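/- **Setting.** Let $\tau:E\to Q$ be a Lie algebroid (smooth vector bundle of finite rank over a finite-dimensional smooth manifold without boundary) with anchor $\rho$ and bracket $[\![\cdot,\cdot]\!]$. For a fibration $\pi:P\to Q$ let $\mathcal T^EP\to P$ be the prolongation of $E$ over $\pi$, i.e. the Lie algebroid with fibres $\mathcal T^E_pP=\{(b,v)\in E_{\pi(p)}\times T_pP:\rho(b)=T_p\pi(v)\}$, anchor $\rho^\pi(b,v)=v$, and bracket determined by $[\![(X_1,U_1),(X_2,U_2)]\!]^\pi=([\![X_1,X_2]\!],[U_1,U_2])$ on projectable sections. On $\mathcal T^EE$ let $S(b,v)=(0,b^{V}_e)$ be the vertical endomorphism and $\Delta(e)=(0,e^V_e)$ the Euler section, where $b^V_e\in T_eE$ is the vertical lift of $b\in E_{\tau(e)}$ at $e$. For a smooth function $L:E\to\mathbb R$ put $\theta_L=S^*(d^{\mathcal T^EE}L)$, $\omega_L=-d^{\mathcal T^EE}\theta_L$, $E_L=\rho^\tau(\Delta)(L)-L$, let $leg_L:E\to E^*$, $leg_L(e)(b)=dL(b^V_e)$, be the Legendre transformation and $\mathcal T leg_L(b,v)=(b,T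 leg_L(v))$ its prolongation $\mathcal T^EE\to\mathcal T^EE^*$. Assume that $L$ is almost regular: $M_1=leg_L(E)$ is an embedded submanifold of $E^*$ and $leg_L:E\to M_1$ is a submersion with connected fibres. Let $E_0=E$ and, inductively, $$E_{j+1}=\{e\in E_j:\ \exists z\in\mathcal T^E_eE,\ \rho^\tau(z)\in T_eE_j,\ i_z\omega_L(e)=d^{\mathcal T^EE}E_L(e)\},\qquad (\mathcal T^EE)_j=(\rho^\tau)^{-1}(TE_j).$$ Assume that for every $j\le k$ the set $E_j$ is an embedded submanifold of $E$ and $(\mathcal T^EE)_j\to E_j$ is a vector bundle, and that $E_{k+1}=E_k$. Put $M_{k+1}=leg_L(E_k)$ and $(\mathcal T^EM_1)_k=(\rho^{\tau^*})^{-1}(TM_{k+1})\subseteq\mathcal T^EE^*$, where $\rho^{\tau^*}$ is the anchor of $\mathcal T^EE^*$, and let $leg_{k+1}:E_k\to M_{k+1}$ and $Leg_{k+1}:(\mathcal T^EE)_k\to(\mathcal T^EM_1)_k$ be the restrictions of $leg_L$ and $\mathcal T leg_L$. **Theorem.** Let $X\in\Gamma((\mathcal T^EE)_k)$ be a section over $E_k$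 such that $(i_X\omega_L)_{|E_k}=(d^{\mathcal T^EE}E_L)_{|E_k}$ and such that $X$ is $(Leg_{k+1},leg_{k+1})$-projectable, i.e. there is $Y\in\Gamma((\mathcal T^EM_1)_k)$ with $Y\circ leg_{k+1}=Leg_{k+1}\circ X$. Then: (i) The set $S^X=\{e\in E_k:\ (SX)(e)=\Delta(e)\}$ is an embedded submanifold (of $E$, contained in $E_k$), and it is the image of a smooth section $M_{k+1}\to E_k$ of $leg_{k+1}$. (ii) $M_{k+1}$ is an embedded submanifold of $E^*$ and $(\mathcal T^EM_1)_k\to M_{k+1}$ is a Lie subalgebroid of $\mathcal T^EE^*$. There is a Lie subalgebroid $A^X\subseteq(\mathcal T^EE)_k$ over $S^X$ such that the restrictions $Leg_{A^X}:A^X\to(\mathcal T^EM_1)_k$ and $leg_{S^X}:S^X\to M_{k+1}$ of $Leg_{k+1}$ and $leg_{k+1}$ form a Lie algebroid isomorphism. -/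

import Mathlib

open Set Filter Topology Bundle Manifold
open scoped ContDiff Manifold Topology Bundle

noncomputable section

namespace LieAlgd

/-! ### Embedded submanifolds, described as subsets of an ambient manifold -/

section Submanifolds

variable {V H N : Type*} [NormedAddCommGroup V] [NormedSpace ℝ V] [TopologicalSpace H]
  (J : ModelWithCorners ℝ V H) [TopologicalSpace N] [ChartedSpace H N]

/-- `S` is an embedded submanifold of `N`: around each of its points there is a chart of `N` (from
the maximal smooth atlas) in which `S` is cut out by an affine subspace (a slice chart). -/
def IsEmbeddedSubmanifold (S : Set N) : Prop :=
  ∀ p ∈ S, ∃ φ ∈ IsManifold.maximalAtlas J ∞ N, p ∈ φ.source ∧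
    ∃ W : Submodule ℝ V, ∀ q ∈ φ.source, q ∈ S ↔ φ.extend J q - φ.extend J p ∈ W

/-- The tangent space `T_p S ⊆ T_p N` of a subset `S` of `N`: the velocities at time `0` of the
smooth curves through `p` that stay in `S`. -/
def tangentTo (S : Set N) (p : N) : Set (TangentSpace J p) :=
  {v | ∃ γ : ℝ → N, γ 0 = p ∧ ContMDiffAt 𝓘(ℝ, ℝ) J ∞ γ 0 ∧ (∀ᶠ t in 𝓝 (0 : ℝ), γ t ∈ S) ∧
    mfderiv 𝓘(ℝ, ℝ) J γ 0 (1 : ℝ) = v}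

/-- The derivative `v(f)` of a real function `f` along a tangent vector `v`. -/
def dirDeriv {p : N} (v : TangentSpace J p) (f : N → ℝ) : ℝ :=
  mfderiv J 𝓘(ℝ, ℝ) f p v

end Submanifolds

/-! ### Lie algebroids -/

section Algebroid

variable (B F : Type*) {Q : Type*} [NormedAddCommGroup B] [NormedSpace ℝ B]
  [NormedAddCommGroup F] [NormedSpace ℝ F]
  [TopologicalSpace Q] [ChartedSpace B Q] [IsManifold 𝓘(ℝ, B) ∞ Q]
  (E : Q → Type*) [∀ x, AddCommGroup (E x)] [∀ x, Module ℝ (E x)] [∀ x, TopologicalSpace (E x)]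
  [TopologicalSpace (TotalSpace F E)] [FiberBundle F E] [VectorBundle ℝ F E]
  [ContMDiffVectorBundle ∞ F E 𝓘(ℝ, B)]

/-- A Lie algebroid structure on the smooth vector bundle `E → Q`: a smooth bundle map
`ρ : E → TQ` (the anchor) and a real Lie bracket on the space `Γ(E)` of smooth sections such that
`⟦X, f Y⟧ = f ⟦X, Y⟧ + ρ(X)(f) Y`. -/
structure LieAlgebroid where
  /-- the anchor map -/
  anchor : ∀ x : Q, E x →L[ℝ] TangentSpace 𝓘(ℝ, B) x
  contMDiff_anchor : ContMDiff (𝓘(ℝ, B).prod 𝓘(ℝ, F)) 𝓘(ℝ, B).tangent ∞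
    (fun e : TotalSpace F E => (⟨e.1, anchor e.1 e.2⟩ : TangentBundle 𝓘(ℝ, B) Q))
  /-- the Lie bracket of sections -/
  bracket : Cₛ^∞⟮𝓘(ℝ, B); F, E⟯ → Cₛ^∞⟮𝓘(ℝ, B); F, E⟯ → Cₛ^∞⟮𝓘(ℝ, B); F, E⟯
  bracket_add_left : ∀ X X' Y, bracket (X + X') Y = bracket X Y + bracket X' Y
  bracket_smul_left : ∀ (c : ℝ) X Y, bracket (c • X) Y = c • bracket X Y
  bracket_skew : ∀ X Y, bracket X Y = -bracket Y X
  jacobi : ∀ X Y Z,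
    bracket X (bracket Y Z) + bracket Y (bracket Z X) + bracket Z (bracket X Y) = 0
  leibniz : ∀ (f : Q → ℝ), ContMDiff 𝓘(ℝ, B) 𝓘(ℝ, ℝ) ∞ f →
    ∀ X Y fY : Cₛ^∞⟮𝓘(ℝ, B); F, E⟯, (∀ x, fY x = f x • Y x) →
      ∀ x, bracket X fY x =
        f x • bracket X Y x + dirDeriv 𝓘(ℝ, B) (anchor x (X x)) f • Y x

end Algebroid

/-! ### The prolongation `𝒯^E N` of a Lie algebroid `E → Q` over a map `pr : N → Q`

An element of `𝒯^E N` over `p : N` is a pair `(b, v)` in `E_{pr(p)} × T_p N` with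
`ρ(b) = T_p pr (v)`; its anchor is `v`. -/

section Prolongation

variable {B F Q : Type*} [NormedAddCommGroup B] [NormedSpace ℝ B]
  [NormedAddCommGroup F] [NormedSpace ℝ F]
  [TopologicalSpace Q] [ChartedSpace B Q] [IsManifold 𝓘(ℝ, B) ∞ Q]
  {E : Q → Type*} [∀ x, AddCommGroup (E x)] [∀ x, Module ℝ (E x)] [∀ x, TopologicalSpace (E x)]
  [TopologicalSpace (TotalSpace F E)] [FiberBundle F E] [VectorBundle ℝ F E]
  [ContMDiffVectorBundle ∞ F E 𝓘(ℝ, B)]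
  {V H N : Type*} [NormedAddCommGroup V] [NormedSpace ℝ V] [TopologicalSpace H]
  [TopologicalSpace N] [ChartedSpace H N] (J : ModelWithCorners ℝ V H) [IsManifold J ∞ N]
  {V' H' N' : Type*} [NormedAddCommGroup V'] [NormedSpace ℝ V'] [TopologicalSpace H']
  [TopologicalSpace N'] [ChartedSpace H' N']
  (J' : ModelWithCorners ℝ V' H') [IsManifold J' ∞ N']

/-- The fibre `𝒯^E_p N = {(b, v) ∈ E_{pr(p)} × T_p N | ρ(b) = T_p pr (v)}`. -/
def prolongation (A : LieAlgebroid B F E) (pr : N → Q) (p : N) :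
    Submodule ℝ (E (pr p) × TangentSpace J p) where
  carrier := {z | A.anchor (pr p) z.1 = mfderiv J 𝓘(ℝ, B) pr p z.2}
  add_mem' := by
    intro a b ha hb
    simp only [mem_ofPred_eq] at ha hb
    simp only [mem_ofPred_eq, Prod.fst_add, Prod.snd_add, map_add, ha, hb]
  zero_mem' := by simp
  smul_mem' := by
    intro c a ha
    simp only [mem_ofPred_eq] at ha
    simp only [mem_ofPred_eq, Prod.smul_fst, Prod.smul_snd, map_smul, ha]

/-- `(ρ^pr)⁻¹(T S)` over a point `p` of a subset `S` of `N`: the elements of `𝒯^E_p N` whose anchor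
is tangent to `S`. -/
def prolongationTo (A : LieAlgebroid B F E) (pr : N → Q) (S : Set N)
    (p : N) : Set (E (pr p) × TangentSpace J p) :=
  {z | z ∈ prolongation J A pr p ∧ z.2 ∈ tangentTo J S p}

variable (B F) in
/-- `Z = (b, U)`, with `b(p) ∈ E_{pr(p)}` and `U(p) ∈ T_p N`, is smooth along `S ⊆ N`, as a map from
`S` to `E × T N`. -/
def SmoothAlong (pr : N → Q) (S : Set N)
    (Z : ∀ p : N, E (pr p) × TangentSpace J p) : Prop :=
  ContMDiffOn J (𝓘(ℝ, B).prod 𝓘(ℝ, F)) ∞ (fun p => (⟨pr p, (Z p).1⟩ : TotalSpace F E)) S ∧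
  ContMDiffOn J J.tangent ∞ (fun p => (⟨p, (Z p).2⟩ : TangentBundle J N)) S

/-- `Z` is a smooth section of `𝒯^E N → N`. -/
def IsSection (A : LieAlgebroid B F E) (pr : N → Q)
    (Z : ∀ p : N, E (pr p) × TangentSpace J p) : Prop :=
  (∀ p, Z p ∈ prolongation J A pr p) ∧ SmoothAlong B F J pr univ Z

/-- `b` is the `E`-component at `p` of the bracket of the sections `Z₁ = (b₁, U₁)` and
`Z₂ = (b₂, U₂)` of `𝒯^E N`: if `b₁ = ∑ fᵢ (sᵢ ∘ pr)` and `b₂ = ∑ gᵢ (sᵢ ∘ pr)` near `p` with `sᵢ` in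
`Γ(E)`, it is `∑ fᵢ gⱼ ⟦sᵢ, sⱼ⟧ ∘ pr + ∑ U₁(gⱼ) (sⱼ ∘ pr) - ∑ U₂(fᵢ) (sᵢ ∘ pr)`. For projectable
sections `Zᵢ = (Xᵢ, Uᵢ)`, with `Xᵢ` in `Γ(E)`, this is `⟦X₁, X₂⟧ ∘ pr`; the general case is forced by
the Leibniz rule. -/
def IsBracketFst (A : LieAlgebroid B F E) (pr : N → Q)
    (Z₁ Z₂ : ∀ p : N, E (pr p) × TangentSpace J p) (p : N) (b : E (pr p)) : Prop :=
  ∃ (r : ℕ) (s : Fin r → Cₛ^∞⟮𝓘(ℝ, B); F, E⟯) (f g : Fin r → N → ℝ),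
    (∀ i, ContMDiff J 𝓘(ℝ, ℝ) ∞ (f i)) ∧ (∀ i, ContMDiff J 𝓘(ℝ, ℝ) ∞ (g i)) ∧
    (∀ᶠ q in 𝓝 p, (Z₁ q).1 = ∑ i, f i q • s i (pr q)) ∧
    (∀ᶠ q in 𝓝 p, (Z₂ q).1 = ∑ i, g i q • s i (pr q)) ∧
    b = ∑ i, ∑ j, (f i p * g j p) • A.bracket (s i) (s j) (pr p)
      + ∑ j, dirDeriv J (Z₁ p).2 (g j) • s j (pr p)
      - ∑ i, dirDeriv J (Z₂ p).2 (f i) • s i (pr p)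

/-- The Lie bracket `⟦Z₁, Z₂⟧^pr` of two smooth sections of `𝒯^E N`. -/
def prolongationBracket (A : LieAlgebroid B F E) (pr : N → Q)
    (Z₁ Z₂ : ∀ p : N, E (pr p) × TangentSpace J p) (p : N) : E (pr p) × TangentSpace J p :=
  (Classical.epsilon (IsBracketFst J A pr Z₁ Z₂ p),
    VectorField.mlieBracket J (fun q => (Z₁ q).2) (fun q => (Z₂ q).2) p)

/-- The differential `d^{𝒯^E N} θ` of a 1-section `θ` of `(𝒯^E N)^*`, at `z₁, z₂ ∈ 𝒯^E_p N`: for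
any smooth sections `Z₁, Z₂` of `𝒯^E N` through `z₁, z₂`, it is the value at `p` of
`ρ^pr(Z₁)(θ(Z₂)) - ρ^pr(Z₂)(θ(Z₁)) - θ(⟦Z₁, Z₂⟧^pr)`. -/
def differential (A : LieAlgebroid B F E) (pr : N → Q)
    (θ : ∀ p : N, E (pr p) × TangentSpace J p → ℝ) (p : N) (z₁ z₂ : E (pr p) × TangentSpace J p) :
    ℝ :=
  Classical.epsilon fun c : ℝ => ∃ Z₁ Z₂ : ∀ p : N, E (pr p) × TangentSpace J p,
    IsSection J A pr Z₁ ∧ IsSection J A pr Z₂ ∧ Z₁ p = z₁ ∧ Z₂ p = z₂ ∧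
    c = dirDeriv J z₁.2 (fun q => θ q (Z₂ q))
      - dirDeriv J z₂.2 (fun q => θ q (Z₁ q))
      - θ p (prolongationBracket J A pr Z₁ Z₂ p)

variable (B F) in
/-- The family of fibres `D p`, for `p` in `S`, is a smooth vector bundle over the submanifold `S`:
near each point of `S` it has a local frame that is smooth along `S`. -/
def IsSubbundle (pr : N → Q) (S : Set N)
    (D : ∀ p : N, Set (E (pr p) × TangentSpace J p)) : Prop :=
  ∀ p ∈ S, ∃ U : Set N, IsOpen U ∧ p ∈ U ∧
    ∃ (r : ℕ) (s : Fin r → ∀ p : N, E (pr p) × TangentSpace J p),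
      (∀ i, SmoothAlong B F J pr (S ∩ U) (s i)) ∧
      ∀ q ∈ S ∩ U, LinearIndependent ℝ (fun i => s i q) ∧
        D q = Submodule.span ℝ (range fun i => s i q)

/-- `D → S` is a Lie subalgebroid of `𝒯^E N → N` over the embedded submanifold `S`: a vector
subbundle of the restriction of `𝒯^E N` to `S`, whose anchor is tangent to `S`, and such that the
bracket of (local extensions of) sections of `D` is again in `D`. -/
structure IsLieSubalgebroid (A : LieAlgebroid B F E) (pr : N → Q)
    (S : Set N) (D : ∀ p : N, Set (E (pr p) × TangentSpace J p)) : Prop where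
  submanifold : IsEmbeddedSubmanifold J S
  subbundle : IsSubbundle B F J pr S D
  subset : ∀ p ∈ S, D p ⊆ prolongation J A pr p
  anchor_tangent : ∀ p ∈ S, ∀ z ∈ D p, z.2 ∈ tangentTo J S p
  bracket_mem : ∀ p ∈ S, ∀ Z₁ Z₂, IsSection J A pr Z₁ → IsSection J A pr Z₂ →
    (∀ᶠ q in 𝓝[S] p, Z₁ q ∈ D q) → (∀ᶠ q in 𝓝[S] p, Z₂ q ∈ D q) →
    prolongationBracket J A pr Z₁ Z₂ p ∈ D p

/-- Given Lie subalgebroids `D → S` of `𝒯^E N → N` and `D' → S'` of `𝒯^E N' → N'`, the bundle map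
`(Φ, φ)` restricts to a Lie algebroid isomorphism from `D → S` onto `D' → S'`: a vector bundle
isomorphism over a diffeomorphism that commutes with the anchors and with the brackets. (A section
`Z'` of `D'` is the image of the section `Z` of `D` if `Φ ∘ Z = Z' ∘ φ`; the bracket of two sections
of `D` at a point is computed by extending them locally to sections of `𝒯^E N`.) -/
structure IsLieAlgebroidIso (A : LieAlgebroid B F E) (pr : N → Q) (pr' : N' → Q)
    (S : Set N) (D : ∀ p : N, Set (E (pr p) × TangentSpace J p))
    (S' : Set N') (D' : ∀ p : N', Set (E (pr' p) × TangentSpace J' p))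
    (φ : N → N')
    (Φ : ∀ p : N, (E (pr p) × TangentSpace J p) →ₗ[ℝ] (E (pr' (φ p)) × TangentSpace J' (φ p))) :
    Prop where
  bijOn_base : BijOn φ S S'
  smooth_base : ContMDiffOn J J' ∞ φ S
  smooth_base_inv : ∃ ψ : N' → N, ContMDiffOn J' J ∞ ψ S' ∧ ∀ p ∈ S, ψ (φ p) = p
  bijOn_fibre : ∀ p ∈ S, BijOn (Φ p) (D p) (D' (φ p))
  smooth_iff : ∀ Z Z', (∀ p ∈ S, Z p ∈ D p) → (∀ p ∈ S, Φ p (Z p) = Z' (φ p)) →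
    (SmoothAlong B F J pr S Z ↔ SmoothAlong B F J' pr' S' Z')
  map_anchor : ∀ p ∈ S, ∀ z ∈ D p, (Φ p z).2 = mfderiv J J' φ p z.2
  map_bracket : ∀ p ∈ S, ∀ Z₁ Z₂ Z₁' Z₂', IsSection J A pr Z₁ → IsSection J A pr Z₂ →
    IsSection J' A pr' Z₁' → IsSection J' A pr' Z₂' →
    (∀ᶠ q in 𝓝[S] p, Z₁ q ∈ D q ∧ Φ q (Z₁ q) = Z₁' (φ q)) →
    (∀ᶠ q in 𝓝[S] p, Z₂ q ∈ D q ∧ Φ q (Z₂ q) = Z₂' (φ q)) →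
    Φ p (prolongationBracket J A pr Z₁ Z₂ p) = prolongationBracket J' A pr' Z₁' Z₂' (φ p)

end Prolongation

/-! ### Lagrangian mechanics on `𝒯^E E` and the Legendre transformation -/

section Lagrangian

variable {B F Q : Type*} [NormedAddCommGroup B] [NormedSpace ℝ B]
  [NormedAddCommGroup F] [NormedSpace ℝ F]
  [TopologicalSpace Q] [ChartedSpace B Q] [IsManifold 𝓘(ℝ, B) ∞ Q]
  {E : Q → Type*} [∀ x, AddCommGroup (E x)] [∀ x, Module ℝ (E x)] [∀ x, TopologicalSpace (E x)]
  [TopologicalSpace (TotalSpace F E)] [FiberBundle F E] [VectorBundle ℝ F E]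
  [ContMDiffVectorBundle ∞ F E 𝓘(ℝ, B)]

variable (B F) in
/-- The model of the manifold `E`. -/
abbrev IE : ModelWithCorners ℝ (B × F) (ModelProd B F) := 𝓘(ℝ, B).prod 𝓘(ℝ, F)

variable (B F) in
/-- The model of the manifold `E^*`. -/
abbrev IEd : ModelWithCorners ℝ (B × (F →L[ℝ] ℝ)) (ModelProd B (F →L[ℝ] ℝ)) :=
  𝓘(ℝ, B).prod 𝓘(ℝ, F →L[ℝ] ℝ)

variable (E) in
/-- The fibres of the dual bundle `E^*`. -/
abbrev Dual (x : Q) : Type _ := E x →L[ℝ] Bundle.Trivial Q ℝ x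

variable (B) in
/-- The vertical lift `b ↦ b^V_e` from `E_x` to `T_e E`, for `e ∈ E_x`: the derivative at `e` of the
inclusion of `E_x` in `E` (with `E_x` identified with the model fibre `F` through the preferred
trivialization at `x`). -/
def vertLift (e : TotalSpace F E) : E e.1 →L[ℝ] TangentSpace (IE B F) e :=
  (mfderiv 𝓘(ℝ, F) (IE B F)
    (fun f : F => (⟨e.1, (trivializationAt F E e.1).symmL ℝ e.1 f⟩ : TotalSpace F E))
    ((trivializationAt F E e.1).continuousLinearMapAt ℝ e.1 e.2)).comp
  ((trivializationAt F E e.1).continuousLinearMapAt ℝ e.1)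

variable (B) in
/-- The vertical endomorphism `S (b, v) = (0, b^V_e)`. -/
def vertEndo (e : TotalSpace F E) (z : E e.1 × TangentSpace (IE B F) e) :
    E e.1 × TangentSpace (IE B F) e :=
  (0, vertLift B e z.1)

variable (B) in
/-- The Euler section `Δ(e) = (0, e^V_e)`. -/
def euler (e : TotalSpace F E) : E e.1 × TangentSpace (IE B F) e :=
  (0, vertLift B e e.2)

variable (B) in
/-- The differential `d^{𝒯^E E} f` of a function `f` on `E`: `(b, v) ↦ v(f)`. -/
def dFun (f : TotalSpace F E → ℝ) (e : TotalSpace F E) (z : E e.1 × TangentSpace (IE B F) e) : ℝ :=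
  dirDeriv (IE B F) z.2 f

variable (B) in
/-- The Cartan 1-section `θ_L = S^*(d^{𝒯^E E} L)`. -/
def cartanOne (L : TotalSpace F E → ℝ) (e : TotalSpace F E)
    (z : E e.1 × TangentSpace (IE B F) e) : ℝ :=
  dFun B L e (vertEndo B e z)

/-- The Cartan 2-section `ω_L = -d^{𝒯^E E} θ_L`. -/
def cartanTwo (A : LieAlgebroid B F E) (L : TotalSpace F E → ℝ) (e : TotalSpace F E)
    (z₁ z₂ : E e.1 × TangentSpace (IE B F) e) : ℝ :=
  -differential (IE B F) A TotalSpace.proj (cartanOne B L) e z₁ z₂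

variable (B) in
/-- The Lagrangian energy `E_L = ρ^τ(Δ)(L) - L`. -/
def energy (L : TotalSpace F E → ℝ) (e : TotalSpace F E) : ℝ :=
  dFun B L e (euler B e) - L e

variable (B) in
/-- The Legendre transformation `leg_L : E → E^*`, `leg_L(e)(e') = θ_L(e)(z') = dL(e'^V_e)` for
every `z'` in `𝒯^E_e E` with `pr₁(z') = e'`. -/
def leg (L : TotalSpace F E → ℝ) (e : TotalSpace F E) : TotalSpace (F →L[ℝ] ℝ) (Dual E) :=
  ⟨e.1, (mfderiv (IE B F) 𝓘(ℝ, ℝ) L e).comp (vertLift B e)⟩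

variable (B) in
/-- The prolonged Legendre transformation `(b, v) ↦ (b, T leg_L (v))` from `𝒯^E_e E` to
`𝒯^E_{leg_L(e)} E^*`. -/
def prolongedLeg (L : TotalSpace F E → ℝ) (e : TotalSpace F E) :
    (E e.1 × TangentSpace (IE B F) e) →ₗ[ℝ]
      (E (leg B L e).1 × TangentSpace (IEd B F) (leg B L e)) :=
  LinearMap.prodMap (LinearMap.id (R := ℝ) (M := E e.1))
    (mfderiv (IE B F) (IEd B F) (leg B L) e).toLinearMap

variable (B) in
/-- `L` is almost regular: `M₁ = leg_L(E)` is an embedded submanifold of `E^*` and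
`leg_L : E → M₁` is a submersion with connected fibres. -/
structure IsAlmostRegular (L : TotalSpace F E → ℝ) : Prop where
  submanifold : IsEmbeddedSubmanifold (IEd B F) (range (leg B L))
  submersion : ∀ e, ∀ v ∈ tangentTo (IEd B F) (range (leg B L)) (leg B L e),
    ∃ w : TangentSpace (IE B F) e, mfderiv (IE B F) (IEd B F) (leg B L) e w = v
  connected : ∀ m ∈ range (leg B L), IsConnected (leg B L ⁻¹' {m})

/-- The sequence `E = E_0 ⊇ E_1 ⊇ E_2 ⊇ ⋯` of the constraint algorithm for the equation
`i_X ω_L = d E_L`: `E_{j+1}` is the set of the points `e` of `E_j` at which the equation has a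
solution in `(ρ^τ)⁻¹(T_e E_j)`. -/
def constraintSet (A : LieAlgebroid B F E) (L : TotalSpace F E → ℝ) : ℕ → Set (TotalSpace F E)
  | 0 => univ
  | j + 1 => {e | e ∈ constraintSet A L j ∧
      ∃ z ∈ prolongationTo (IE B F) A TotalSpace.proj (constraintSet A L j) e,
        ∀ z' ∈ prolongation (IE B F) A TotalSpace.proj e,
          cartanTwo A L e z z' = dFun B (energy B L) e z'}

/-- `(𝒯^E E)_j = (ρ^τ)⁻¹(T E_j)`. -/
def constraintBundle (A : LieAlgebroid B F E) (L : TotalSpace F E → ℝ) (j : ℕ)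
    (e : TotalSpace F E) : Set (E e.1 × TangentSpace (IE B F) e) :=
  prolongationTo (IE B F) A TotalSpace.proj (constraintSet A L j) e

/-- The image `M_{k+1} = leg_L(E_k)` of the `k`-th constraint submanifold. -/
def legConstraintSet (A : LieAlgebroid B F E) (L : TotalSpace F E → ℝ) (k : ℕ) :
    Set (TotalSpace (F →L[ℝ] ℝ) (Dual E)) :=
  leg B L '' constraintSet A L k

/-- `(𝒯^E M₁)_k = (ρ^{τ^*})⁻¹(T M_{k+1})`. -/
def legConstraintBundle (A : LieAlgebroid B F E) (L : TotalSpace F E → ℝ) (k : ℕ)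
    (m : TotalSpace (F →L[ℝ] ℝ) (Dual E)) : Set (E m.1 × TangentSpace (IEd B F) m) :=
  prolongationTo (IEd B F) A TotalSpace.proj (legConstraintSet A L k) m

/-- The set `S^X = {e ∈ E_k | (S X)(e) = Δ(e)}`. -/
def sodeSet (A : LieAlgebroid B F E) (L : TotalSpace F E → ℝ) (k : ℕ)
    (X : ∀ e : TotalSpace F E, E e.1 × TangentSpace (IE B F) e) : Set (TotalSpace F E) :=
  {e | e ∈ constraintSet A L k ∧ vertEndo B e (X e) = euler B e}

end Lagrangian

end LieAlgd

end

open LieAlgd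

open Set Filter Topology Bundle Manifold
open scoped ContDiff Manifold Topology Bundle

noncomputable section

/-! Vertical lifts are injective, so `(SX)(e) = Δ(e)` says that the `E`-component of `X e` is `e`
itself. The map `𝒯leg` leaves `E`-components unchanged, so projectability makes this component a
function of `m = leg e`, namely `(Y m).1`. Over `m` the only candidate for a point of `S^X` is
therefore `W m = (Y m).1`, which is smooth in `m` because `Y` is. Part (i) amounts to the claim that
`W m` lies on the fibre of `leg` over `m` (`leg_fst_of_projectable`).

Testing the dynamical equation on vertical vectors shows that the fibrewise Hessian of `L` at `e`
annihilates `(X e).1 - e` (`mfderiv_leg_vertLift_of_solution`). So at every point `e` of the fibre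
over `m` the vertical vector pointing from `e` to `W m` is tangent to that fibre. The fibre is a
closed subset of the vector space `E_x`, hence has a point nearest to `W m`; if the two were
distinct, one could move along the fibre straight towards `W m` and get closer. This is
`leg_eq_of_forall_vertLift`.

The argument needs the equation on the whole fibre, that is, `E_k` must be a union of fibres of
`leg` (`constraintSet_saturated`). In a frame, `ω_L` is built from the momenta `e ↦ leg(e)(s_a)` and
their derivatives (`cartanTwo_eq`), so it depends only on data downstairs. The derivative of `E_L`
vanishes along the connected fibres, so `E_L` descends as well (`energy_congr`). Since `leg` has
smooth local sections, a solution at one point of a fibre is transported to any other, and induction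
on `j` applies.

For (ii), saturation and local sections carry the submanifold `E_k`, and frames of its bundle, down
to `M_{k+1}`; the kernel of `T leg` is tangent to `E_k` and has locally constant dimension, so the
image bundle has constant rank locally. `A^X` consists of the elements whose anchor is tangent to
`S^X`. On it `𝒯leg` is inverted by the derivative of a local extension of `W`, and it respects
brackets because a bracket at a point of a submanifold is determined by values along the submanifold
when both anchors are tangent to it. -/

namespace LieAlgd

/-! ### Tangent vectors as derivations of smooth functions. -/

section Derivations

variable {V H N : Type*} [NormedAddCommGroup V] [NormedSpace ℝ V] [TopologicalSpace H]
  {J : ModelWithCorners ℝ V H} [TopologicalSpace N] [ChartedSpace H N]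
  {V' H' N' : Type*} [NormedAddCommGroup V'] [NormedSpace ℝ V'] [TopologicalSpace H']
  {J' : ModelWithCorners ℝ V' H'} [TopologicalSpace N'] [ChartedSpace H' N']

theorem dirDeriv_congr {p : N} (v : TangentSpace J p) {f g : N → ℝ} (h : f =ᶠ[𝓝 p] g) :
    dirDeriv J v f = dirDeriv J v g := by
  unfold dirDeriv
  rw [h.mfderiv_eq]
  rfl

theorem dirDeriv_mfderiv {p : N} (v : TangentSpace J p) {f : N → N'} {g : N' → ℝ}
    (hf : MDifferentiableAt J J' f p) (hg : MDifferentiableAt J' 𝓘(ℝ, ℝ) g (f p)) :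
    dirDeriv J' (mfderiv J J' f p v) g = dirDeriv J v (fun q => g (f q)) := by
  have := mfderiv_comp p hg hf
  unfold dirDeriv
  change _ = mfderiv J 𝓘(ℝ, ℝ) (g ∘ f) p v
  rw [this]
  rfl

theorem dirDeriv_add {p : N} (v : TangentSpace J p) {f g : N → ℝ}
    (hf : MDifferentiableAt J 𝓘(ℝ, ℝ) f p) (hg : MDifferentiableAt J 𝓘(ℝ, ℝ) g p) :
    dirDeriv J v (fun q => f q + g q) = dirDeriv J v f + dirDeriv J v g := by
  have := (hf.hasMFDerivAt.add hg.hasMFDerivAt).mfderiv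
  unfold dirDeriv
  change mfderiv J 𝓘(ℝ, ℝ) (f + g) p v = _
  rw [this]
  rfl

theorem dirDeriv_mul {p : N} (v : TangentSpace J p) {f g : N → ℝ}
    (hf : MDifferentiableAt J 𝓘(ℝ, ℝ) f p) (hg : MDifferentiableAt J 𝓘(ℝ, ℝ) g p) :
    dirDeriv J v (fun q => f q * g q) = dirDeriv J v f * g p + f p * dirDeriv J v g := by
  have := (hf.hasMFDerivAt.mul hg.hasMFDerivAt).mfderiv
  unfold dirDeriv
  change mfderiv J 𝓘(ℝ, ℝ) (f * g) p v = _
  rw [this]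
  change f p * dirDeriv J v g + g p * dirDeriv J v f = _
  rw [add_comm, mul_comm (g p)]
  rfl

theorem dirDeriv_const {p : N} (v : TangentSpace J p) (c : ℝ) :
    dirDeriv J v (fun _ => c) = 0 := by
  unfold dirDeriv
  rw [mfderiv_const]
  rfl

theorem mdifferentiableAt_finset_sum {ι : Type*} (s : Finset ι) {p : N} {f : ι → N → ℝ}
    (hf : ∀ i ∈ s, MDifferentiableAt J 𝓘(ℝ, ℝ) (f i) p) :
    MDifferentiableAt J 𝓘(ℝ, ℝ) (fun q => ∑ i ∈ s, f i q) p := by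
  classical
  induction s using Finset.induction_on with
  | empty => simpa using mdifferentiableAt_const
  | insert a s ha ih =>
    simp only [Finset.sum_insert ha]
    exact (hf a (by simp)).add (ih fun i hi => hf i (by simp [hi]))

theorem dirDeriv_sum {ι : Type*} (s : Finset ι) {p : N} (v : TangentSpace J p) {f : ι → N → ℝ}
    (hf : ∀ i ∈ s, MDifferentiableAt J 𝓘(ℝ, ℝ) (f i) p) :
    dirDeriv J v (fun q => ∑ i ∈ s, f i q) = ∑ i ∈ s, dirDeriv J v (f i) := by
  classical
  induction s using Finset.induction_on with
  | empty => simpa using dirDeriv_const v 0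
  | insert a s ha ih =>
    simp only [Finset.sum_insert ha]
    rw [← ih fun i hi => hf i (by simp [hi])]
    exact dirDeriv_add v (hf a (by simp))
      (mdifferentiableAt_finset_sum s fun i hi => hf i (by simp [hi]))

@[simp] theorem dirDeriv_vec_add {p : N} (v w : TangentSpace J p) (f : N → ℝ) :
    dirDeriv J (v + w) f = dirDeriv J v f + dirDeriv J w f :=
  map_add (mfderiv J 𝓘(ℝ, ℝ) f p) v w

@[simp] theorem dirDeriv_vec_sub {p : N} (v w : TangentSpace J p) (f : N → ℝ) :
    dirDeriv J (v - w) f = dirDeriv J v f - dirDeriv J w f :=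
  map_sub (mfderiv J 𝓘(ℝ, ℝ) f p) v w

@[simp] theorem dirDeriv_vec_smul {p : N} (c : ℝ) (v : TangentSpace J p) (f : N → ℝ) :
    dirDeriv J (c • v) f = c * dirDeriv J v f :=
  map_smul (mfderiv J 𝓘(ℝ, ℝ) f p) c v

@[simp] theorem dirDeriv_vec_zero {p : N} (f : N → ℝ) :
    dirDeriv J (0 : TangentSpace J p) f = 0 :=
  map_zero (mfderiv J 𝓘(ℝ, ℝ) f p)

theorem dirDeriv_vec_sum {ι : Type*} (s : Finset ι) {p : N} (v : ι → TangentSpace J p)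
    (f : N → ℝ) : dirDeriv J (∑ i ∈ s, v i) f = ∑ i ∈ s, dirDeriv J (v i) f :=
  map_sum (mfderiv J 𝓘(ℝ, ℝ) f p) v s

/-- Two tangent vectors agree if they agree as derivations on locally defined smooth functions. -/
theorem tangent_ext [FiniteDimensional ℝ V] [IsManifold J ∞ N] {p : N} {v w : TangentSpace J p}
    (h : ∀ (g : N → ℝ) (U : Set N), IsOpen U → p ∈ U → ContMDiffOn J 𝓘(ℝ, ℝ) ∞ g U →
      dirDeriv J v g = dirDeriv J w g) : v = w := by
  have : IsManifold J 1 N := IsManifold.of_le (n := ∞) (by simp)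
  have hinv := isInvertible_mfderiv_extChartAt (I := J) (mem_extChartAt_source p)
  obtain ⟨e, he⟩ := hinv
  have hd : MDifferentiableAt J 𝓘(ℝ, V) (extChartAt J p) p :=
    (contMDiffAt_extChartAt (n := 1)).mdifferentiableAt (by simp)
  -- Linear functionals of a chart are enough test functions, since they separate points of `V`.
  have key : ∀ l : V →L[ℝ] ℝ, l (e v) = l (e w) := by
    intro l
    have := h (fun q => l (extChartAt J p q)) (chartAt H p).source (chartAt H p).open_source
      (mem_chart_source H p)
      (l.contMDiff.comp_contMDiffOn (contMDiffOn_extChartAt (n := ∞)))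
    rw [← dirDeriv_mfderiv v hd l.mdifferentiableAt, ← dirDeriv_mfderiv w hd l.mdifferentiableAt,
      ← he] at this
    unfold dirDeriv at this
    rw [l.mfderiv_eq] at this
    exact this
  have : e v = e w := by
    by_contra hne
    obtain ⟨l, hl⟩ := SeparatingDual.exists_separating_of_ne (R := ℝ) (V := V) hne
    exact hl (key l)
  exact e.injective this

/-- The derivative along the velocity of a curve. -/
theorem dirDeriv_velocity {p : N} {γ : ℝ → N} (h0 : γ 0 = p)
    (hγ : MDifferentiableAt 𝓘(ℝ, ℝ) J γ 0) {g : N → ℝ} (hg : MDifferentiableAt J 𝓘(ℝ, ℝ) g p) :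
    dirDeriv J (p := p) (mfderiv 𝓘(ℝ, ℝ) J γ 0 (1 : ℝ)) g = deriv (fun t => g (γ t)) 0 := by
  subst h0
  rw [dirDeriv_mfderiv (J := 𝓘(ℝ, ℝ)) (p := (0 : ℝ)) (1 : ℝ) hγ hg]
  unfold dirDeriv
  rw [mfderiv_eq_fderiv]
  rfl

theorem exists_bump [FiniteDimensional ℝ V] [T2Space N] [IsManifold J ∞ N]
    {p : N} {U : Set N} (hU : U ∈ 𝓝 p) :
    ∃ χ : N → ℝ, ContMDiff J 𝓘(ℝ, ℝ) ∞ χ ∧ tsupport χ ⊆ U ∧ χ =ᶠ[𝓝 p] fun _ => 1 := by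
  obtain ⟨f, -, hf⟩ := (SmoothBumpFunction.nhds_basis_tsupport (I := J) p).mem_iff.1 hU
  exact ⟨f, f.contMDiff, hf, f.eventuallyEq_one⟩

/-- A locally defined smooth function agrees near a point with a global smooth function. -/
theorem exists_contMDiff_eventuallyEq [FiniteDimensional ℝ V] [T2Space N] [IsManifold J ∞ N]
    {p : N} {U : Set N} (hU : IsOpen U) (hp : p ∈ U) {g : N → ℝ}
    (hg : ContMDiffOn J 𝓘(ℝ, ℝ) ∞ g U) :
    ∃ g' : N → ℝ, ContMDiff J 𝓘(ℝ, ℝ) ∞ g' ∧ g' =ᶠ[𝓝 p] g := by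
  obtain ⟨χ, hχ, hs, h1⟩ := exists_bump (J := J) (hU.mem_nhds hp)
  refine ⟨fun q => χ q * g q, fun q => ?_, ?_⟩
  · by_cases hq : q ∈ U
    · exact hχ.contMDiffAt.mul (hg.contMDiffAt (hU.mem_nhds hq))
    · have hq' : q ∈ (tsupport χ)ᶜ := fun h => hq (hs h)
      refine (contMDiffAt_const (c := (0 : ℝ))).congr_of_eventuallyEq ?_
      filter_upwards [(isClosed_tsupport χ).isOpen_compl.mem_nhds hq'] with x hx
      simp [image_eq_zero_of_notMem_tsupport hx]
  · filter_upwards [h1] with x hx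
    simp [hx]

end Derivations

/-! ### Slice charts and smooth local retractions. -/

section Charts
variable {V H N : Type*} [NormedAddCommGroup V] [NormedSpace ℝ V] [TopologicalSpace H]
  {J : ModelWithCorners ℝ V H} [TopologicalSpace N] [ChartedSpace H N]
  {V' H' N' : Type*} [NormedAddCommGroup V'] [NormedSpace ℝ V'] [TopologicalSpace H']
  {J' : ModelWithCorners ℝ V' H'} [TopologicalSpace N'] [ChartedSpace H' N']

/-- Inverse function theorem: a smooth map with invertible derivative, composed with a preferred
chart, is locally a chart. -/
theorem exists_chart_of_hasFDerivAt [J.Boundaryless] [CompleteSpace V] [IsManifold J ∞ N]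
    {p : N} {f : V → V} {W : Set V} (hW : IsOpen W) (hp : extChartAt J p p ∈ W)
    (hf : ContDiffOn ℝ ∞ f W) {f' : V ≃L[ℝ] V}
    (hf' : HasFDerivAt f (f' : V →L[ℝ] V) (extChartAt J p p)) :
    ∃ φ ∈ IsManifold.maximalAtlas J ∞ N, p ∈ φ.source ∧
      (∀ q ∈ φ.source, q ∈ (chartAt H p).source ∧ extChartAt J p q ∈ W) ∧
      ∀ q ∈ φ.source, φ.extend J q = f (extChartAt J p q) := by
  have hfa : ContDiffAt ℝ ∞ f (extChartAt J p p) := hf.contDiffAt (hW.mem_nhds hp)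
  set G := hfa.toOpenPartialHomeomorph f hf' (by simp) with hG
  have hGc : (G : V → V) = f := rfl
  have hG0 : extChartAt J p p ∈ G.source := hfa.mem_toOpenPartialHomeomorph_source hf' (by simp)
  -- Shrinking to the open set where the derivative stays invertible makes the local inverse smooth
  -- on its entire domain, not only at the image of the base point.
  set D : Set V := W ∩ fderiv ℝ f ⁻¹' (range ((↑) : (V ≃L[ℝ] V) → V →L[ℝ] V)) with hD
  have hDo : IsOpen D :=
    (hf.continuousOn_fderiv_of_isOpen hW (by simp)).isOpen_inter_preimage hW
      (ContinuousLinearEquiv.isOpen)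
  have hD0 : extChartAt J p p ∈ D := ⟨hp, f', hf'.fderiv.symm⟩
  set G' := G.restrOpen D hDo with hG'
  have hG'c : (G' : V → V) = f := rfl
  have hG's : G'.source ⊆ D := fun x hx => hx.2
  have hsymm : ContDiffOn ℝ ∞ G'.symm G'.target := by
    intro y hy
    have hx := G'.map_target hy
    obtain ⟨hxW, e, he⟩ := hG's hx
    have hd : HasFDerivAt G' (e : V →L[ℝ] V) (G'.symm y) := by
      rw [he]
      exact ((hf.contDiffAt (hW.mem_nhds hxW)).differentiableAt (by simp)).hasFDerivAt
    exact (G'.contDiffAt_symm hy hd (hf.contDiffAt (hW.mem_nhds hxW))).contDiffWithinAt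
  let T := J.toHomeomorph.toOpenPartialHomeomorph
  let φ : OpenPartialHomeomorph N H :=
    (((chartAt H p).trans T).trans G').trans T.symm
  have hsrc : ∀ q, q ∈ φ.source ↔ q ∈ (chartAt H p).source ∧ extChartAt J p q ∈ G'.source := by
    intro q
    simp [φ, T]
  have hval : ∀ q, φ q = J.symm (f (extChartAt J p q)) := fun q => rfl
  have hinv : ∀ h, φ.symm h = (extChartAt J p).symm (G'.symm (J h)) := fun h => rfl
  have htgt : ∀ h ∈ φ.target, J h ∈ G'.target ∧ G'.symm (J h) ∈ (extChartAt J p).target := by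
    intro h hh
    have h1 := φ.map_target hh
    have h2 := φ.right_inv hh
    rw [hsrc, hinv] at h1
    simp only [φ, T, OpenPartialHomeomorph.trans_target] at hh
    simp only [mfld_simps] at hh
    refine ⟨by simpa [ModelWithCorners.toHomeomorph] using hh.1, ?_⟩
    have := hh.2
    simp only [ModelWithCorners.toHomeomorph, mfld_simps] at this ⊢
    exact ⟨by simp [J.range_eq_univ], by simpa using this⟩
  refine ⟨φ, ?_, ?_, ?_, ?_⟩
  · apply OpenPartialHomeomorph.mem_maximalAtlas_of_contMDiffOn
    · have h1 : ContMDiffOn J 𝓘(ℝ, V) ∞ (fun q => f (extChartAt J p q)) φ.source := by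
        refine hf.contMDiffOn.comp ((contMDiffOn_extChartAt (x := p)).mono ?_) ?_
        · exact fun q hq => ((hsrc q).1 hq).1
        · exact fun q hq => (hG's ((hsrc q).1 hq).2).1
      refine (J.contMDiffOn_symm (n := ∞)).comp h1 ?_
      simp [J.range_eq_univ]
    · have h1 : ContMDiffOn J 𝓘(ℝ, V) ∞ (fun h => G'.symm (J h)) φ.target :=
        hsymm.contMDiffOn.comp J.contMDiff.contMDiffOn fun h hh => (htgt h hh).1
      exact (contMDiffOn_extChartAt_symm p).comp h1 fun h hh => (htgt h hh).2
  · rw [hsrc]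
    exact ⟨mem_chart_source H p, hG0, hD0⟩
  · exact fun q hq => ⟨((hsrc q).1 hq).1, (hG's ((hsrc q).1 hq).2).1⟩
  · intro q hq
    rw [OpenPartialHomeomorph.extend_coe, Function.comp_apply, hval,
      J.right_inv (by simp [J.range_eq_univ])]

/-- The map `r` is a smooth retraction of the neighbourhood `U` of `p` into the set `S`. -/
structure IsRetraction (J : ModelWithCorners ℝ V H) (S : Set N) (p : N) (U : Set N) (r : N → N) :
    Prop where
  isOpen : IsOpen U
  mem : p ∈ U
  contMDiffOn : ContMDiffOn J J ∞ r U
  mapsTo : ∀ q ∈ U, r q ∈ S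
  eq_self : ∀ q ∈ S, q ∈ U → r q = q

theorem IsRetraction.contMDiffAt {S U : Set N} {p : N} {r : N → N} (h : IsRetraction J S p U r) :
    ContMDiffAt J J ∞ r p :=
  h.contMDiffOn.contMDiffAt (h.isOpen.mem_nhds h.mem)

theorem IsRetraction.mono {S U U' : Set N} {p p' : N} {r : N → N} (h : IsRetraction J S p U r)
    (hU' : IsOpen U') (hp : p' ∈ U') (hs : U' ⊆ U) : IsRetraction J S p' U' r :=
  ⟨hU', hp, h.contMDiffOn.mono hs, fun q hq => h.mapsTo q (hs hq),
    fun q hq hq' => h.eq_self q hq (hs hq')⟩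

/-- A retraction fixes its values that lie in its domain, so intersecting a small neighbourhood with
its own preimage already gives an invariant one; no iteration is needed. -/
theorem IsRetraction.shrink {S U O : Set N} {p : N} {r : N → N} (h : IsRetraction J S p U r)
    (hp : p ∈ S) (hO : IsOpen O) (hpO : p ∈ O) :
    ∃ U' ⊆ U ∩ O, IsRetraction J S p U' r ∧ ∀ q ∈ U', r q ∈ U' := by
  refine ⟨(U ∩ O) ∩ (U ∩ r ⁻¹' (U ∩ O)), inter_subset_left, ?_, ?_⟩
  · refine h.mono ((h.isOpen.inter hO).inter ?_) ⟨⟨h.mem, hpO⟩, h.mem, ?_⟩ fun q hq => hq.1.1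
    · exact h.contMDiffOn.continuousOn.isOpen_inter_preimage h.isOpen (h.isOpen.inter hO)
    · rw [mem_preimage, h.eq_self p hp h.mem]
      exact ⟨h.mem, hpO⟩
  · rintro q ⟨hq, hqU, hq'⟩
    refine ⟨hq', hq'.1, ?_⟩
    rw [mem_preimage, h.eq_self _ (h.mapsTo _ hqU) hq'.1]
    exact hq'

theorem contMDiffOn_extend' {φ : OpenPartialHomeomorph N H}
    (hφ : φ ∈ IsManifold.maximalAtlas J ∞ N) : ContMDiffOn J 𝓘(ℝ, V) ∞ (φ.extend J) φ.source :=
  J.contMDiff.comp_contMDiffOn (contMDiffOn_of_mem_maximalAtlas hφ)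

theorem contMDiffOn_extend_symm' [J.Boundaryless] {φ : OpenPartialHomeomorph N H}
    (hφ : φ ∈ IsManifold.maximalAtlas J ∞ N) :
    ContMDiffOn 𝓘(ℝ, V) J ∞ (φ.extend J).symm (φ.extend J).target := by
  have := contMDiffOn_extend_symm hφ
  rwa [← OpenPartialHomeomorph.extend_target'] at this

/-- In a slice chart, project linearly onto the slice. Together with the converse below, this allows
submanifolds to be handled through maps, which compose more easily than charts. -/
theorem IsEmbeddedSubmanifold.exists_isRetraction [J.Boundaryless] [FiniteDimensional ℝ V]
    {S : Set N} (h : IsEmbeddedSubmanifold J S) {p : N} (hp : p ∈ S) :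
    ∃ U r, IsRetraction J S p U r := by
  obtain ⟨φ, hφ, hpφ, W, hW⟩ := h p hp
  obtain ⟨P, hP⟩ := Submodule.ClosedComplemented.of_finiteDimensional W
  set e := φ.extend J with he
  let k : V → V := fun x => e p + (P (x - e p) : V)
  have hk : ContDiff ℝ ∞ k := by
    have : ContDiff ℝ ∞ fun x : V => (W.subtypeL ∘L P) (x - e p) :=
      (W.subtypeL ∘L P).contDiff.comp (contDiff_id.sub contDiff_const)
    exact contDiff_const.add this
  have hsrc : e.source = φ.source := φ.extend_source
  have hcont : ContinuousOn (fun q => k (e q)) φ.source :=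
    hk.continuous.comp_continuousOn (contMDiffOn_extend' hφ).continuousOn
  refine ⟨φ.source ∩ (fun q => k (e q)) ⁻¹' e.target, fun q => e.symm (k (e q)), ?_, ?_, ?_, ?_, ?_⟩
  · exact hcont.isOpen_inter_preimage φ.open_source φ.isOpen_extend_target
  · refine ⟨hpφ, ?_⟩
    simp only [mem_preimage, k, sub_self, map_zero, Submodule.coe_zero, add_zero]
    exact e.map_source (hsrc ▸ hpφ)
  · refine (contMDiffOn_extend_symm' hφ).comp
      ((hk.contMDiff.comp_contMDiffOn (contMDiffOn_extend' hφ)).mono inter_subset_left) ?_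
    exact fun q hq => hq.2
  · intro q hq
    have h1 : e.symm (k (e q)) ∈ φ.source := hsrc ▸ e.map_target hq.2
    rw [hW _ h1, e.right_inv hq.2]
    simp only [k, add_sub_cancel_left]
    exact (P _).2
  · intro q hq hq'
    have h1 := (hW q hq'.1).1 hq
    have h2 : k (e q) = e q := by
      simp only [k]
      have := congrArg Subtype.val (hP ⟨_, h1⟩)
      rw [this, add_sub_cancel]
    simp only [h2]
    exact e.left_inv (hsrc ▸ hq'.1)

/-- Sets which are smooth retracts of small open sets are embedded submanifolds. -/
theorem isEmbeddedSubmanifold_of_isRetraction [J.Boundaryless] [FiniteDimensional ℝ V]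
    [IsManifold J ∞ N] {S : Set N} (h : ∀ p ∈ S, ∃ U r, IsRetraction J S p U r) :
    IsEmbeddedSubmanifold J S := by
  have : CompleteSpace V := FiniteDimensional.complete ℝ V
  intro p hp
  obtain ⟨U₀, r, hr₀⟩ := h p hp
  obtain ⟨U, hUsub, hr, hrU⟩ := hr₀.shrink hp (chartAt H p).open_source (mem_chart_source H p)
  have hrp : r p = p := hr.eq_self p hp hr.mem
  set c := extChartAt J p with hc
  set ρ : V → V := fun x => c (r (c.symm x)) with hρ
  set W : Set V := c.target ∩ c.symm ⁻¹' U with hWdef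
  have hsy : ContMDiffOn 𝓘(ℝ, V) J ∞ c.symm c.target := contMDiffOn_extChartAt_symm p
  have hWo : IsOpen W :=
    hsy.continuousOn.isOpen_inter_preimage (isOpen_extChartAt_target p) hr.isOpen
  have hx0 : c p ∈ W := ⟨mem_extChartAt_target p, by simpa [hc] using hr.mem⟩
  have hρW : ContDiffOn ℝ ∞ ρ W := by
    rw [← contMDiffOn_iff_contDiffOn]
    exact (contMDiffOn_extChartAt (x := p)).comp (hr.contMDiffOn.comp
      (hsy.mono inter_subset_left) fun x hx => hx.2) fun x hx => (hUsub (hrU _ hx.2)).2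
  have hρ0 : ρ (c p) = c p := by simp [hρ, hc, hrp]
  have hidem : ∀ x ∈ W, ρ (ρ x) = ρ x := by
    intro x hx
    have h4 : c.symm (ρ x) = r (c.symm x) :=
      c.left_inv (by simpa [hc] using (hUsub (hrU _ hx.2)).2)
    change c (r (c.symm (ρ x))) = c (r (c.symm x))
    rw [h4, hr.eq_self _ (hr.mapsTo _ hx.2) (hrU _ hx.2)]
  set A := fderiv ℝ ρ (c p) with hA
  have hAd : HasFDerivAt ρ A (c p) :=
    ((hρW.contDiffAt (hWo.mem_nhds hx0)).differentiableAt (by simp)).hasFDerivAt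
  have hAA : ∀ v, A (A v) = A v := by
    have h1 : HasFDerivAt (ρ ∘ ρ) (A ∘L A) (c p) := by
      refine HasFDerivAt.comp (c p) ?_ hAd
      rwa [hρ0]
    have h2 : ρ ∘ ρ =ᶠ[𝓝 (c p)] ρ := by
      filter_upwards [hWo.mem_nhds hx0] with x hx using hidem x hx
    exact fun v => DFunLike.congr_fun (h1.unique (hAd.congr_of_eventuallyEq h2)) v
  -- The derivative `A` of the idempotent map `ρ` is a linear projection, so `f` has derivative `A²
  -- + (1 - A)² = 1`. On fixed points of `ρ` the second summand vanishes and `f` takes values in the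
  -- range of `A`.
  set f : V → V := fun x => A (ρ x) + ((x - ρ x) - A (x - ρ x)) with hf
  have hfW : ContDiffOn ℝ ∞ f W := by
    have h1 : ContDiffOn ℝ ∞ (fun x => x - ρ x) W := contDiffOn_id.sub hρW
    exact (A.contDiff.comp_contDiffOn hρW).add (h1.sub (A.contDiff.comp_contDiffOn h1))
  have hfd : HasFDerivAt f ((ContinuousLinearEquiv.refl ℝ V : V ≃L[ℝ] V) : V →L[ℝ] V) (c p) := by
    have h1 : HasFDerivAt (fun x => x - ρ x) (ContinuousLinearMap.id ℝ V - A) (c p) :=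
      (hasFDerivAt_id _).sub hAd
    have h2 := (A.hasFDerivAt.comp (c p) hAd).add (h1.sub (A.hasFDerivAt.comp (c p) h1))
    refine h2.congr_fderiv ?_
    ext v
    simp [hAA]
  obtain ⟨φ, hφ, hpφ, hφs, hφf⟩ := exists_chart_of_hasFDerivAt hWo hx0 hfW hfd
  obtain ⟨U', hU', hr', hrU'⟩ := hr.shrink hp φ.open_source hpφ
  refine ⟨φ.restr U', restr_mem_maximalAtlas _ hφ hr'.isOpen, ?_, LinearMap.range A.toLinearMap, ?_⟩
  · rw [φ.restr_source' U' hr'.isOpen]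
    exact ⟨hpφ, hr'.mem⟩
  · intro q hq
    rw [φ.restr_source' U' hr'.isOpen] at hq
    have hrq : r q ∈ φ.source := (hU' (hrU' q hq.2)).2
    have hsymm : ∀ q' ∈ φ.source, c.symm (c q') = q' := fun q' hq' =>
      c.left_inv (by simpa [hc] using (hφs q' hq').1)
    have hfS : ∀ q' ∈ φ.source, r q' = q' → f (c q') = A (c q') := by
      intro q' hq' h'
      have : ρ (c q') = c q' := by simp only [hρ, hsymm q' hq', h']
      simp [hf, this]
    have hcq : c (r q) = ρ (c q) := by simp only [hρ, hsymm q hq.1]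
    change _ ↔ φ.extend J q - φ.extend J p ∈ _
    rw [hφf q hq.1, hφf p hpφ, hfS p hpφ hrp]
    constructor
    · intro hqS
      rw [hfS q hq.1 (hr'.eq_self q hqS hq.2), ← map_sub]
      exact ⟨_, rfl⟩
    · rintro ⟨w, hw⟩
      have hw' : A w = f (c q) - A (c p) := hw
      -- The left side is killed by `A`. If `f (c q) - f (c p)` is in the range of `A`, so is the
      -- left side, and `A` is the identity there; hence it is zero. Then `q` and `r q` have the
      -- same image under the chart.
      have h1 : (c q - ρ (c q)) - A (c q - ρ (c q)) = 0 := by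
        have h2 : (c q - ρ (c q)) - A (c q - ρ (c q)) = A (w + c p - ρ (c q)) := by
          have h5 : A (w + c p - ρ (c q)) = A w + A (c p) - A (ρ (c q)) := by
            rw [map_sub, map_add]
          rw [h5, hw']
          simp only [hf]
          change _ = A (ρ (c q)) + (c q - ρ (c q) - A (c q - ρ (c q))) - A (c p) + A (c p) -
            A (ρ (c q))
          abel
        have h3 := congrArg A h2
        rw [map_sub, hAA, sub_self, hAA] at h3
        rw [h2, ← h3]
      have h4 : f (c q) = f (c (r q)) := by
        rw [hfS (r q) hrq (hr'.eq_self _ (hr'.mapsTo q hq.2) (hrU' q hq.2)), hcq]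
        simp only [hf, h1, add_zero]
      rw [← hφf q hq.1, ← hφf _ hrq] at h4
      have : q = r q := (φ.extend J).injOn (by simpa using hq.1) (by simpa using hrq) h4
      rw [this]
      exact hr'.mapsTo q hq.2

end Charts

/-! ### Tangent spaces of subsets, defined by velocities of curves. -/

section Tangent
variable {V H N : Type*} [NormedAddCommGroup V] [NormedSpace ℝ V] [TopologicalSpace H]
  {J : ModelWithCorners ℝ V H} [TopologicalSpace N] [ChartedSpace H N]
  {V' H' N' : Type*} [NormedAddCommGroup V'] [NormedSpace ℝ V'] [TopologicalSpace H']
  {J' : ModelWithCorners ℝ V' H'} [TopologicalSpace N'] [ChartedSpace H' N']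

theorem mdifferentiableAt_extend' {φ : OpenPartialHomeomorph N H}
    (hφ : φ ∈ IsManifold.maximalAtlas J ∞ N) {p : N} (hp : p ∈ φ.source) :
    MDifferentiableAt J 𝓘(ℝ, V) (φ.extend J) p :=
  ((contMDiffOn_extend' hφ).contMDiffAt (φ.open_source.mem_nhds hp)).mdifferentiableAt (by simp)

/-- A tangent vector which is tangent to the slice in a slice chart is tangent to the
submanifold. -/
theorem mem_tangentTo_of_slice [FiniteDimensional ℝ V] [J.Boundaryless] [IsManifold J ∞ N]
    {S : Set N} {φ : OpenPartialHomeomorph N H} (hφ : φ ∈ IsManifold.maximalAtlas J ∞ N) {p : N}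
    (hp : p ∈ φ.source) {W : Submodule ℝ V}
    (hW : ∀ q ∈ φ.source, φ.extend J q - φ.extend J p ∈ W → q ∈ S) {v : TangentSpace J p}
    (hv : (mfderiv J 𝓘(ℝ, V) (φ.extend J) p v : V) ∈ W) : v ∈ tangentTo J S p := by
  set c := φ.extend J with hc
  set w : V := mfderiv J 𝓘(ℝ, V) c p v with hw
  have hsrc : c.source = φ.source := φ.extend_source
  have hpc : p ∈ c.source := hsrc ▸ hp
  have hT : IsOpen c.target := φ.isOpen_extend_target
  have hd : MDifferentiableAt J 𝓘(ℝ, V) c p := mdifferentiableAt_extend' hφ hp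
  have h1 : ContMDiff 𝓘(ℝ, ℝ) 𝓘(ℝ, V) ∞ fun t : ℝ => c p + t • w :=
    (contDiff_const.add (contDiff_id.smul contDiff_const)).contMDiff
  have hsy : ContMDiffAt 𝓘(ℝ, V) J ∞ c.symm (c p) :=
    (contMDiffOn_extend_symm' hφ).contMDiffAt (hT.mem_nhds (c.map_source hpc))
  have h0 : c p + (0 : ℝ) • w = c p := by simp
  have hγ0 : c.symm (c p + (0 : ℝ) • w) = p := by rw [h0]; exact c.left_inv hpc
  have hγ : ContMDiffAt 𝓘(ℝ, ℝ) J ∞ (fun t : ℝ => c.symm (c p + t • w)) 0 :=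
    ContMDiffAt.comp (g := c.symm) (f := fun t : ℝ => c p + t • w) (0 : ℝ)
      (by rw [h0]; exact hsy) h1.contMDiffAt
  -- The straight line in the chart with direction `w`; it stays in the slice because `w` lies in
  -- the linear subspace.
  refine ⟨fun t => c.symm (c p + t • w), hγ0, hγ, ?_, ?_⟩
  · have hcont : ContinuousAt (fun t : ℝ => c p + t • w) 0 := h1.continuous.continuousAt
    have h4 : c.target ∈ 𝓝 ((fun t : ℝ => c p + t • w) 0) := by
      simpa using hT.mem_nhds (c.map_source hpc)
    filter_upwards [hcont h4] with t ht
    refine hW _ (hsrc ▸ c.map_target ht) ?_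
    rw [c.right_inv ht, add_sub_cancel_left]
    exact W.smul_mem t hv
  refine tangent_ext (p := p) fun g U hU hpU hg => ?_
  have hga : ContMDiffAt J 𝓘(ℝ, ℝ) ∞ g p := hg.contMDiffAt (hU.mem_nhds hpU)
  have hgc : ContMDiffAt 𝓘(ℝ, V) 𝓘(ℝ, ℝ) ∞ (fun x => g (c.symm x)) (c p) :=
    ContMDiffAt.comp (g := g) (f := c.symm) (c p)
      (by rw [c.left_inv hpc]; exact hga) hsy
  have h1' : dirDeriv J v g = dirDeriv J v fun q => (fun x => g (c.symm x)) (c q) := by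
    apply dirDeriv_congr
    filter_upwards [φ.open_source.mem_nhds hp] with q hq
    simp only [c.left_inv (hsrc ▸ hq)]
  refine (dirDeriv_velocity hγ0 (hγ.mdifferentiableAt (by simp))
    (hga.mdifferentiableAt (by simp))).trans ?_
  rw [h1', ← dirDeriv_mfderiv v hd (hgc.mdifferentiableAt (by simp))]
  unfold dirDeriv
  rw [mfderiv_eq_fderiv]
  have h5 : HasDerivAt (fun t : ℝ => c p + t • w) w 0 := by
    simpa using ((hasDerivAt_id (0 : ℝ)).smul_const w).const_add (c p)
  have h6 : HasFDerivAt (fun x => g (c.symm x)) (fderiv ℝ (fun x => g (c.symm x)) (c p))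
      (c p + (0 : ℝ) • w) := by
    rw [h0]
    exact (hgc.contDiffAt.differentiableAt (by simp)).hasFDerivAt
  exact (h6.comp_hasDerivAt (0 : ℝ) h5).deriv

/-- Every tangent vector is the velocity of a smooth curve. -/
theorem mem_tangentTo_univ [FiniteDimensional ℝ V] [J.Boundaryless] [IsManifold J ∞ N] {p : N}
    (v : TangentSpace J p) : v ∈ tangentTo J univ p :=
  mem_tangentTo_of_slice (IsManifold.chart_mem_maximalAtlas p) (mem_chart_source H p) (W := ⊤)
    (fun _ _ _ => mem_univ _) (Submodule.mem_top (R := ℝ) (M := V))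

/-- A curve whose increments lie in `W` is fixed, up to its starting value, by a projection onto
`W`; hence so is its velocity. -/
theorem mfderiv_mem_of_mem_tangentTo [FiniteDimensional ℝ V] {S : Set N} {p : N} {O : Set N}
    (hO : IsOpen O) (hp : p ∈ O) {W : Submodule ℝ V'} {f : N → V'} [FiniteDimensional ℝ V']
    (hf : MDifferentiableAt J 𝓘(ℝ, V') f p)
    (hW : ∀ q ∈ O, q ∈ S → f q - f p ∈ W) {v : TangentSpace J p} (hv : v ∈ tangentTo J S p) :
    (mfderiv J 𝓘(ℝ, V') f p v : V') ∈ W := by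
  obtain ⟨P, hP⟩ := Submodule.ClosedComplemented.of_finiteDimensional W
  obtain ⟨γ, h0, hγ, hγS, rfl⟩ := hv
  subst h0
  have hγd : MDifferentiableAt 𝓘(ℝ, ℝ) J γ 0 := hγ.mdifferentiableAt (by simp)
  set k : ℝ → V' := fun t => f (γ t) with hk
  have hkd : MDifferentiableAt 𝓘(ℝ, ℝ) 𝓘(ℝ, V') k 0 := hf.comp (0 : ℝ) hγd
  have hkd' : DifferentiableAt ℝ k 0 := hkd.differentiableAt
  have h1 : (mfderiv J 𝓘(ℝ, V') f (γ 0) (mfderiv 𝓘(ℝ, ℝ) J γ 0 (1 : ℝ)) : V') = deriv k 0 := by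
    have := DFunLike.congr_fun (F := ℝ →L[ℝ] V') (mfderiv_comp (0 : ℝ) hf hγd) (1 : ℝ)
    refine this.symm.trans ?_
    change (mfderiv 𝓘(ℝ, ℝ) 𝓘(ℝ, V') k 0 : ℝ →L[ℝ] V') 1 = _
    rw [mfderiv_eq_fderiv]
    rfl
  have h2 : HasDerivAt (fun t => (P (k t - k 0) : V')) (P (deriv k 0) : V') 0 :=
    ((W.subtypeL ∘L P).hasFDerivAt).comp_hasDerivAt (0 : ℝ) (hkd'.hasDerivAt.sub_const (k 0))
  have h3 : (fun t => (P (k t - k 0) : V')) =ᶠ[𝓝 0] fun t => k t - k 0 := by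
    filter_upwards [hγS, hγ.continuousAt (hO.mem_nhds hp)] with t ht ht'
    exact congrArg Subtype.val (hP ⟨_, hW _ ht' ht⟩)
  have h4 := h2.unique ((hkd'.hasDerivAt.sub_const (k 0)).congr_of_eventuallyEq h3)
  rw [h1, ← h4]
  exact (P _).2

/-- The tangent vectors of a submanifold in a slice chart. -/
theorem mem_tangentTo_iff_of_slice [FiniteDimensional ℝ V] [J.Boundaryless] [IsManifold J ∞ N]
    {S : Set N} {φ : OpenPartialHomeomorph N H} (hφ : φ ∈ IsManifold.maximalAtlas J ∞ N) {p : N}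
    (hp : p ∈ φ.source) {W : Submodule ℝ V}
    (hW : ∀ q ∈ φ.source, q ∈ S ↔ φ.extend J q - φ.extend J p ∈ W) {v : TangentSpace J p} :
    v ∈ tangentTo J S p ↔ (mfderiv J 𝓘(ℝ, V) (φ.extend J) p v : V) ∈ W :=
  ⟨mfderiv_mem_of_mem_tangentTo φ.open_source hp (mdifferentiableAt_extend' hφ hp)
    fun q hq hqS => (hW q hq).1 hqS,
    mem_tangentTo_of_slice hφ hp fun q hq h => (hW q hq).2 h⟩

theorem mfderiv_extend_injective [J.Boundaryless] {φ : OpenPartialHomeomorph N H}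
    (hφ : φ ∈ IsManifold.maximalAtlas J ∞ N) {p : N} (hp : p ∈ φ.source) :
    Function.Injective (mfderiv J 𝓘(ℝ, V) (φ.extend J) p) := by
  have hpc : p ∈ (φ.extend J).source := by rwa [φ.extend_source]
  have hs : MDifferentiableAt 𝓘(ℝ, V) J (φ.extend J).symm (φ.extend J p) :=
    ((contMDiffOn_extend_symm' hφ).contMDiffAt
      (φ.isOpen_extend_target.mem_nhds ((φ.extend J).map_source hpc))).mdifferentiableAt (by simp)
  have h1 := mfderiv_comp p hs (mdifferentiableAt_extend' hφ hp)
  have h2 : (φ.extend J).symm ∘ φ.extend J =ᶠ[𝓝 p] id := by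
    filter_upwards [φ.open_source.mem_nhds hp] with q hq
    exact (φ.extend J).left_inv (by rwa [φ.extend_source])
  have h3 := h1.symm.trans h2.mfderiv_eq
  intro v w hvw
  have hv := DFunLike.congr_fun (F := V →L[ℝ] V) h3 v
  have hw := DFunLike.congr_fun (F := V →L[ℝ] V) h3 w
  rw [mfderiv_id] at hv hw
  refine hv.symm.trans (Eq.trans ?_ hw)
  exact congrArg (mfderiv 𝓘(ℝ, V) J (φ.extend J).symm (φ.extend J p)) hvw

theorem tangentTo_mono {S S' : Set N} (h : S ⊆ S') (p : N) : tangentTo J S p ⊆ tangentTo J S' p :=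
  fun _ ⟨γ, h0, hγ, hS, hv⟩ => ⟨γ, h0, hγ, hS.mono fun _ ht => h ht, hv⟩

/-- The differential of a smooth map sends tangent vectors of a set to tangent vectors of its
image. -/
theorem mfderiv_mem_tangentTo {S : Set N} {S' : Set N'} {p : N} {f : N → N'}
    (hf : ContMDiffAt J J' ∞ f p) (hS : ∀ᶠ q in 𝓝[S] p, f q ∈ S') {v : TangentSpace J p}
    (hv : v ∈ tangentTo J S p) : mfderiv J J' f p v ∈ tangentTo J' S' (f p) := by
  obtain ⟨γ, h0, hγ, hγS, rfl⟩ := hv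
  subst h0
  refine ⟨fun t => f (γ t), rfl, hf.comp (0 : ℝ) hγ, ?_, ?_⟩
  · have : Tendsto γ (𝓝 0) (𝓝[S] (γ 0)) :=
      tendsto_nhdsWithin_iff.2 ⟨hγ.continuousAt, hγS⟩
    exact this hS
  · have := mfderiv_comp (0 : ℝ) (hf.mdifferentiableAt (by simp))
      (hγ.mdifferentiableAt (by simp))
    change mfderiv 𝓘(ℝ, ℝ) J' (f ∘ γ) 0 _ = _
    rw [this]
    rfl

/-- The derivative of a function along a tangent vector of `S` depends only on the values on
`S`. -/
theorem dirDeriv_congr_of_mem_tangentTo {S : Set N} {p : N} {v : TangentSpace J p}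
    (hv : v ∈ tangentTo J S p) {g h : N → ℝ} (hg : MDifferentiableAt J 𝓘(ℝ, ℝ) g p)
    (hh : MDifferentiableAt J 𝓘(ℝ, ℝ) h p) (hgh : ∀ᶠ q in 𝓝[S] p, g q = h q) :
    dirDeriv J v g = dirDeriv J v h := by
  obtain ⟨γ, h0, hγ, hγS, rfl⟩ := hv
  rw [dirDeriv_velocity h0 (hγ.mdifferentiableAt (by simp)) hg,
    dirDeriv_velocity h0 (hγ.mdifferentiableAt (by simp)) hh]
  apply EventuallyEq.deriv_eq
  have : Tendsto γ (𝓝 0) (𝓝[S] p) :=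
    tendsto_nhdsWithin_iff.2 ⟨h0 ▸ hγ.continuousAt, hγS⟩
  exact this hgh

theorem mfderiv_congr_of_mem_tangentTo {S : Set N} {p : N} {v : TangentSpace J p}
    (hv : v ∈ tangentTo J S p) {f h : N → N'} (hf : MDifferentiableAt J J' f p)
    (hh : MDifferentiableAt J J' h p) (hfh : ∀ᶠ q in 𝓝[S] p, f q = h q) :
    (mfderiv J J' f p v : V') = mfderiv J J' h p v := by
  obtain ⟨γ, h0, hγ, hγS, rfl⟩ := hv
  subst h0
  have h1 := mfderiv_comp (0 : ℝ) hf (hγ.mdifferentiableAt (by simp))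
  have h2 := mfderiv_comp (0 : ℝ) hh (hγ.mdifferentiableAt (by simp))
  have : Tendsto γ (𝓝 0) (𝓝[S] (γ 0)) := tendsto_nhdsWithin_iff.2 ⟨hγ.continuousAt, hγS⟩
  have h3 : f ∘ γ =ᶠ[𝓝 0] h ∘ γ := this hfh
  have h4 := h3.mfderiv_eq (I := 𝓘(ℝ, ℝ)) (I' := J')
  rw [h1, h2] at h4
  exact DFunLike.congr_fun (F := ℝ →L[ℝ] V') h4 (1 : ℝ)

/-- This turns tangency into an equation: the tangent space is the fixed space of the derivative of
the retraction. -/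
theorem IsRetraction.mem_tangentTo_iff [J.Boundaryless] [IsManifold J ∞ N] {S U : Set N} {p : N}
    {r : N → N} [FiniteDimensional ℝ V] (h : IsRetraction J S p U r) (hp : p ∈ S) (v : TangentSpace J p) :
    v ∈ tangentTo J S p ↔ (mfderiv J J r p v : V) = (v : V) := by
  have hrp := h.eq_self p hp h.mem
  constructor
  · intro hv
    have := mfderiv_congr_of_mem_tangentTo hv (h.contMDiffAt.mdifferentiableAt (by simp))
      (mdifferentiableAt_id) (J' := J) (by
        filter_upwards [self_mem_nhdsWithin, mem_nhdsWithin_of_mem_nhds (h.isOpen.mem_nhds h.mem)]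
          with q hq hq' using h.eq_self q hq hq')
    rw [this, mfderiv_id]
    rfl
  · intro hv
    have := mfderiv_mem_tangentTo (S' := S) h.contMDiffAt (by
      filter_upwards [mem_nhdsWithin_of_mem_nhds (h.isOpen.mem_nhds h.mem)] with q hq
      exact h.mapsTo q hq) (mem_tangentTo_univ v)
    have key : ∀ (q : N), q = p → ∀ (w : V), w = v →
        (w : TangentSpace J q) ∈ tangentTo J S q → v ∈ tangentTo J S p := by
      rintro q rfl w rfl hw
      exact hw
    exact key _ hrp _ hv this

end Tangent

/-! ### Lie brackets of vector fields tangent to, or related along, a subset. -/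

section LieBracket
variable {V H N : Type*} [NormedAddCommGroup V] [NormedSpace ℝ V] [TopologicalSpace H]
  {J : ModelWithCorners ℝ V H} [TopologicalSpace N] [ChartedSpace H N]
  {V' H' N' : Type*} [NormedAddCommGroup V'] [NormedSpace ℝ V'] [TopologicalSpace H']
  {J' : ModelWithCorners ℝ V' H'} [TopologicalSpace N'] [ChartedSpace H' N']
open VectorField

/-- The vector field `U` is smooth near `p`. -/
def SmoothFieldAt (J : ModelWithCorners ℝ V H) [IsManifold J ∞ N] (U : ∀ q : N, TangentSpace J q)
    (p : N) : Prop :=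
  ∃ O : Set N, IsOpen O ∧ p ∈ O ∧
    ContMDiffOn J J.tangent ∞ (fun q => (⟨q, U q⟩ : TangentBundle J N)) O

theorem SmoothFieldAt.contMDiffAt [IsManifold J ∞ N] {U : ∀ q : N, TangentSpace J q} {p : N}
    (h : SmoothFieldAt J U p) :
    ContMDiffAt J J.tangent ∞ (fun q => (⟨q, U q⟩ : TangentBundle J N)) p := by
  obtain ⟨O, hO, hp, h⟩ := h
  exact h.contMDiffAt (hO.mem_nhds hp)

/-- A real function is smooth near a point. -/
def SmoothFunAt (J : ModelWithCorners ℝ V H) (g : N → ℝ) (p : N) : Prop :=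
  ∃ O : Set N, IsOpen O ∧ p ∈ O ∧ ContMDiffOn J 𝓘(ℝ, ℝ) ∞ g O

theorem SmoothFunAt.contMDiffAt {g : N → ℝ} {p : N} (h : SmoothFunAt J g p) :
    ContMDiffAt J 𝓘(ℝ, ℝ) ∞ g p := by
  obtain ⟨O, hO, hp, h⟩ := h
  exact h.contMDiffAt (hO.mem_nhds hp)

theorem SmoothFunAt.mdifferentiableAt {g : N → ℝ} {p : N} (h : SmoothFunAt J g p) :
    MDifferentiableAt J 𝓘(ℝ, ℝ) g p :=
  h.contMDiffAt.mdifferentiableAt (by simp)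

theorem SmoothFunAt.eventually {g : N → ℝ} {p : N} (h : SmoothFunAt J g p) :
    ∀ᶠ q in 𝓝 p, SmoothFunAt J g q := by
  obtain ⟨O, hO, hp, h⟩ := h
  filter_upwards [hO.mem_nhds hp] with q hq using ⟨O, hO, hq, h⟩

/-- The derivative of a smooth function along a smooth vector field is smooth. -/
theorem SmoothFieldAt.smoothFunAt_dirDeriv [IsManifold J ∞ N] {U : ∀ q : N, TangentSpace J q}
    {p : N} (hU : SmoothFieldAt J U p) {g : N → ℝ} (hg : SmoothFunAt J g p) :
    SmoothFunAt J (fun q => dirDeriv J (U q) g) p := by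
  obtain ⟨O, hO, hp, hU⟩ := hU
  obtain ⟨O', hO', hp', hg⟩ := hg
  refine ⟨O ∩ O', hO.inter hO', ⟨hp, hp'⟩, ?_⟩
  have h1 : ContMDiffOn J.tangent 𝓘(ℝ, ℝ).tangent ∞ (tangentMapWithin J 𝓘(ℝ, ℝ) g O')
      (TotalSpace.proj ⁻¹' O') := hg.contMDiffOn_tangentMapWithin (by simp) hO'.uniqueMDiffOn
  have h2 := h1.comp (f := fun q => (⟨q, U q⟩ : TangentBundle J N)) (s := O ∩ O')
    (hU.mono inter_subset_left) (fun q hq => hq.2)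
  refine ((contMDiff_snd_tangentBundle_modelSpace ℝ 𝓘(ℝ, ℝ)).comp_contMDiffOn h2).congr
    fun q hq => ?_
  change mfderiv J 𝓘(ℝ, ℝ) g q (U q) = mfderivWithin J 𝓘(ℝ, ℝ) g O' q (U q)
  rw [mfderivWithin_of_isOpen hO' hq.2]

theorem dirDeriv_eq_fderiv [J.Boundaryless] [IsManifold J ∞ N] {p q : N}
    (hq : q ∈ (chartAt H p).source) (v : TangentSpace J q) {g : N → ℝ}
    (hg : MDifferentiableAt J 𝓘(ℝ, ℝ) g q) :
    dirDeriv J v g = fderiv ℝ (fun y => g ((extChartAt J p).symm y)) (extChartAt J p q)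
      (mfderiv J 𝓘(ℝ, V) (extChartAt J p) q v) := by
  have : IsManifold J 1 N := IsManifold.of_le (n := ∞) (by simp)
  have hq' : q ∈ (extChartAt J p).source := by simpa using hq
  have h1 : g =ᶠ[𝓝 q] fun q => (fun y => g ((extChartAt J p).symm y)) (extChartAt J p q) := by
    filter_upwards [(isOpen_extChartAt_source (I := J) p).mem_nhds hq'] with q' hq'
    simp only [(extChartAt J p).left_inv hq']
  have hs : MDifferentiableAt 𝓘(ℝ, V) J (extChartAt J p).symm (extChartAt J p q) :=
    ((contMDiffOn_extChartAt_symm (n := ∞) p).contMDiffAt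
      ((isOpen_extChartAt_target p).mem_nhds ((extChartAt J p).map_source hq'))).mdifferentiableAt
      (by simp)
  have hgs : MDifferentiableAt 𝓘(ℝ, V) 𝓘(ℝ, ℝ) (fun y => g ((extChartAt J p).symm y))
      (extChartAt J p q) := by
    refine MDifferentiableAt.comp (g := g) (f := (extChartAt J p).symm) (extChartAt J p q) ?_ hs
    rw [(extChartAt J p).left_inv hq']
    exact hg
  rw [dirDeriv_congr v h1, ← dirDeriv_mfderiv v (mdifferentiableAt_extChartAt hq) hgs]
  unfold dirDeriv
  rw [mfderiv_eq_fderiv]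
  rfl

/-- `mlieBracket` is computed from fields pulled back by the inverse chart; derivations have to be
expressed through the same pullbacks for the two to be compared. -/
theorem dirDeriv_symm_eq_fderiv_mpullbackWithin [J.Boundaryless] [IsManifold J ∞ N] {p : N} {y : V}
    (hy : y ∈ (extChartAt J p).target) (U : ∀ q : N, TangentSpace J q) {g : N → ℝ}
    (hg : MDifferentiableAt J 𝓘(ℝ, ℝ) g ((extChartAt J p).symm y)) :
    dirDeriv J (U ((extChartAt J p).symm y)) g =
      fderiv ℝ (fun y => g ((extChartAt J p).symm y)) y
        (mpullbackWithin 𝓘(ℝ, V) J (extChartAt J p).symm U (range J) y) := by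
  have : IsManifold J 1 N := IsManifold.of_le (n := ∞) (by simp)
  obtain ⟨e, he⟩ := isInvertible_mfderivWithin_extChartAt_symm (I := J) hy
  have hs : MDifferentiableAt 𝓘(ℝ, V) J (extChartAt J p).symm y :=
    ((contMDiffOn_extChartAt_symm (n := ∞) p).contMDiffAt
      ((isOpen_extChartAt_target p).mem_nhds hy)).mdifferentiableAt (by simp)
  have h1 : mfderiv 𝓘(ℝ, V) J (extChartAt J p).symm y
      (mpullbackWithin 𝓘(ℝ, V) J (extChartAt J p).symm U (range J) y) =
      U ((extChartAt J p).symm y) := by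
    rw [mpullbackWithin_apply, ← he, ContinuousLinearMap.inverse_equiv]
    rw [J.range_eq_univ, mfderivWithin_univ] at he
    rw [← he]
    exact e.apply_symm_apply _
  rw [← h1, dirDeriv_mfderiv _ hs hg]
  unfold dirDeriv
  rw [mfderiv_eq_fderiv]
  rfl

/-- The Lie bracket of smooth vector fields, as a derivation. -/
theorem dirDeriv_mlieBracket [J.Boundaryless] [CompleteSpace V] [IsManifold J ∞ N] {p : N}
    {X Y : ∀ q : N, TangentSpace J q} (hX : SmoothFieldAt J X p) (hY : SmoothFieldAt J Y p)
    {g : N → ℝ} (hg : SmoothFunAt J g p) :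
    dirDeriv J (mlieBracket J X Y p) g =
      dirDeriv J (X p) (fun q => dirDeriv J (Y q) g) -
      dirDeriv J (Y p) (fun q => dirDeriv J (X q) g) := by
  have : IsManifold J 1 N := IsManifold.of_le (n := ∞) (by simp)
  have : IsManifold J 2 N := inferInstance
  set c := extChartAt J p with hc
  have hp := mem_chart_source H p
  set gh : V → ℝ := fun y => g (c.symm y) with hgh
  have hsy : c.symm (c p) = p := extChartAt_to_inv p
  have hgs : ContDiffAt ℝ ∞ gh (c p) := by
    rw [← contMDiffAt_iff_contDiffAt]
    refine ContMDiffAt.comp (g := g) (f := c.symm) (c p) (by rw [hsy]; exact hg.contMDiffAt) ?_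
    exact (contMDiffOn_extChartAt_symm p).contMDiffAt (extChartAt_target_mem_nhds p)
  have hev : ∀ᶠ y in 𝓝 (c p), y ∈ c.target ∧ MDifferentiableAt J 𝓘(ℝ, ℝ) g (c.symm y) := by
    have h1 : Tendsto c.symm (𝓝 (c p)) (𝓝 p) := by
      have := continuousAt_extChartAt_symm (I := J) p
      rwa [ContinuousAt, extChartAt_to_inv] at this
    filter_upwards [extChartAt_target_mem_nhds (I := J) p, h1.eventually hg.eventually]
      with y hy hy' using ⟨hy, hy'.mdifferentiableAt⟩
  set Xh := mpullbackWithin 𝓘(ℝ, V) J c.symm X (range J) with hXh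
  set Yh := mpullbackWithin 𝓘(ℝ, V) J c.symm Y (range J) with hYh
  have key : ∀ (Z : ∀ q : N, TangentSpace J q), SmoothFieldAt J Z p →
      DifferentiableAt ℝ (mpullbackWithin 𝓘(ℝ, V) J c.symm Z (range J) : V → V) (c p) ∧
      (mfderiv J 𝓘(ℝ, V) c p (Z p) : V) =
        mpullbackWithin 𝓘(ℝ, V) J c.symm Z (range J) (c p) := by
    intro Z hZ
    constructor
    · have := (hZ.contMDiffAt.mdifferentiableAt
        (by simp)).mdifferentiableWithinAt
          (s := univ) |>.differentiableWithinAt_mpullbackWithin_vectorField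
      rw [J.range_eq_univ, preimage_univ, univ_inter] at this
      rw [J.range_eq_univ]
      exact differentiableWithinAt_univ.1 this
    · refine (DFunLike.congr_fun (mfderiv_extChartAt_self (I := J) (x := p)) (Z p)).trans ?_
      refine (mfderivWithin_extChartAt_symm_inverse_apply (I := J) (x := p) (Z p)).symm.trans ?_
      have h1 : (Z p : V) = Z (c.symm (c p)) := congrArg (fun q => (Z q : V)) hsy.symm
      exact congrArg (fun w : V => ((mfderivWithin 𝓘(ℝ, V) J c.symm (range J) (c p)).inverse :
        V →L[ℝ] V) w) h1
  obtain ⟨hXd, hXp⟩ := key X hX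
  obtain ⟨hYd, hYp⟩ := key Y hY
  -- The coordinate formula `v(Z g) = D²g(v, Z) + Dg(DZ v)`. On antisymmetrizing, the Hessian terms
  -- cancel and the rest is `Dg` of the coordinate bracket.
  have step : ∀ (Z : ∀ q : N, TangentSpace J q), SmoothFieldAt J Z p →
      ∀ (v : TangentSpace J p) (w : V), (mfderiv J 𝓘(ℝ, V) c p v : V) = w →
      dirDeriv J v (fun q => dirDeriv J (Z q) g) =
        fderiv ℝ (fderiv ℝ gh) (c p) w (mpullbackWithin 𝓘(ℝ, V) J c.symm Z (range J) (c p)) +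
        fderiv ℝ gh (c p) (fderiv ℝ (mpullbackWithin 𝓘(ℝ, V) J c.symm Z (range J) : V → V)
          (c p) w) := by
    intro Z hZ v w hvw
    rw [dirDeriv_eq_fderiv hp v (hZ.smoothFunAt_dirDeriv hg).mdifferentiableAt, hvw]
    have h1 : (fun y => dirDeriv J (Z (c.symm y)) g) =ᶠ[𝓝 (c p)]
        fun y => fderiv ℝ gh y (mpullbackWithin 𝓘(ℝ, V) J c.symm Z (range J) y) := by
      filter_upwards [hev] with y hy
      exact dirDeriv_symm_eq_fderiv_mpullbackWithin hy.1 Z hy.2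
    have h2 : DifferentiableAt ℝ (fderiv ℝ gh) (c p) :=
      (hgs.fderiv_right (m := 1) (by rw [one_add_one_eq_two]; exact ENat.LEInfty.out)).differentiableAt (by simp)
    have h3 := (h2.hasFDerivAt.clm_apply (key Z hZ).1.hasFDerivAt).fderiv
    rw [h1.fderiv_eq, h3]
    exact add_comm _ _
  rw [step X hX _ _ hYp, step Y hY _ _ hXp, dirDeriv_eq_fderiv hp _ hg.mdifferentiableAt]
  have hsymm : fderiv ℝ (fderiv ℝ gh) (c p) (Xh (c p)) (Yh (c p)) =
      fderiv ℝ (fderiv ℝ gh) (c p) (Yh (c p)) (Xh (c p)) :=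
    (hgs.isSymmSndFDerivAt (by simp; exact ENat.LEInfty.out)) _ _
  have hbr : (mfderiv J 𝓘(ℝ, V) c p (mlieBracket J X Y p) : V) =
      fderiv ℝ Yh (c p) (Xh (c p)) - fderiv ℝ Xh (c p) (Yh (c p)) := by
    obtain ⟨e, he⟩ := isInvertible_mfderiv_extChartAt (I := J) (mem_extChartAt_source p)
    rw [← mlieBracketWithin_univ, mlieBracketWithin_apply, ← he,
      ContinuousLinearMap.inverse_equiv]
    refine (e.apply_symm_apply _).trans ?_
    rw [J.range_eq_univ, preimage_univ, univ_inter]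
    simp only [hXh, hYh, J.range_eq_univ]
    exact congrFun (lieBracketWithin_univ (𝕜 := ℝ)) (c p)
  rw [hbr, map_sub, ← hXh, ← hYh, hsymm]
  abel

/-- Two vector fields tangent to `S` along `S` and related by `f` along `S` to two other vector
fields have related Lie brackets. -/
theorem mfderiv_mlieBracket_of_related [J.Boundaryless] [FiniteDimensional ℝ V] [IsManifold J ∞ N]
    [J'.Boundaryless] [FiniteDimensional ℝ V'] [IsManifold J' ∞ N']
    {S : Set N} {p : N} (hp : p ∈ S) {f : N → N'} {O : Set N} (hO : IsOpen O) (hpO : p ∈ O)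
    (hf : ContMDiffOn J J' ∞ f O)
    {X Y : ∀ q : N, TangentSpace J q} (hX : SmoothFieldAt J X p) (hY : SmoothFieldAt J Y p)
    {X' Y' : ∀ q : N', TangentSpace J' q} (hX' : SmoothFieldAt J' X' (f p))
    (hY' : SmoothFieldAt J' Y' (f p))
    (hXS : X p ∈ tangentTo J S p) (hYS : Y p ∈ tangentTo J S p)
    (hXX : ∀ᶠ q in 𝓝[S] p, mfderiv J J' f q (X q) = X' (f q))
    (hYY : ∀ᶠ q in 𝓝[S] p, mfderiv J J' f q (Y q) = Y' (f q)) :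
    mfderiv J J' f p (mlieBracket J X Y p) = mlieBracket J' X' Y' (f p) := by
  have : CompleteSpace V := FiniteDimensional.complete ℝ V
  have : CompleteSpace V' := FiniteDimensional.complete ℝ V'
  have hfa : MDifferentiableAt J J' f p :=
    (hf.contMDiffAt (hO.mem_nhds hpO)).mdifferentiableAt (by simp)
  refine tangent_ext fun g U hU hpU hg => ?_
  have hg' : SmoothFunAt J' g (f p) := ⟨U, hU, hpU, hg⟩
  have hgf : SmoothFunAt J (fun q => g (f q)) p :=
    ⟨O ∩ f ⁻¹' U, hf.continuousOn.isOpen_inter_preimage hO hU, ⟨hpO, hpU⟩,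
      hg.comp (hf.mono inter_subset_left) fun q hq => hq.2⟩
  -- The functions `W(g ∘ f)` and `(W' g) ∘ f` agree only along `S`, but they are differentiated in
  -- a direction tangent to `S`, for which this suffices.
  have key : ∀ (Z W : ∀ q : N, TangentSpace J q) (Z' W' : ∀ q : N', TangentSpace J' q),
      SmoothFieldAt J W p → SmoothFieldAt J' W' (f p) → Z p ∈ tangentTo J S p →
      mfderiv J J' f p (Z p) = Z' (f p) → (∀ᶠ q in 𝓝[S] p, mfderiv J J' f q (W q) = W' (f q)) →
      dirDeriv J (Z p) (fun q => dirDeriv J (W q) fun q => g (f q)) =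
        dirDeriv J' (Z' (f p)) fun q => dirDeriv J' (W' q) g := by
    intro Z W Z' W' hW hW' hZS hZ hWW
    rw [← hZ, dirDeriv_mfderiv _ hfa (hW'.smoothFunAt_dirDeriv hg').mdifferentiableAt]
    refine dirDeriv_congr_of_mem_tangentTo hZS (hW.smoothFunAt_dirDeriv hgf).mdifferentiableAt
      ((hW'.smoothFunAt_dirDeriv hg').mdifferentiableAt.comp p hfa) ?_
    have h1 : O ∩ f ⁻¹' U ∈ 𝓝[S] p := mem_nhdsWithin_of_mem_nhds
      ((hf.continuousOn.isOpen_inter_preimage hO hU).mem_nhds ⟨hpO, hpU⟩)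
    filter_upwards [hWW, h1] with q hq hqU
    rw [← hq, dirDeriv_mfderiv _ ((hf.contMDiffAt (hO.mem_nhds hqU.1)).mdifferentiableAt (by simp))
      ((hg.contMDiffAt (hU.mem_nhds hqU.2)).mdifferentiableAt (by simp))]
  have hXp := hXX.self_of_nhdsWithin hp
  have hYp := hYY.self_of_nhdsWithin hp
  rw [dirDeriv_mlieBracket hX' hY' hg', dirDeriv_mfderiv _ hfa hg'.mdifferentiableAt,
    dirDeriv_mlieBracket hX hY hgf, key X Y X' Y' hY hY' hXS hXp hYY,
    key Y X Y' X' hX hX' hYS hYp hXX]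

/-- The Lie bracket of vector fields tangent to an embedded submanifold is tangent to it. -/
theorem mlieBracket_mem_tangentTo [J.Boundaryless] [FiniteDimensional ℝ V] [IsManifold J ∞ N]
    {S : Set N} (hS : IsEmbeddedSubmanifold J S) {p : N} (hp : p ∈ S)
    {X Y : ∀ q : N, TangentSpace J q} (hX : SmoothFieldAt J X p) (hY : SmoothFieldAt J Y p)
    (hXS : ∀ᶠ q in 𝓝[S] p, X q ∈ tangentTo J S q) (hYS : ∀ᶠ q in 𝓝[S] p, Y q ∈ tangentTo J S q) :
    mlieBracket J X Y p ∈ tangentTo J S p := by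
  obtain ⟨U, r, hr⟩ := hS.exists_isRetraction hp
  have hrp : r p = p := hr.eq_self p hp hr.mem
  -- A field tangent to `S` is related to itself by the retraction, along `S`; so the bracket is
  -- fixed by the derivative of the retraction.
  have key : ∀ (Z : ∀ q : N, TangentSpace J q), (∀ᶠ q in 𝓝[S] p, Z q ∈ tangentTo J S q) →
      ∀ᶠ q in 𝓝[S] p, mfderiv J J r q (Z q) = Z (r q) := by
    intro Z hZ
    filter_upwards [hZ, self_mem_nhdsWithin, mem_nhdsWithin_of_mem_nhds (hr.isOpen.mem_nhds hr.mem)]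
      with q hq hqS hqU
    refine (((hr.mono hr.isOpen hqU subset_rfl).mem_tangentTo_iff hqS _).1 hq).trans ?_
    exact congrArg (fun q => (Z q : V)) (hr.eq_self q hqS hqU).symm
  rw [hr.mem_tangentTo_iff hp]
  refine (mfderiv_mlieBracket_of_related hp hr.isOpen hr.mem hr.contMDiffOn hX hY
    (X' := X) (Y' := Y) (hrp.symm ▸ hX) (hrp.symm ▸ hY) (hXS.self_of_nhdsWithin hp)
    (hYS.self_of_nhdsWithin hp) (key X hXS) (key Y hYS)).trans ?_
  exact congrArg (fun q => (mlieBracket J X Y q : V)) hrp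

end LieBracket

/-! ### Submersions onto embedded submanifolds: normal form, local sections, fibres. -/

section Submersions
variable {V H N : Type*} [NormedAddCommGroup V] [NormedSpace ℝ V] [TopologicalSpace H]
  {J : ModelWithCorners ℝ V H} [TopologicalSpace N] [ChartedSpace H N]
  {V' H' N' : Type*} [NormedAddCommGroup V'] [NormedSpace ℝ V'] [TopologicalSpace H']
  {J' : ModelWithCorners ℝ V' H'} [TopologicalSpace N'] [ChartedSpace H' N']

theorem mfderiv_extend_surjective [J.Boundaryless] [FiniteDimensional ℝ V]
    {φ : OpenPartialHomeomorph N H}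
    (hφ : φ ∈ IsManifold.maximalAtlas J ∞ N) {p : N} (hp : p ∈ φ.source) :
    Function.Surjective (mfderiv J 𝓘(ℝ, V) (φ.extend J) p) := by
  let L : V →ₗ[ℝ] V := (mfderiv J 𝓘(ℝ, V) (φ.extend J) p : V →L[ℝ] V).toLinearMap
  exact (LinearMap.injective_iff_surjective (f := L)).1 (mfderiv_extend_injective hφ hp)

/-- Local normal form of a smooth map `f` which, near `p`, takes values in an embedded submanifold
`M` and is a submersion onto `M`: charts `φ` and `φ'` and linear maps `D` and `P` such that `f`
becomes linear after projection to the slice of `M`. -/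
theorem exists_submersion_normal_form [J.Boundaryless] [FiniteDimensional ℝ V] [IsManifold J ∞ N]
    [J'.Boundaryless] [FiniteDimensional ℝ V'] [IsManifold J' ∞ N'] {f : N → N'}
    (hf : ContMDiff J J' ∞ f) {M : Set N'} (hM : IsEmbeddedSubmanifold J' M) (hfM : ∀ q, f q ∈ M)
    {p : N} (hsub : ∀ v ∈ tangentTo J' M (f p), ∃ w : TangentSpace J p, mfderiv J J' f p w = v) :
    ∃ φ ∈ IsManifold.maximalAtlas J ∞ N, ∃ φ' ∈ IsManifold.maximalAtlas J' ∞ N',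
      p ∈ φ.source ∧ (∀ q ∈ φ.source, f q ∈ φ'.source) ∧
      ∃ (W : Submodule ℝ V') (P : V' →L[ℝ] W) (D : V →L[ℝ] W) (s : W →L[ℝ] V),
        (∀ w, D (s w) = w) ∧ (∀ w : W, P w = w) ∧
        (∀ m ∈ φ'.source, m ∈ M ↔ φ'.extend J' m - φ'.extend J' (f p) ∈ W) ∧
        (∀ q ∈ φ.source, D (φ.extend J q) = P (φ'.extend J' (f q))) ∧
        ∀ q ∈ φ.source, ∀ m ∈ φ'.source, m ∈ M → D (φ.extend J q) = P (φ'.extend J' m) →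
          f q = m := by
  have : CompleteSpace V := FiniteDimensional.complete ℝ V
  obtain ⟨φ', hφ', hpφ', W, hW⟩ := hM (f p) (hfM p)
  obtain ⟨P, hP⟩ := Submodule.ClosedComplemented.of_finiteDimensional W
  set c' := φ'.extend J' with hc'
  set c := extChartAt J p with hc
  set O : Set V := c.target ∩ c.symm ⁻¹' (f ⁻¹' φ'.source) with hO
  have hsy : ContMDiffOn 𝓘(ℝ, V) J ∞ c.symm c.target := contMDiffOn_extChartAt_symm p
  have hOo : IsOpen O := hsy.continuousOn.isOpen_inter_preimage (isOpen_extChartAt_target p)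
    (φ'.open_source.preimage hf.continuous)
  have hcp : c.symm (c p) = p := extChartAt_to_inv p
  have hpO : c p ∈ O := ⟨mem_extChartAt_target p, by
    rw [mem_preimage, hcp]
    exact hpφ'⟩
  set ψ : V → W := fun x => P (c' (f (c.symm x))) with hψ
  have hψO : ContDiffOn ℝ ∞ ψ O := by
    rw [← contMDiffOn_iff_contDiffOn]
    exact P.contMDiff.comp_contMDiffOn ((contMDiffOn_extend' hφ').comp
      (hf.comp_contMDiffOn (hsy.mono inter_subset_left)) fun x hx => hx.2)
  have hψd : DifferentiableAt ℝ ψ (c p) :=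
    (hψO.contDiffAt (hOo.mem_nhds hpO)).differentiableAt (by simp)
  set D := fderiv ℝ ψ (c p) with hD
  have hsurj : Function.Surjective D := by
    intro w
    have hc'd : MDifferentiableAt J' 𝓘(ℝ, V') c' (f p) := mdifferentiableAt_extend' hφ' hpφ'
    have hc's : Function.Surjective (mfderiv J' 𝓘(ℝ, V') c' (f p)) :=
      mfderiv_extend_surjective hφ' hpφ'
    obtain ⟨v, hv⟩ := hc's (w : V')
    have hvM : v ∈ tangentTo J' M (f p) := by
      rw [mem_tangentTo_iff_of_slice hφ' hpφ' hW, ← hc', hv]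
      exact w.2
    obtain ⟨u, hu⟩ := hsub v hvM
    have hPc : MDifferentiableAt J' 𝓘(ℝ, W) (fun m => P (c' m)) (f p) :=
      P.mdifferentiableAt.comp (f p) hc'd
    have hfd : MDifferentiableAt J J' f p := hf.mdifferentiableAt (by simp)
    have h1 : (mfderiv J 𝓘(ℝ, W) (fun q => P (c' (f q))) p u : W) = w := by
      have h2 := DFunLike.congr_fun (F := V →L[ℝ] W) (mfderiv_comp p hPc hfd) u
      refine h2.trans ?_
      change (mfderiv J' 𝓘(ℝ, W) (fun m => P (c' m)) (f p) (mfderiv J J' f p u) : W) = w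
      rw [hu]
      have h3 := DFunLike.congr_fun (F := V' →L[ℝ] W)
        (mfderiv_comp (f p) (g := P) (f := c') P.mdifferentiableAt hc'd) v
      refine h3.trans ?_
      change mfderiv 𝓘(ℝ, V') 𝓘(ℝ, W) P (c' (f p)) (mfderiv J' 𝓘(ℝ, V') c' (f p) v) = w
      rw [hv, P.mfderiv_eq]
      exact hP w
    have hcd : MDifferentiableAt J 𝓘(ℝ, V) c p := mdifferentiableAt_extChartAt (mem_chart_source H p)
    have h4 : (fun q => P (c' (f q))) =ᶠ[𝓝 p] ψ ∘ c := by
      filter_upwards [extChartAt_source_mem_nhds (I := J) p] with q hq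
      simp only [hψ, Function.comp_apply, hc, (extChartAt J p).left_inv hq]
    have h5 := DFunLike.congr_fun (F := V →L[ℝ] W)
      (h4.mfderiv_eq.trans (mfderiv_comp p hψd.mdifferentiableAt hcd)) u
    refine ⟨mfderiv J 𝓘(ℝ, V) c p u, ?_⟩
    refine Eq.trans ?_ (h5.symm.trans h1)
    change _ = mfderiv 𝓘(ℝ, V) 𝓘(ℝ, W) ψ (c p) (mfderiv J 𝓘(ℝ, V) c p u)
    rw [mfderiv_eq_fderiv]
    rfl
  obtain ⟨s, hs⟩ := D.exists_rightInverse_of_surjective (LinearMap.range_eq_top.2 hsurj)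
  have hs' : ∀ w, D (s w) = w := fun w => DFunLike.congr_fun hs w
  -- With `D` the derivative of `ψ` and `s` a right inverse of `D`, the derivative of `Ψ` at the
  -- base point is the identity, while `D ∘ Ψ = ψ`. So `Ψ` is a change of coordinates that makes `ψ`
  -- linear.
  set Ψ : V → V := fun x => s (ψ x) + (x - s (D x)) with hΨ
  have hΨO : ContDiffOn ℝ ∞ Ψ O :=
    (s.contDiff.comp_contDiffOn hψO).add
      (contDiffOn_id.sub (s.contDiff.comp D.contDiff).contDiffOn)
  have hΨd : HasFDerivAt Ψ ((ContinuousLinearEquiv.refl ℝ V : V ≃L[ℝ] V) : V →L[ℝ] V) (c p) := by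
    have := (s.hasFDerivAt.comp (c p) hψd.hasFDerivAt).add
      ((hasFDerivAt_id (c p)).sub (s.hasFDerivAt.comp (c p) D.hasFDerivAt))
    refine this.congr_fderiv ?_
    ext v
    simp [hD]
  obtain ⟨φ, hφ, hpφ, hφs, hφΨ⟩ := exists_chart_of_hasFDerivAt hOo hpO hΨO hΨd
  have hinv : ∀ q ∈ φ.source, c.symm (c q) = q := fun q hq =>
    c.left_inv (by simpa [hc] using (hφs q hq).1)
  have hsrc' : c'.source = φ'.source := φ'.extend_source
  -- Differences of points of `M` lie in the slice, where `P` is the identity; projecting therefore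
  -- loses nothing on `M`.
  have hPinj : ∀ m ∈ φ'.source, m ∈ M → ∀ m' ∈ φ'.source, m' ∈ M → P (c' m) = P (c' m') →
      m = m' := by
    intro m hm hmM m' hm' hmM' h
    have h1 := (hW m hm).1 hmM
    have h2 := (hW m' hm').1 hmM'
    apply c'.injOn (by rwa [hsrc']) (by rwa [hsrc'])
    have h3 := hP ⟨_, W.sub_mem h1 h2⟩
    have h4 : P (c' m - c' m') = 0 := by rw [map_sub, h, sub_self]
    simp only [sub_sub_sub_cancel_right] at h3
    rw [h4] at h3
    exact sub_eq_zero.1 (congrArg Subtype.val h3).symm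
  have hfs : ∀ q ∈ φ.source, f q ∈ φ'.source := by
    intro q hq
    have := (hφs q hq).2.2
    rwa [mem_preimage, hinv q hq] at this
  have hDP : ∀ q ∈ φ.source, D (φ.extend J q) = P (c' (f q)) := by
    intro q hq
    rw [hφΨ q hq]
    simp only [hΨ, map_add, map_sub, hs', ← hc, hψ, hinv q hq]
    abel
  refine ⟨φ, hφ, φ', hφ', hpφ, hfs, W, P, D, s, hs', hP, hW, hDP, ?_⟩
  intro q hq m hm hmM h
  rw [hDP q hq] at h
  exact hPinj _ (hfs q hq) (hfM q) m hm hmM h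

section
variable [J.Boundaryless] [FiniteDimensional ℝ V] [IsManifold J ∞ N]
    [J'.Boundaryless] [FiniteDimensional ℝ V'] [IsManifold J' ∞ N'] {f : N → N'}
    (hf : ContMDiff J J' ∞ f) {M : Set N'} (hM : IsEmbeddedSubmanifold J' M) (hfM : ∀ q, f q ∈ M)
include hf hM hfM

/-- A submersion onto an embedded submanifold has smooth local sections. -/
theorem exists_local_section {p : N}
    (hsub : ∀ v ∈ tangentTo J' M (f p), ∃ w : TangentSpace J p, mfderiv J J' f p w = v) :
    ∃ (O : Set N') (σ : N' → N), IsOpen O ∧ f p ∈ O ∧ ContMDiffOn J' J ∞ σ O ∧ σ (f p) = p ∧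
      ∀ m ∈ M, m ∈ O → f (σ m) = m := by
  obtain ⟨φ, hφ, φ', hφ', hp, hfs, W, P, D, s, hDs, hP, hW, hDP, hfeq⟩ :=
    exists_submersion_normal_form hf hM hfM hsub
  set c := φ.extend J with hc
  set c' := φ'.extend J' with hc'
  have hsrc : c.source = φ.source := φ.extend_source
  -- Chosen so that `D (k m) = P (c' m)`, which by the normal form means that the point with
  -- coordinates `k m` is sent to `m`.
  set k : N' → V := fun m => c p + s (P (c' m) - P (c' (f p))) with hk
  have hkO : ContMDiffOn J' 𝓘(ℝ, V) ∞ k φ'.source := by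
    have h1 : ContDiff ℝ ∞ fun x : V' => c p + s (P x - P (c' (f p))) :=
      contDiff_const.add (s.contDiff.comp (P.contDiff.sub contDiff_const))
    exact h1.contMDiff.comp_contMDiffOn (contMDiffOn_extend' hφ')
  have hkp : k (f p) = c p := by simp [hk]
  refine ⟨φ'.source ∩ k ⁻¹' c.target, fun m => c.symm (k m),
    hkO.continuousOn.isOpen_inter_preimage φ'.open_source φ.isOpen_extend_target,
    ⟨hfs p hp, ?_⟩, ?_, ?_, ?_⟩
  · rw [mem_preimage, hkp]
    exact c.map_source (by rwa [hsrc])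
  · exact (contMDiffOn_extend_symm' hφ).comp (hkO.mono inter_subset_left) fun m hm => hm.2
  · simp only [hkp]
    exact c.left_inv (by rwa [hsrc])
  · intro m hmM hm
    have h1 : c.symm (k m) ∈ φ.source := hsrc ▸ c.map_target hm.2
    refine hfeq _ h1 _ hm.1 hmM ?_
    rw [c.right_inv hm.2, hk]
    simp only [map_add, hDs, hDP p hp]
    abel

/-- In the normal form the fibre is a level set of the linear map `D`, so `ker D` is the slice. The
same chart treats both the fibre and the kernel of the derivative. -/
theorem exists_fibre_slice {p : N}
    (hsub : ∀ v ∈ tangentTo J' M (f p), ∃ w : TangentSpace J p, mfderiv J J' f p w = v) :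
    ∃ φ ∈ IsManifold.maximalAtlas J ∞ N, p ∈ φ.source ∧ ∃ K : Submodule ℝ V,
      (∀ q ∈ φ.source, q ∈ f ⁻¹' {f p} ↔ φ.extend J q - φ.extend J p ∈ K) ∧
      ∀ w : TangentSpace J p, mfderiv J J' f p w = 0 →
        (mfderiv J 𝓘(ℝ, V) (φ.extend J) p w : V) ∈ K := by
  obtain ⟨φ, hφ, φ', hφ', hp, hfs, W, P, D, s, hDs, hP, hW, hDP, hfeq⟩ :=
    exists_submersion_normal_form hf hM hfM hsub
  refine ⟨φ, hφ, hp, LinearMap.ker D.toLinearMap, fun q hq => ?_, fun w hw => ?_⟩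
  · rw [LinearMap.mem_ker]
    change f q = f p ↔ D _ = 0
    rw [map_sub, hDP p hp, sub_eq_zero]
    exact ⟨fun h => by rw [hDP q hq, h], hfeq q hq _ (hfs p hp) (hfM p)⟩
  · have hd := mdifferentiableAt_extend' hφ hp
    have hd' := mdifferentiableAt_extend' hφ' (hfs p hp)
    have h4 : (fun q => P (φ'.extend J' (f q))) =ᶠ[𝓝 p] fun q => D (φ.extend J q) := by
      filter_upwards [φ.open_source.mem_nhds hp] with q hq using (hDP q hq).symm
    have h5 := DFunLike.congr_fun (F := V →L[ℝ] W) (mfderiv_comp p (g := D) (f := φ.extend J)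
      D.mdifferentiableAt hd) w
    have h6 := DFunLike.congr_fun (F := V →L[ℝ] W)
      (mfderiv_comp p (g := fun m => P (φ'.extend J' m)) (f := f)
      (P.mdifferentiableAt.comp (f p) hd') (hf.mdifferentiableAt (by simp))) w
    have h7 := DFunLike.congr_fun (F := V →L[ℝ] W) (h4.mfderiv_eq (I := J) (I' := 𝓘(ℝ, W))) w
    have h8 : (mfderiv 𝓘(ℝ, V) 𝓘(ℝ, W) D (φ.extend J p) : V →L[ℝ] W)
        (mfderiv J 𝓘(ℝ, V) (φ.extend J) p w) = 0 := by
      refine h5.symm.trans (h7.symm.trans (h6.trans ?_))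
      change mfderiv J' 𝓘(ℝ, W) (fun m => P (φ'.extend J' m)) (f p) (mfderiv J J' f p w) = 0
      rw [hw, map_zero]
    rw [D.mfderiv_eq] at h8
    exact h8

/-- The fibres of a submersion onto an embedded submanifold are embedded submanifolds. -/
theorem isEmbeddedSubmanifold_fibre
    (hsub : ∀ p, ∀ v ∈ tangentTo J' M (f p), ∃ w : TangentSpace J p, mfderiv J J' f p w = v)
    (m : N') : IsEmbeddedSubmanifold J (f ⁻¹' {m}) := by
  rintro p rfl
  obtain ⟨φ, hφ, hp, K, hK, -⟩ := exists_fibre_slice hf hM hfM (hsub p)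
  exact ⟨φ, hφ, hp, K, hK⟩

/-- The kernel of the derivative of a submersion onto an embedded submanifold is tangent to the
fibre. -/
theorem mem_tangentTo_fibre {p : N}
    (hsub : ∀ v ∈ tangentTo J' M (f p), ∃ w : TangentSpace J p, mfderiv J J' f p w = v)
    {w : TangentSpace J p} (hw : mfderiv J J' f p w = 0) : w ∈ tangentTo J (f ⁻¹' {f p}) p := by
  obtain ⟨φ, hφ, hp, K, hK, hKw⟩ := exists_fibre_slice hf hM hfM hsub
  exact (mem_tangentTo_iff_of_slice hφ hp hK).2 (hKw w hw)

end

/-- A function whose derivative vanishes along a connected embedded submanifold is constant on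
it. -/
theorem eqOn_of_dirDeriv_eq_zero [J.Boundaryless] [FiniteDimensional ℝ V] [IsManifold J ∞ N]
    {S : Set N} (hS : IsEmbeddedSubmanifold J S) (hc : IsPreconnected S) {g : N → ℝ}
    (hg : ContMDiff J 𝓘(ℝ, ℝ) ∞ g) (h0 : ∀ p ∈ S, ∀ v ∈ tangentTo J S p, dirDeriv J v g = 0)
    {p q : N} (hp : p ∈ S) (hq : q ∈ S) : g p = g q := by
  have hloc : ∀ x ∈ S, ∀ᶠ y in 𝓝[S] x, g y = g x := by
    intro x hx
    obtain ⟨φ, hφ, hxφ, W, hW⟩ := hS x hx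
    set c := φ.extend J with hcdef
    have hsrc : c.source = φ.source := φ.extend_source
    have hxc : x ∈ c.source := by rwa [hsrc]
    have hT : IsOpen c.target := φ.isOpen_extend_target
    -- In a ball of the chart, a nearby point of `S` is joined to `x` by a straight segment inside
    -- the slice, along which `g` has zero derivative. Local constancy then spreads by
    -- connectedness.
    obtain ⟨ε, hε, hball⟩ := Metric.isOpen_iff.1 hT (c x) (c.map_source hxc)
    have hcont : ContinuousAt c x :=
      ((contMDiffOn_extend' hφ).contMDiffAt (φ.open_source.mem_nhds hxφ)).continuousAt
    filter_upwards [self_mem_nhdsWithin, mem_nhdsWithin_of_mem_nhds (φ.open_source.mem_nhds hxφ),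
      mem_nhdsWithin_of_mem_nhds (hcont (Metric.ball_mem_nhds (c x) hε))] with y hyS hy hyb
    set u : V := c y - c x with hu
    have huW : u ∈ W := (hW y hy).1 hyS
    have hyu : ‖u‖ < ε := by simpa [hu, dist_eq_norm] using hyb
    set γ : ℝ → N := fun t => c.symm (c x + t • u) with hγ
    have hline : ContDiff ℝ ∞ fun t : ℝ => c x + t • u :=
      contDiff_const.add (contDiff_id.smul contDiff_const)
    set I : Set ℝ := (fun t : ℝ => c x + t • u) ⁻¹' Metric.ball (c x) ε with hI
    have hIo : IsOpen I := Metric.isOpen_ball.preimage hline.continuous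
    have hIsub : Icc (0 : ℝ) 1 ⊆ I := by
      intro t ht
      simp only [hI, mem_preimage, Metric.mem_ball, dist_eq_norm, add_sub_cancel_left, norm_smul,
        Real.norm_eq_abs, abs_of_nonneg ht.1]
      nlinarith [ht.2, norm_nonneg u]
    have hγI : ContMDiffOn 𝓘(ℝ, ℝ) J ∞ γ I :=
      (contMDiffOn_extend_symm' hφ).comp hline.contMDiff.contMDiffOn fun t ht => hball ht
    have hγS : ∀ t ∈ I, γ t ∈ S := by
      intro t ht
      have h1 : γ t ∈ φ.source := hsrc ▸ c.map_target (hball ht)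
      have hd : c (γ t) - c x ∈ W := by
        rw [hγ, c.right_inv (hball ht), add_sub_cancel_left]
        exact W.smul_mem t huW
      exact (hW _ h1).2 hd
    have hderiv : ∀ t ∈ I, HasDerivAt (fun t => g (γ t)) 0 t := by
      intro t ht
      have hγt : ContMDiffAt 𝓘(ℝ, ℝ) J ∞ γ t := hγI.contMDiffAt (hIo.mem_nhds ht)
      have hd : DifferentiableAt ℝ (fun t => g (γ t)) t :=
        (hg.contMDiffAt.comp t hγt).contDiffAt.differentiableAt (by simp)
      have h1 : ContMDiffAt 𝓘(ℝ, ℝ) J ∞ (fun τ => γ (t + τ)) 0 :=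
        ContMDiffAt.comp (g := γ) (f := fun τ : ℝ => t + τ) (0 : ℝ) (by rwa [add_zero])
          (contDiff_const.add contDiff_id).contMDiff.contMDiffAt
      have h2 : mfderiv 𝓘(ℝ, ℝ) J (fun τ => γ (t + τ)) 0 (1 : ℝ) ∈
          tangentTo J S (γ (t + 0)) := by
        refine ⟨_, rfl, h1, ?_, rfl⟩
        have : Tendsto (fun τ : ℝ => t + τ) (𝓝 0) (𝓝 t) := by
          have h3 : Continuous fun τ : ℝ => t + τ := by fun_prop
          simpa using h3.tendsto 0
        filter_upwards [this (hIo.mem_nhds ht)] with τ hτ using hγS _ hτ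
      have h3 := h0 _ (hγS (t + 0) (by rwa [add_zero])) _ h2
      rw [dirDeriv_velocity (p := γ (t + 0)) rfl (h1.mdifferentiableAt (by simp))
        (hg.mdifferentiableAt (by simp))] at h3
      have h4 := hd.hasDerivAt
      have h5 : deriv (fun τ => g (γ (t + τ))) 0 = deriv (fun t => g (γ t)) t := by
        have := deriv_comp_const_add (fun t => g (γ t)) t 0
        rwa [add_zero] at this
      rwa [← h5, h3] at h4
    have h6 : ∀ t ∈ Icc (0 : ℝ) 1, g (γ t) = g (γ 0) := by
      apply constant_of_has_deriv_right_zero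
      · exact fun t ht => (hderiv t (hIsub ht)).continuousAt.continuousWithinAt
      · exact fun t ht => (hderiv t (hIsub ⟨ht.1, ht.2.le⟩)).hasDerivWithinAt
    have h7 := h6 1 ⟨zero_le_one, le_rfl⟩
    have e0 : γ 0 = x := by simp [hγ, c.left_inv hxc]
    have e1 : γ 1 = y := by simp [hγ, hu, c.left_inv (hsrc ▸ hy)]
    rwa [e0, e1] at h7
  refine hc.induction₂ (fun x y => g x = g y) (fun x hx => ?_) (fun _ _ _ _ _ _ => Eq.trans)
    (fun _ _ _ _ => Eq.symm) hp hq
  filter_upwards [hloc x hx] with y hy using hy.symm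

end Submersions

/-! ### Lie algebroids: locality of the bracket, the anchor as a morphism, frames. -/

section AlgebroidTheory
open VectorField
variable {B F Q : Type*} [NormedAddCommGroup B] [NormedSpace ℝ B]
  [NormedAddCommGroup F] [NormedSpace ℝ F]
  [TopologicalSpace Q] [ChartedSpace B Q] [IsManifold 𝓘(ℝ, B) ∞ Q]
  {E : Q → Type*} [∀ x, AddCommGroup (E x)] [∀ x, Module ℝ (E x)] [∀ x, TopologicalSpace (E x)]
  [TopologicalSpace (TotalSpace F E)] [FiberBundle F E] [VectorBundle ℝ F E]
  [ContMDiffVectorBundle ∞ F E 𝓘(ℝ, B)]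

/-- The Hausdorff property provides bump functions on the total spaces of `E` and `E^*`, and
closedness of the fibres of `leg`. -/
theorem t2Space_totalSpace {Q F : Type*} [TopologicalSpace Q] [TopologicalSpace F] [T2Space Q]
    [T2Space F] (E : Q → Type*) [∀ x, TopologicalSpace (E x)] [TopologicalSpace (TotalSpace F E)]
    [FiberBundle F E] : T2Space (TotalSpace F E) := by
  refine ⟨fun a b hab => ?_⟩
  by_cases h : a.1 = b.1
  · let e := trivializationAt F E a.1
    have ha : a ∈ e.source := FiberBundle.mem_trivializationAt_proj_source
    have hb : b ∈ e.source := by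
      rw [e.mem_source, ← h]
      exact FiberBundle.mem_baseSet_trivializationAt' a.1
    obtain ⟨u, v, hu, hv, hau, hbv, huv⟩ :=
      t2_separation (e.toOpenPartialHomeomorph.injOn.ne ha hb hab)
    exact ⟨_, _, e.toOpenPartialHomeomorph.isOpen_inter_preimage hu,
      e.toOpenPartialHomeomorph.isOpen_inter_preimage hv, ⟨ha, hau⟩, ⟨hb, hbv⟩,
      (huv.preimage _).mono inter_subset_right inter_subset_right⟩
  · obtain ⟨u, v, hu, hv, hau, hbv, huv⟩ := t2_separation h
    have hc := FiberBundle.continuous_proj F E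
    exact ⟨_, _, hu.preimage hc, hv.preimage hc, hau, hbv, huv.preimage _⟩

/-- The product of a section with a smooth function. -/
def smulSection (f : Q → ℝ) (hf : ContMDiff 𝓘(ℝ, B) 𝓘(ℝ, ℝ) ∞ f) (Y : Cₛ^∞⟮𝓘(ℝ, B); F, E⟯) :
    Cₛ^∞⟮𝓘(ℝ, B); F, E⟯ :=
  ⟨fun x => f x • Y x, hf.smul_section Y.contMDiff⟩

@[simp] theorem smulSection_apply (f : Q → ℝ) (hf : ContMDiff 𝓘(ℝ, B) 𝓘(ℝ, ℝ) ∞ f)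
    (Y : Cₛ^∞⟮𝓘(ℝ, B); F, E⟯) (x : Q) : smulSection f hf Y x = f x • Y x := rfl

namespace LieAlgebroid
variable (A : LieAlgebroid B F E)

theorem bracket_add_right (X Y Y' : Cₛ^∞⟮𝓘(ℝ, B); F, E⟯) :
    A.bracket X (Y + Y') = A.bracket X Y + A.bracket X Y' := by
  rw [A.bracket_skew, A.bracket_add_left, A.bracket_skew Y X, A.bracket_skew Y' X]
  abel

theorem bracket_sub_right (X Y Y' : Cₛ^∞⟮𝓘(ℝ, B); F, E⟯) :
    A.bracket X (Y - Y') = A.bracket X Y - A.bracket X Y' := by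
  have := A.bracket_add_right X (Y - Y') Y'
  rw [sub_add_cancel] at this
  rw [this, add_sub_cancel_right]

section
variable [FiniteDimensional ℝ B] [T2Space Q]

/-- Locality: `Y = (1 - χ) Y` for a bump function `χ` supported where `Y` vanishes. In the Leibniz
rule at `x` both terms vanish, since `χ x = 1` and `Y x = 0`. -/
theorem bracket_apply_eq_zero (X Y : Cₛ^∞⟮𝓘(ℝ, B); F, E⟯) {x : Q} (hY : ∀ᶠ y in 𝓝 x, Y y = 0) :
    A.bracket X Y x = 0 := by
  obtain ⟨χ, hχ, hs, h1⟩ := exists_bump (J := 𝓘(ℝ, B)) hY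
  have h2 := A.leibniz (fun y => 1 - χ y) (contMDiff_const.sub hχ) X Y Y (fun y => by
    by_cases hy : χ y = 0
    · simp [hy]
    · have : Y y = 0 := hs (subset_tsupport χ hy)
      simp [this]) x
  have h3 : Y x = 0 := hY.self_of_nhds
  have h4 : χ x = 1 := h1.self_of_nhds
  rw [h2, h3, h4]
  simp

/-- The Leibniz rule for a section which is locally a combination of other sections. -/
theorem bracket_sum_right {ι : Type*} (t : Finset ι) (X Z : Cₛ^∞⟮𝓘(ℝ, B); F, E⟯)
    (g : ι → Q → ℝ) (hg : ∀ i, ContMDiff 𝓘(ℝ, B) 𝓘(ℝ, ℝ) ∞ (g i))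
    (s : ι → Cₛ^∞⟮𝓘(ℝ, B); F, E⟯) {x : Q} (hZ : ∀ᶠ y in 𝓝 x, Z y = ∑ i ∈ t, g i y • s i y) :
    A.bracket X Z x = ∑ i ∈ t, (g i x • A.bracket X (s i) x +
      dirDeriv 𝓘(ℝ, B) (A.anchor x (X x)) (g i) • s i x) := by
  classical
  induction t using Finset.induction_on generalizing Z with
  | empty => simpa using A.bracket_apply_eq_zero X Z (by simpa using hZ)
  | insert a t ha ih =>
    have h1 := ih (Z - smulSection (g a) (hg a) (s a)) (by
      filter_upwards [hZ] with y hy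
      simp [hy, Finset.sum_insert ha])
    rw [A.bracket_sub_right] at h1
    have h2 := A.leibniz (g a) (hg a) X (s a) (smulSection (g a) (hg a) (s a)) (fun _ => rfl) x
    rw [Finset.sum_insert ha, ← h1, ← h2]
    simp

/-- The vector field on `Q` which is the anchor of a section. -/
def anchorField (X : Cₛ^∞⟮𝓘(ℝ, B); F, E⟯) (x : Q) : TangentSpace 𝓘(ℝ, B) x := A.anchor x (X x)

omit [FiniteDimensional ℝ B] [T2Space Q] in
theorem contMDiff_anchorField (X : Cₛ^∞⟮𝓘(ℝ, B); F, E⟯) :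
    ContMDiff 𝓘(ℝ, B) 𝓘(ℝ, B).tangent ∞
      (fun x => (⟨x, A.anchorField X x⟩ : TangentBundle 𝓘(ℝ, B) Q)) :=
  A.contMDiff_anchor.comp X.contMDiff

omit [FiniteDimensional ℝ B] [T2Space Q] in
theorem smoothFieldAt_anchorField (X : Cₛ^∞⟮𝓘(ℝ, B); F, E⟯) (x : Q) :
    SmoothFieldAt 𝓘(ℝ, B) (A.anchorField X) x :=
  ⟨univ, isOpen_univ, mem_univ _, (A.contMDiff_anchorField X).contMDiffOn⟩

omit [FiniteDimensional ℝ B] [T2Space Q] in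
theorem contMDiff_dirDeriv_anchorField (X : Cₛ^∞⟮𝓘(ℝ, B); F, E⟯) {f : Q → ℝ}
    (hf : ContMDiff 𝓘(ℝ, B) 𝓘(ℝ, ℝ) ∞ f) :
    ContMDiff 𝓘(ℝ, B) 𝓘(ℝ, ℝ) ∞ fun x => dirDeriv 𝓘(ℝ, B) (A.anchorField X x) f := fun x =>
  ((A.smoothFieldAt_anchorField X x).smoothFunAt_dirDeriv
    ⟨univ, isOpen_univ, mem_univ _, hf.contMDiffOn⟩).contMDiffAt

-- Subtract `f` times the Jacobi identity for `X, Y, Z` from the Jacobi identity for `X, Y, f Z` and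
-- expand by Leibniz: only the second-order terms in `f`, multiplied by `Z`, survive.
omit [FiniteDimensional ℝ B] [T2Space Q] in
theorem anchor_bracket_smul (X Y Z : Cₛ^∞⟮𝓘(ℝ, B); F, E⟯) {f : Q → ℝ}
    (hf : ContMDiff 𝓘(ℝ, B) 𝓘(ℝ, ℝ) ∞ f) (x : Q) :
    (dirDeriv 𝓘(ℝ, B) (A.anchorField (A.bracket X Y) x) f) • Z x =
    (dirDeriv 𝓘(ℝ, B) (A.anchorField X x) (fun y => dirDeriv 𝓘(ℝ, B) (A.anchorField Y y) f) -
      dirDeriv 𝓘(ℝ, B) (A.anchorField Y x)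
        (fun y => dirDeriv 𝓘(ℝ, B) (A.anchorField X y) f)) • Z x := by
  have L1 : ∀ (W : Cₛ^∞⟮𝓘(ℝ, B); F, E⟯) (g : Q → ℝ) (hg : ContMDiff 𝓘(ℝ, B) 𝓘(ℝ, ℝ) ∞ g)
      (T : Cₛ^∞⟮𝓘(ℝ, B); F, E⟯), A.bracket W (smulSection g hg T) =
      smulSection g hg (A.bracket W T) +
        smulSection _ (A.contMDiff_dirDeriv_anchorField W hg) T := by
    intro W g hg T
    ext y
    exact A.leibniz g hg W T _ (fun _ => rfl) y
  have h1 := A.jacobi X Y (smulSection f hf Z)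
  have h2 := A.jacobi X Y Z
  rw [A.bracket_skew (smulSection f hf Z) X, A.bracket_skew (smulSection f hf Z) (A.bracket X Y)]
    at h1
  have hneg : ∀ W T, A.bracket W (-T) = - A.bracket W T := by
    intro W T
    have := A.bracket_sub_right W 0 T
    have h0 := A.bracket_sub_right W 0 0
    rw [sub_self, sub_self] at h0
    rwa [zero_sub, h0, zero_sub] at this
  rw [A.bracket_skew Z X, A.bracket_skew Z (A.bracket X Y)] at h2
  simp only [hneg, L1, A.bracket_add_right] at h1 h2
  have h1x := congrArg (fun W : Cₛ^∞⟮𝓘(ℝ, B); F, E⟯ => W x) h1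
  have h2x := congrArg (fun W : Cₛ^∞⟮𝓘(ℝ, B); F, E⟯ => f x • W x) h2
  simp only [ContMDiffSection.coe_add, ContMDiffSection.coe_neg, Pi.add_apply, Pi.neg_apply,
    smulSection_apply, ContMDiffSection.coe_zero, Pi.zero_apply, smul_zero, smul_add, smul_neg]
    at h1x h2x
  rw [sub_smul, ← sub_eq_zero]
  refine Eq.trans ?_ (congrArg₂ (fun u v : E x => u - v) h2x h1x |>.trans (sub_zero _))
  simp only [anchorField]
  abel

/-- The anchor is compatible with the brackets. -/
theorem dirDeriv_anchor_bracket (X Y : Cₛ^∞⟮𝓘(ℝ, B); F, E⟯) {f : Q → ℝ}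
    (hf : ContMDiff 𝓘(ℝ, B) 𝓘(ℝ, ℝ) ∞ f) (x : Q)  :
    dirDeriv 𝓘(ℝ, B) (A.anchor x (A.bracket X Y x)) f =
    dirDeriv 𝓘(ℝ, B) (A.anchor x (X x)) (fun y => dirDeriv 𝓘(ℝ, B) (A.anchor y (Y y)) f) -
      dirDeriv 𝓘(ℝ, B) (A.anchor x (Y x)) (fun y => dirDeriv 𝓘(ℝ, B) (A.anchor y (X y)) f) := by
  -- Cancelling `Z x` requires a section that does not vanish at `x`. If there is none, the vectors
  -- `X x`, `Y x` and the value of the bracket are all zero.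
  by_cases h : ∃ Z : Cₛ^∞⟮𝓘(ℝ, B); F, E⟯, Z x ≠ 0
  · obtain ⟨Z, hZ⟩ := h
    exact smul_left_injective ℝ hZ (A.anchor_bracket_smul X Y Z hf x)
  · push Not at h
    simp [h]

end
end LieAlgebroid

/-- A frame of the vector bundle `E` near a point, by global sections. -/
structure LocalFrame (B F : Type*) {Q : Type*} [NormedAddCommGroup B] [NormedSpace ℝ B]
    [NormedAddCommGroup F] [NormedSpace ℝ F] [TopologicalSpace Q] [ChartedSpace B Q]
    (E : Q → Type*) [∀ x, AddCommGroup (E x)] [∀ x, Module ℝ (E x)] [∀ x, TopologicalSpace (E x)]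
    [TopologicalSpace (TotalSpace F E)] [FiberBundle F E] [VectorBundle ℝ F E] (x : Q) where
  /-- the rank -/
  rank : ℕ
  /-- the domain -/
  dom : Set Q
  isOpen_dom : IsOpen dom
  mem_dom : x ∈ dom
  /-- the sections -/
  sec : Fin rank → Cₛ^∞⟮𝓘(ℝ, B); F, E⟯
  /-- the coordinates -/
  coord : Fin rank → ∀ y, E y →ₗ[ℝ] ℝ
  sum_coord : ∀ y ∈ dom, ∀ b : E y, ∑ i, coord i y b • sec i y = b
  coord_sec : ∀ y ∈ dom, ∀ i j, coord i y (sec j y) = if i = j then 1 else 0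
  contMDiffOn_coord : ∀ i, ContMDiffOn (𝓘(ℝ, B).prod 𝓘(ℝ, F)) 𝓘(ℝ, ℝ) ∞
    (fun e : TotalSpace F E => coord i e.1 e.2) (TotalSpace.proj ⁻¹' dom)

/-- The bracket acts on global sections, so the frame of the trivialization is cut off by a bump
function and used where the latter is `1`. The link with the trivialization is recorded for use in
`contMDiff_leg`. -/
theorem exists_localFrame_trivializationAt [FiniteDimensional ℝ B] [FiniteDimensional ℝ F]
    [T2Space Q] (x : Q) : ∃ (fr : LocalFrame B F E x) (b : Module.Basis (Fin fr.rank) ℝ F),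
      ∀ y ∈ fr.dom, y ∈ (trivializationAt F E x).baseSet ∧
        ∀ a, fr.sec a y = (trivializationAt F E x).symm y (b a) := by
  let e := trivializationAt F E x
  have hx : x ∈ e.baseSet := FiberBundle.mem_baseSet_trivializationAt' x
  let b := Module.finBasis ℝ F
  obtain ⟨χ, hχ, hs, h1⟩ := exists_bump (J := 𝓘(ℝ, B)) (e.open_baseSet.mem_nhds hx)
  obtain ⟨O, hO, hOo, hxO⟩ := eventually_nhds_iff.1 (h1.and (e.open_baseSet.eventually_mem hx))
  have hloc : ∀ i y, y ∈ e.baseSet → e.localFrame b i y = e.symm y (b i) := by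
    intro i y hy
    rw [Trivialization.localFrame_apply_of_mem_baseSet (hx := hy), Trivialization.basisAt]
    simp
  refine ⟨⟨Module.finrank ℝ F, O, hOo, hxO, fun i => ⟨fun y => χ y • e.localFrame b i y, ?_⟩,
    fun i y => (b.coord i).comp (e.linearMapAt ℝ y), ?_, ?_, ?_⟩, b, fun y hy => ⟨(hO y hy).2, fun a => ?_⟩⟩
  · intro y
    by_cases hy : y ∈ e.baseSet
    · exact hχ.contMDiffAt.smul_section (contMDiffAt_localFrame_of_mem (I := 𝓘(ℝ, B)) (n := ∞) e b i hy)
    · have : ∀ᶠ z in 𝓝 y, χ z = 0 := by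
        have : y ∉ tsupport χ := fun h => hy (hs h)
        filter_upwards [(isClosed_tsupport χ).isOpen_compl.mem_nhds this] with z hz
        exact image_eq_zero_of_notMem_tsupport hz
      refine (contMDiff_zeroSection ℝ E).contMDiffAt.congr_of_eventuallyEq ?_
      filter_upwards [this] with z hz
      simp [hz, zeroSection]
  · intro y hy v
    obtain ⟨h2, h3⟩ := hO y hy
    have h4 := b.sum_repr (e.linearMapAt ℝ y v)
    have h5 := congrArg (e.symmₗ ℝ y) h4
    rw [e.symmₗ_linearMapAt h3, map_sum] at h5
    refine Eq.trans (Finset.sum_congr rfl fun i _ => ?_) h5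
    change _ • (χ y • e.localFrame b i y) = _
    rw [h2, hloc i y h3, one_smul, map_smul, e.coe_symmₗ h3]
    rfl
  · intro y hy i j
    obtain ⟨h2, h3⟩ := hO y hy
    change b.coord i (e.linearMapAt ℝ y (χ y • e.localFrame b j y)) = _
    rw [h2, hloc j y h3, one_smul]
    have h4 := e.linearMapAt_symmₗ (R := ℝ) h3 (b j)
    rw [e.coe_symmₗ h3] at h4
    rw [h4, b.coord_apply, b.repr_self, Finsupp.single_apply]
    simp only [eq_comm]
  · intro i
    have h2 : ContMDiff 𝓘(ℝ, F) 𝓘(ℝ, ℝ) ∞ (b.coord i) :=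
      (LinearMap.toContinuousLinearMap (b.coord i)).contMDiff
    have h3 := h2.comp_contMDiffOn
      (contMDiff_snd.comp_contMDiffOn (e.contMDiffOn (IB := 𝓘(ℝ, B)) (n := ∞)))
    refine (h3.mono fun z hz => ?_).congr fun z hz => ?_
    · rw [e.mem_source]
      exact (hO _ hz).2
    · change b.coord i (e.linearMapAt ℝ z.1 z.2) = _
      rw [e.coe_linearMapAt_of_mem (hO _ hz).2]
      rfl

  · change χ y • e.localFrame b a y = _
    rw [(hO y hy).1, hloc a y (hO y hy).2, one_smul]

theorem exists_localFrame [FiniteDimensional ℝ B] [FiniteDimensional ℝ F] [T2Space Q] (x : Q) :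
    Nonempty (LocalFrame B F E x) :=
  let ⟨fr, _⟩ := exists_localFrame_trivializationAt x
  ⟨fr⟩

end AlgebroidTheory

/-- The algebra of a change of frame: `τ` is the transition matrix, `d` its derivatives along the
sections with coefficients `c`, and `w` the derivatives of the coefficients `g`. -/
theorem sum_smul_bracket_expand {M ι κ β : Type*} [AddCommGroup M] [Module ℝ M] [Fintype ι]
    [Fintype κ] [Fintype β] (br : ι → β → M) (e : β → M) (c : ι → ℝ) (g w : κ → ℝ)
    (τ : κ → β → ℝ) (d : ι → κ → β → ℝ) :
    ∑ i, ∑ j, (c i * g j) • ∑ b, (τ j b • br i b + d i j b • e b) + ∑ j, w j • ∑ b, τ j b • e b =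
    ∑ i, ∑ b, (c i * ∑ j, g j * τ j b) • br i b +
      ∑ b, (∑ j, (w j * τ j b + g j * ∑ i, c i * d i j b)) • e b := by
  simp only [smul_add, Finset.smul_sum, Finset.sum_add_distrib, smul_smul, Finset.mul_sum,
    Finset.sum_smul, add_smul]
  have h1 : ∑ i, ∑ j, ∑ b, (c i * g j * τ j b) • br i b =
      ∑ i, ∑ b, ∑ j, (c i * (g j * τ j b)) • br i b := by
    refine Finset.sum_congr rfl fun i _ => ?_
    rw [Finset.sum_comm]
    simp only [mul_assoc]
  have h2 : ∑ i, ∑ j, ∑ b, (c i * g j * d i j b) • e b =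
      ∑ b, ∑ j, ∑ i, (g j * (c i * d i j b)) • e b := by
    rw [Finset.sum_comm]
    simp_rw [Finset.sum_comm (s := (Finset.univ : Finset ι))]
    rw [Finset.sum_comm]
    refine Finset.sum_congr rfl fun b _ => Finset.sum_congr rfl fun j _ =>
      Finset.sum_congr rfl fun i _ => ?_
    congr 1
    ring
  have h3 : ∑ j, ∑ b, (w j * τ j b) • e b = ∑ b, ∑ j, (w j * τ j b) • e b := Finset.sum_comm
  rw [h1, h2, h3]
  abel

/-! ### The bracket of the prolongation: independence of choices, compatibility with the anchor. -/

section ProlongationBracket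
open VectorField
variable {B F Q : Type*} [NormedAddCommGroup B] [NormedSpace ℝ B]
  [NormedAddCommGroup F] [NormedSpace ℝ F]
  [TopologicalSpace Q] [ChartedSpace B Q] [IsManifold 𝓘(ℝ, B) ∞ Q]
  {E : Q → Type*} [∀ x, AddCommGroup (E x)] [∀ x, Module ℝ (E x)] [∀ x, TopologicalSpace (E x)]
  [TopologicalSpace (TotalSpace F E)] [FiberBundle F E] [VectorBundle ℝ F E]
  [ContMDiffVectorBundle ∞ F E 𝓘(ℝ, B)]
  {V H N : Type*} [NormedAddCommGroup V] [NormedSpace ℝ V] [TopologicalSpace H]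
  [TopologicalSpace N] [ChartedSpace H N] {J : ModelWithCorners ℝ V H} [IsManifold J ∞ N]
  {pr : N → Q} {x₀ : Q}

theorem SmoothFunAt.comp_contMDiff {f : Q → ℝ} {p : N} (hf : SmoothFunAt 𝓘(ℝ, B) f (pr p))
    (hpr : ContMDiff J 𝓘(ℝ, B) ∞ pr) : SmoothFunAt J (fun q => f (pr q)) p := by
  obtain ⟨O, hO, hp, h⟩ := hf
  exact ⟨pr ⁻¹' O, hO.preimage hpr.continuous, hp, h.comp hpr.contMDiffOn fun q hq => hq⟩

theorem smoothFunAt_of_contMDiff {f : N → ℝ} (hf : ContMDiff J 𝓘(ℝ, ℝ) ∞ f) (p : N) :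
    SmoothFunAt J f p :=
  ⟨univ, isOpen_univ, mem_univ _, hf.contMDiffOn⟩

theorem LocalFrame.smoothFunAt_coord (fr : LocalFrame B F E x₀) {p : N} (hp : pr p ∈ fr.dom)
    {O : Set N} (hO : IsOpen O) (hpO : p ∈ O) {Z : ∀ q, E (pr q)}
    (hZ : ContMDiffOn J (𝓘(ℝ, B).prod 𝓘(ℝ, F)) ∞ (fun q => (⟨pr q, Z q⟩ : TotalSpace F E)) O)
    (a : Fin fr.rank) : SmoothFunAt J (fun q => fr.coord a (pr q) (Z q)) p := by
  have h1 : ContinuousOn pr O :=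
    (FiberBundle.continuous_proj F E).comp_continuousOn hZ.continuousOn
  exact ⟨O ∩ pr ⁻¹' fr.dom, h1.isOpen_inter_preimage hO fr.isOpen_dom, ⟨hpO, hp⟩,
    (fr.contMDiffOn_coord a).comp (hZ.mono inter_subset_left) fun q hq => hq.2⟩

theorem LocalFrame.smoothFunAt_coord_section (fr : LocalFrame B F E x₀) {x : Q} (hx : x ∈ fr.dom)
    (s : Cₛ^∞⟮𝓘(ℝ, B); F, E⟯) (a : Fin fr.rank) :
    SmoothFunAt 𝓘(ℝ, B) (fun y => fr.coord a y (s y)) x :=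
  fr.smoothFunAt_coord (pr := fun y => y) hx isOpen_univ (mem_univ _) s.contMDiff.contMDiffOn a

section
variable [FiniteDimensional ℝ B] [T2Space Q] (A : LieAlgebroid B F E)

theorem LocalFrame.bracket_eq (fr : LocalFrame B F E x₀) {x : Q} (hx : x ∈ fr.dom)
    (s t : Cₛ^∞⟮𝓘(ℝ, B); F, E⟯) :
    A.bracket s t x = ∑ b, (fr.coord b x (t x) • A.bracket s (fr.sec b) x +
      dirDeriv 𝓘(ℝ, B) (A.anchor x (s x)) (fun y => fr.coord b y (t y)) • fr.sec b x) := by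
  have h1 : ∀ b, ∃ f : Q → ℝ, ContMDiff 𝓘(ℝ, B) 𝓘(ℝ, ℝ) ∞ f ∧
      f =ᶠ[𝓝 x] fun y => fr.coord b y (t y) := fun b => by
    obtain ⟨O, hO, hxO, h⟩ := fr.smoothFunAt_coord_section hx t b
    exact exists_contMDiff_eventuallyEq hO hxO h
  choose f hf hfe using h1
  rw [A.bracket_sum_right Finset.univ s t f hf fr.sec]
  · refine Finset.sum_congr rfl fun b _ => ?_
    rw [dirDeriv_congr _ (hfe b), (hfe b).self_of_nhds]
  · filter_upwards [eventually_all.2 hfe, fr.isOpen_dom.mem_nhds hx] with y hy hyO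
    simp only [hy]
    exact (fr.sum_coord y hyO _).symm

/-- The part of the bracket formula that involves derivatives of the second section does not change
when that section is re-expanded in the frame. By `hu`, the derivative of a transition function
along `u` equals its derivative along the anchor of `∑ c_i s_i`, which is the term that the Leibniz
rule produces. -/
theorem LocalFrame.sum_bracket_eq (fr : LocalFrame B F E x₀) (hpr : ContMDiff J 𝓘(ℝ, B) ∞ pr)
    {p : N} (hp : pr p ∈ fr.dom)
    {ι κ : Type*} [Fintype ι] [Fintype κ] (s : ι → Cₛ^∞⟮𝓘(ℝ, B); F, E⟯) (c : ι → ℝ)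
    (u : TangentSpace J p)
    (hu : A.anchor (pr p) (∑ i, c i • s i (pr p)) = mfderiv J 𝓘(ℝ, B) pr p u)
    (t : κ → Cₛ^∞⟮𝓘(ℝ, B); F, E⟯) (g : κ → N → ℝ) (hg : ∀ j, SmoothFunAt J (g j) p)
    (Z : ∀ q : N, E (pr q)) (hZ : ∀ᶠ q in 𝓝 p, Z q = ∑ j, g j q • t j (pr q)) :
    ∑ i, ∑ j, (c i * g j p) • A.bracket (s i) (t j) (pr p) +
      ∑ j, dirDeriv J u (g j) • t j (pr p) =
    ∑ i, ∑ b, (c i * fr.coord b (pr p) (Z p)) • A.bracket (s i) (fr.sec b) (pr p) +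
      ∑ b, dirDeriv J u (fun q => fr.coord b (pr q) (Z q)) • fr.sec b (pr p) := by
  set τ : κ → Fin fr.rank → Q → ℝ := fun j b y => fr.coord b y (t j y) with hτ
  have hτs : ∀ j b, SmoothFunAt 𝓘(ℝ, B) (τ j b) (pr p) := fun j b =>
    fr.smoothFunAt_coord_section hp (t j) b
  have hprd : MDifferentiableAt J 𝓘(ℝ, B) pr p := hpr.mdifferentiableAt (by simp)
  have h1 : ∀ b, fr.coord b (pr p) (Z p) = ∑ j, g j p * τ j b (pr p) := fun b => by
    rw [hZ.self_of_nhds, map_sum]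
    simp [hτ]
  have h2 : ∀ b, dirDeriv J u (fun q => fr.coord b (pr q) (Z q)) =
      ∑ j, (dirDeriv J u (g j) * τ j b (pr p) +
        g j p * ∑ i, c i * dirDeriv 𝓘(ℝ, B) (A.anchor (pr p) (s i (pr p))) (τ j b)) := fun b => by
    have h3 : (fun q => fr.coord b (pr q) (Z q)) =ᶠ[𝓝 p] fun q => ∑ j, g j q * τ j b (pr q) := by
      filter_upwards [hZ] with q hq
      rw [hq, map_sum]
      simp [hτ]
    have hm : ∀ j, MDifferentiableAt J 𝓘(ℝ, ℝ) (fun q => τ j b (pr q)) p := fun j =>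
      ((hτs j b).comp_contMDiff hpr).mdifferentiableAt
    rw [dirDeriv_congr u h3, dirDeriv_sum Finset.univ u (f := fun j q => g j q * τ j b (pr q))
      fun j _ => (hg j).mdifferentiableAt.mul (hm j)]
    refine Finset.sum_congr rfl fun j _ => ?_
    rw [dirDeriv_mul u (hg j).mdifferentiableAt (hm j),
      ← dirDeriv_mfderiv u hprd (hτs j b).mdifferentiableAt, ← hu]
    simp only [map_sum, map_smul, dirDeriv_vec_sum, dirDeriv_vec_smul]
  have h4 : ∀ j, t j (pr p) = ∑ b, τ j b (pr p) • fr.sec b (pr p) := fun j =>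
    (fr.sum_coord _ hp _).symm
  simp only [h1, h2, fun i j => fr.bracket_eq A hp (s i) (t j)]
  conv_lhs =>
    enter [2, 2, j]
    rw [h4 j]
  exact sum_smul_bracket_expand (fun i b => A.bracket (s i) (fr.sec b) (pr p))
    (fun b => fr.sec b (pr p)) c (fun j => g j p) (fun j => dirDeriv J u (g j))
    (fun j b => τ j b (pr p)) _

/-- The `E`-component of the bracket of two sections of the prolongation, in a frame. -/
def LocalFrame.bracketFst (fr : LocalFrame B F E x₀) (A : LieAlgebroid B F E) (J : ModelWithCorners ℝ V H) (pr : N → Q)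
    (Z₁ Z₂ : ∀ q : N, E (pr q) × TangentSpace J q) (p : N) : E (pr p) :=
  ∑ a, ∑ b, (fr.coord a (pr p) (Z₁ p).1 * fr.coord b (pr p) (Z₂ p).1) •
      A.bracket (fr.sec a) (fr.sec b) (pr p)
    + ∑ b, dirDeriv J (Z₁ p).2 (fun q => fr.coord b (pr q) (Z₂ q).1) • fr.sec b (pr p)
    - ∑ a, dirDeriv J (Z₂ p).2 (fun q => fr.coord a (pr q) (Z₁ q).1) • fr.sec a (pr p)

variable [FiniteDimensional ℝ V] [T2Space N]

theorem LocalFrame.isBracketFst (fr : LocalFrame B F E x₀) {p : N} (hp : pr p ∈ fr.dom)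
    (hpr : ContMDiff J 𝓘(ℝ, B) ∞ pr)
    {O : Set N} (hO : IsOpen O) (hpO : p ∈ O) {Z₁ Z₂ : ∀ q : N, E (pr q) × TangentSpace J q}
    (hZ₁ : ContMDiffOn J (𝓘(ℝ, B).prod 𝓘(ℝ, F)) ∞
      (fun q => (⟨pr q, (Z₁ q).1⟩ : TotalSpace F E)) O)
    (hZ₂ : ContMDiffOn J (𝓘(ℝ, B).prod 𝓘(ℝ, F)) ∞
      (fun q => (⟨pr q, (Z₂ q).1⟩ : TotalSpace F E)) O) :
    IsBracketFst J A pr Z₁ Z₂ p (fr.bracketFst A J pr Z₁ Z₂ p) := by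
  have h1 : ∀ {Z : ∀ q : N, E (pr q) × TangentSpace J q} (_ : ContMDiffOn J
      (𝓘(ℝ, B).prod 𝓘(ℝ, F)) ∞ (fun q => (⟨pr q, (Z q).1⟩ : TotalSpace F E)) O) (a : Fin fr.rank),
      ∃ f : N → ℝ, ContMDiff J 𝓘(ℝ, ℝ) ∞ f ∧ f =ᶠ[𝓝 p] fun q => fr.coord a (pr q) (Z q).1 :=
    fun {Z} hZ a => by
      obtain ⟨U, hU, hpU, h⟩ := fr.smoothFunAt_coord hp hO hpO hZ a
      exact exists_contMDiff_eventuallyEq hU hpU h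
  choose f hf hfe using h1 hZ₁
  choose g hg hge using h1 hZ₂
  have hdom : ∀ᶠ q in 𝓝 p, pr q ∈ fr.dom :=
    hpr.continuous.continuousAt.eventually (fr.isOpen_dom.mem_nhds hp)
  refine ⟨fr.rank, fr.sec, f, g, hf, hg, ?_, ?_, ?_⟩
  · filter_upwards [eventually_all.2 hfe, hdom] with q hq hqd
    simp only [hq, fr.sum_coord _ hqd]
  · filter_upwards [eventually_all.2 hge, hdom] with q hq hqd
    simp only [hq, fr.sum_coord _ hqd]
  · simp only [LocalFrame.bracketFst, fun i => (hfe i).self_of_nhds,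
      fun i => (hge i).self_of_nhds, fun i => dirDeriv_congr (Z₁ p).2 (hge i),
      fun i => dirDeriv_congr (Z₂ p).2 (hfe i)]

-- Uniqueness of the value singled out by `IsBracketFst`: re-expand one section in the frame, then
-- the other, with skew-symmetry exchanging their roles.
omit [FiniteDimensional ℝ V] [T2Space N] in
theorem LocalFrame.eq_of_isBracketFst (fr : LocalFrame B F E x₀) {p : N} (hp : pr p ∈ fr.dom)
    (hpr : ContMDiff J 𝓘(ℝ, B) ∞ pr) {Z₁ Z₂ : ∀ q : N, E (pr q) × TangentSpace J q}
    (hZ₁ : Z₁ p ∈ prolongation J A pr p) (hZ₂ : Z₂ p ∈ prolongation J A pr p)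
    {b : E (pr p)} (h : IsBracketFst J A pr Z₁ Z₂ p b) :
    b = fr.bracketFst A J pr Z₁ Z₂ p := by
  obtain ⟨r, s, f, g, hf, hg, hfZ, hgZ, rfl⟩ := h
  have h1 := fr.sum_bracket_eq A hpr hp s (fun i => f i p) (Z₁ p).2
    (by rw [← hfZ.self_of_nhds]; exact hZ₁) s g (fun j => smoothFunAt_of_contMDiff (hg j) p) _ hgZ
  have h2 := fr.sum_bracket_eq A hpr hp fr.sec (fun b => fr.coord b (pr p) (Z₂ p).1) (Z₂ p).2
    (by rw [fr.sum_coord _ hp]; exact hZ₂) s f (fun j => smoothFunAt_of_contMDiff (hf j) p) _ hfZ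
  rw [h1]
  have h3 : ∑ i, ∑ b, (f i p * fr.coord b (pr p) (Z₂ p).1) • A.bracket (s i) (fr.sec b) (pr p) =
      - ∑ b, ∑ i, (fr.coord b (pr p) (Z₂ p).1 * f i p) • A.bracket (fr.sec b) (s i) (pr p) := by
    rw [Finset.sum_comm, ← Finset.sum_neg_distrib]
    refine Finset.sum_congr rfl fun b _ => ?_
    rw [← Finset.sum_neg_distrib]
    refine Finset.sum_congr rfl fun i _ => ?_
    rw [A.bracket_skew (s i), mul_comm, ContMDiffSection.coe_neg, Pi.neg_apply, smul_neg]
  have h4 : ∑ a, ∑ b, (fr.coord a (pr p) (Z₁ p).1 * fr.coord b (pr p) (Z₂ p).1) •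
      A.bracket (fr.sec a) (fr.sec b) (pr p) =
      - ∑ b, ∑ a, (fr.coord b (pr p) (Z₂ p).1 * fr.coord a (pr p) (Z₁ p).1) •
      A.bracket (fr.sec b) (fr.sec a) (pr p) := by
    rw [Finset.sum_comm, ← Finset.sum_neg_distrib]
    refine Finset.sum_congr rfl fun b _ => ?_
    rw [← Finset.sum_neg_distrib]
    refine Finset.sum_congr rfl fun i _ => ?_
    rw [A.bracket_skew (fr.sec i), mul_comm, ContMDiffSection.coe_neg, Pi.neg_apply, smul_neg]
  rw [LocalFrame.bracketFst, h3, h4, ← sub_eq_zero]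
  rw [← sub_eq_zero] at h2
  refine Eq.trans ?_ ((congrArg (fun v : E (pr p) => -v) h2).trans neg_zero)
  abel

/-- Existence and uniqueness together show that the choice operator in `prolongationBracket` returns
the expected value, in any frame around the point. -/
theorem LocalFrame.prolongationBracket_fst (fr : LocalFrame B F E x₀) {p : N}
    (hp : pr p ∈ fr.dom) (hpr : ContMDiff J 𝓘(ℝ, B) ∞ pr)
    {Z₁ Z₂ : ∀ q : N, E (pr q) × TangentSpace J q}
    (hZ₁ : IsSection J A pr Z₁) (hZ₂ : IsSection J A pr Z₂) :
    (prolongationBracket J A pr Z₁ Z₂ p).1 = fr.bracketFst A J pr Z₁ Z₂ p :=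
  fr.eq_of_isBracketFst A hp hpr (hZ₁.1 p) (hZ₂.1 p)
    (Classical.epsilon_spec ⟨_, fr.isBracketFst A hp hpr isOpen_univ (mem_univ p) hZ₁.2.1 hZ₂.2.1⟩)

omit [FiniteDimensional ℝ B] [T2Space Q] [FiniteDimensional ℝ V] [T2Space N] in
theorem IsSection.smoothFieldAt {Z : ∀ q : N, E (pr q) × TangentSpace J q}
    (hZ : IsSection J A pr Z) (p : N) : SmoothFieldAt J (fun q => (Z q).2) p :=
  ⟨univ, isOpen_univ, mem_univ p, hZ.2.2⟩

/-- Both sides are vectors on `Q`, so they are compared on functions `g` of `Q`, the right side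
acting on `g ∘ pr`. The identity reduces to compatibility of the anchor with the brackets of frame
sections. -/
theorem prolongationBracket_mem [FiniteDimensional ℝ F] [J.Boundaryless]
    (hpr : ContMDiff J 𝓘(ℝ, B) ∞ pr) {Z₁ Z₂ : ∀ q : N, E (pr q) × TangentSpace J q}
    (hZ₁ : IsSection J A pr Z₁) (hZ₂ : IsSection J A pr Z₂) (p : N) :
    prolongationBracket J A pr Z₁ Z₂ p ∈ prolongation J A pr p := by
  have : CompleteSpace V := FiniteDimensional.complete ℝ V
  obtain ⟨fr⟩ := exists_localFrame (B := B) (F := F) (E := E) (pr p)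
  have hp := fr.mem_dom
  change A.anchor (pr p) (prolongationBracket J A pr Z₁ Z₂ p).1 =
    mfderiv J 𝓘(ℝ, B) pr p (mlieBracket J (fun q => (Z₁ q).2) (fun q => (Z₂ q).2) p)
  rw [fr.prolongationBracket_fst A hp hpr hZ₁ hZ₂]
  have hprd : ∀ q, MDifferentiableAt J 𝓘(ℝ, B) pr q := fun q => hpr.mdifferentiableAt (by simp)
  refine tangent_ext fun g₀ U hU hpU hg₀ => ?_
  obtain ⟨g, hg, hge⟩ := exists_contMDiff_eventuallyEq hU hpU hg₀
  rw [← dirDeriv_congr _ hge, ← dirDeriv_congr _ hge,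
    dirDeriv_mfderiv _ (hprd p) (hg.mdifferentiableAt (by simp)),
    dirDeriv_mlieBracket (g := fun q => g (pr q)) (hZ₁.smoothFieldAt A p) (hZ₂.smoothFieldAt A p)
      (smoothFunAt_of_contMDiff (hg.comp hpr) p)]
  have hρ : ∀ a, SmoothFunAt 𝓘(ℝ, B)
      (fun y => dirDeriv 𝓘(ℝ, B) (A.anchor y (fr.sec a y)) g) (pr p) := fun a =>
    smoothFunAt_of_contMDiff (A.contMDiff_dirDeriv_anchorField (fr.sec a) hg) _
  have hdom : ∀ᶠ q in 𝓝 p, pr q ∈ fr.dom :=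
    hpr.continuous.continuousAt.eventually (fr.isOpen_dom.mem_nhds hp)
  -- The iterated derivative `u(Z(g ∘ pr))` in frame coordinates: derivatives of the coordinates of
  -- `Z`, plus iterated anchors applied to `g`.
  have h1 : ∀ (u : TangentSpace J p) (b : E (pr p)) (_ : A.anchor (pr p) b = mfderiv J 𝓘(ℝ, B) pr p u)
      (Z : ∀ q : N, E (pr q) × TangentSpace J q) (_ : IsSection J A pr Z),
      dirDeriv J u (fun q => dirDeriv J (Z q).2 fun q => g (pr q)) =
      ∑ b, dirDeriv J u (fun q => fr.coord b (pr q) (Z q).1) *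
        dirDeriv 𝓘(ℝ, B) (A.anchor (pr p) (fr.sec b (pr p))) g +
      ∑ a, ∑ c, (fr.coord a (pr p) b * fr.coord c (pr p) (Z p).1) *
        dirDeriv 𝓘(ℝ, B) (A.anchor (pr p) (fr.sec a (pr p)))
          (fun y => dirDeriv 𝓘(ℝ, B) (A.anchor y (fr.sec c y)) g) := by
    intro u b hb Z hZ
    have h2 : (fun q => dirDeriv J (Z q).2 fun q => g (pr q)) =ᶠ[𝓝 p] fun q =>
        ∑ c, fr.coord c (pr q) (Z q).1 *
          dirDeriv 𝓘(ℝ, B) (A.anchor (pr q) (fr.sec c (pr q))) g := by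
      filter_upwards [hdom] with q hq
      have h3 : A.anchor (pr q) (Z q).1 = mfderiv J 𝓘(ℝ, B) pr q (Z q).2 := hZ.1 q
      rw [← dirDeriv_mfderiv _ (hprd q) (hg.mdifferentiableAt (by simp)), ← h3]
      conv_lhs => rw [← fr.sum_coord _ hq (Z q).1]
      simp only [map_sum, map_smul, dirDeriv_vec_sum, dirDeriv_vec_smul]
    have h4 : ∀ c, MDifferentiableAt J 𝓘(ℝ, ℝ) (fun q => fr.coord c (pr q) (Z q).1) p := fun c =>
      (fr.smoothFunAt_coord hp isOpen_univ (mem_univ _) hZ.2.1 c).mdifferentiableAt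
    have h5 : ∀ c, MDifferentiableAt J 𝓘(ℝ, ℝ)
        (fun q => dirDeriv 𝓘(ℝ, B) (A.anchor (pr q) (fr.sec c (pr q))) g) p := fun c =>
      ((hρ c).comp_contMDiff hpr).mdifferentiableAt
    rw [dirDeriv_congr u h2, dirDeriv_sum Finset.univ u (f := fun c q => fr.coord c (pr q) (Z q).1 *
          dirDeriv 𝓘(ℝ, B) (A.anchor (pr q) (fr.sec c (pr q))) g) fun c _ => (h4 c).mul (h5 c),
      Finset.sum_comm, ← Finset.sum_add_distrib]
    refine Finset.sum_congr rfl fun c _ => ?_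
    rw [dirDeriv_mul u (h4 c) (h5 c), ← dirDeriv_mfderiv u (hprd p) (hρ c).mdifferentiableAt, ← hb]
    conv_lhs => rw [← fr.sum_coord _ hp b]
    simp only [map_sum, map_smul, dirDeriv_vec_sum, dirDeriv_vec_smul, Finset.mul_sum]
    congr 1
    · refine Finset.sum_congr rfl fun a _ => ?_
      ring
  rw [h1 _ _ (hZ₁.1 p) Z₂ hZ₂, h1 _ _ (hZ₂.1 p) Z₁ hZ₁, LocalFrame.bracketFst]
  simp only [map_sum, map_smul, map_add, map_sub, dirDeriv_vec_sum, dirDeriv_vec_smul,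
    dirDeriv_vec_add, dirDeriv_vec_sub, A.dirDeriv_anchor_bracket _ _ hg]
  simp only [mul_sub, Finset.sum_sub_distrib]
  -- Renaming the indices in one double sum matches it with the second half of the commutators of
  -- anchors.
  rw [Finset.sum_comm (f := fun a c => (fr.coord a (pr p) (Z₂ p).1 * fr.coord c (pr p) (Z₁ p).1) *
        dirDeriv 𝓘(ℝ, B) (A.anchor (pr p) (fr.sec a (pr p)))
          (fun y => dirDeriv 𝓘(ℝ, B) (A.anchor y (fr.sec c y)) g))]
  simp only [mul_comm (fr.coord _ (pr p) (Z₂ p).1) (fr.coord _ (pr p) (Z₁ p).1)]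
  ring

/-- The elements of the prolongation whose anchor is tangent to an embedded submanifold form a Lie
subalgebroid as soon as they form a vector bundle. -/
theorem isLieSubalgebroid_prolongationTo [FiniteDimensional ℝ F] [J.Boundaryless]
    (hpr : ContMDiff J 𝓘(ℝ, B) ∞ pr) {S : Set N} (hS : IsEmbeddedSubmanifold J S)
    (hb : IsSubbundle B F J pr S (prolongationTo J A pr S)) :
    IsLieSubalgebroid J A pr S (prolongationTo J A pr S) where
  submanifold := hS
  subbundle := hb
  subset _ _ _ hz := hz.1
  anchor_tangent _ _ _ hz := hz.2
  bracket_mem p hp _ _ hZ₁ hZ₂ h₁ h₂ := ⟨prolongationBracket_mem A hpr hZ₁ hZ₂ p,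
    mlieBracket_mem_tangentTo hS hp (hZ₁.smoothFieldAt A p) (hZ₂.smoothFieldAt A p)
      (h₁.mono fun _ h => h.2) (h₂.mono fun _ h => h.2)⟩

end
end ProlongationBracket

/-! ### Vertical lifts and calculus along the fibres of a vector bundle. -/

section Vertical
variable {B F Q : Type*} [NormedAddCommGroup B] [NormedSpace ℝ B]
  [NormedAddCommGroup F] [NormedSpace ℝ F]
  [TopologicalSpace Q] [ChartedSpace B Q] [IsManifold 𝓘(ℝ, B) ∞ Q]
  {E : Q → Type*} [∀ x, AddCommGroup (E x)] [∀ x, Module ℝ (E x)] [∀ x, TopologicalSpace (E x)]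
  [TopologicalSpace (TotalSpace F E)] [FiberBundle F E] [VectorBundle ℝ F E]
  [ContMDiffVectorBundle ∞ F E 𝓘(ℝ, B)]
  {V H N : Type*} [NormedAddCommGroup V] [NormedSpace ℝ V] [TopologicalSpace H]
  [TopologicalSpace N] [ChartedSpace H N] {J : ModelWithCorners ℝ V H}

variable (F E) in
/-- The identification of a fibre with the model fibre. -/
def fibreCoord (x : Q) : E x →L[ℝ] F := (trivializationAt F E x).continuousLinearMapAt ℝ x

variable (F E) in
/-- The inclusion of a fibre, identified with the model fibre, in the total space. -/
def fibreIncl (x : Q) (y : F) : TotalSpace F E := ⟨x, (trivializationAt F E x).symmL ℝ x y⟩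

@[simp] theorem fibreIncl_fst (x : Q) (y : F) : (fibreIncl F E x y).1 = x := rfl

@[simp] theorem fibreIncl_fibreCoord {x : Q} (a : E x) :
    fibreIncl F E x (fibreCoord F E x a) = ⟨x, a⟩ := by
  rw [fibreIncl, fibreCoord, Trivialization.symmL_continuousLinearMapAt _
    (FiberBundle.mem_baseSet_trivializationAt' x)]

@[simp] theorem fibreCoord_fibreIncl (x : Q) (y : F) :
    fibreCoord F E x (fibreIncl F E x y).2 = y :=
  Trivialization.continuousLinearMapAt_symmL _ (FiberBundle.mem_baseSet_trivializationAt' x) y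

theorem fibreCoord_injective (x : Q) : Function.Injective (fibreCoord F E x) := fun a b h => by
  have h1 := fibreIncl_fibreCoord (F := F) (E := E) a
  rw [h, fibreIncl_fibreCoord] at h1
  exact (TotalSpace.mk_injective (F := F) (E := E) x h1).symm

theorem trivializationAt_snd (x : Q) {e : TotalSpace F E}
    (he : e.1 ∈ (trivializationAt F E x).baseSet) :
    ((trivializationAt F E x) e).2 = (trivializationAt F E x).continuousLinearMapAt ℝ e.1 e.2 := by
  rw [Trivialization.continuousLinearMapAt_apply, Trivialization.coe_linearMapAt_of_mem _ he]

theorem trivializationAt_fibreIncl (x : Q) (y : F) :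
    (trivializationAt F E x (fibreIncl F E x y)).2 = y := by
  rw [trivializationAt_snd _ (FiberBundle.mem_baseSet_trivializationAt' x)]
  exact fibreCoord_fibreIncl x y

theorem fibreIncl_trivializationAt {x : Q} {q : TotalSpace F E} (hq : q.1 = x) :
    fibreIncl F E x (trivializationAt F E x q).2 = q := by
  subst hq
  rw [trivializationAt_snd (e := q) _ (FiberBundle.mem_baseSet_trivializationAt' q.1)]
  exact fibreIncl_fibreCoord q.2

theorem contMDiff_fibreIncl (x : Q) : ContMDiff 𝓘(ℝ, F) (IE B F) ∞ (fibreIncl F E x) := by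
  intro y
  rw [contMDiffAt_totalSpace]
  refine ⟨contMDiffAt_const, ?_⟩
  simp only [fibreIncl_fst, trivializationAt_fibreIncl]
  exact contMDiffAt_id

/-- Reduces every vertical derivative to ordinary calculus on the fixed vector space `F`. -/
theorem mfderiv_vertLift {f : TotalSpace F E → N} {e : TotalSpace F E} (b : E e.1)
    (hf : MDifferentiableAt (IE B F) J f e) : (mfderiv (IE B F) J f e (vertLift B e b) : V) =
    mfderiv 𝓘(ℝ, F) J (fun y => f (fibreIncl F E e.1 y)) (fibreCoord F E e.1 e.2)
      (fibreCoord F E e.1 b) := by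
  have h := mfderiv_comp_of_eq (I := 𝓘(ℝ, F)) (I' := IE B F) (I'' := J)
    (x := fibreCoord F E e.1 e.2) (g := f) (f := fibreIncl F E e.1) (y := e) hf
    ((contMDiff_fibreIncl e.1).mdifferentiableAt (by simp)) (fibreIncl_fibreCoord e.2)
  have h' : ∀ q : TotalSpace F E, q = e → (mfderiv (IE B F) J f q : B × F →L[ℝ] V) =
      mfderiv (IE B F) J f e := by
    rintro q rfl
    rfl
  refine Eq.trans ?_ (DFunLike.congr_fun (F := F →L[ℝ] V) h (fibreCoord F E e.1 b)).symm
  exact (DFunLike.congr_fun (h' (fibreIncl F E e.1 (fibreCoord F E e.1 e.2)) (fibreIncl_fibreCoord e.2))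
    (vertLift B e b)).symm

theorem dirDeriv_vertLift {f : TotalSpace F E → ℝ} {e : TotalSpace F E} (b : E e.1)
    (hf : MDifferentiableAt (IE B F) 𝓘(ℝ, ℝ) f e) : dirDeriv (IE B F) (vertLift B e b) f =
    fderiv ℝ (fun y => f (fibreIncl F E e.1 y)) (fibreCoord F E e.1 e.2)
      (fibreCoord F E e.1 b) := by
  refine (mfderiv_vertLift b hf).trans ?_
  rw [mfderiv_eq_fderiv]
  rfl

theorem mfderiv_proj_vertLift (e : TotalSpace F E) (b : E e.1) :
    mfderiv (IE B F) 𝓘(ℝ, B) TotalSpace.proj e (vertLift B e b) = 0 := by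
  refine (mfderiv_vertLift b ((contMDiff_proj E (n := ∞)).mdifferentiableAt (by simp))).trans ?_
  have : (fun y => TotalSpace.proj (fibreIncl F E e.1 y)) = fun _ => e.1 := rfl
  rw [this, mfderiv_const]
  rfl

theorem contMDiffAt_trivializationAt_snd (e : TotalSpace F E) :
    ContMDiffAt (IE B F) 𝓘(ℝ, F) ∞ (fun e' => (trivializationAt F E e.1 e').2) e :=
  ((contMDiffAt_totalSpace (f := fun e' : TotalSpace F E => e')).1 contMDiffAt_id).2

theorem mfderiv_trivializationAt_snd_vertLift (e : TotalSpace F E) (b : E e.1) :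
    (mfderiv (IE B F) 𝓘(ℝ, F) (fun e' => (trivializationAt F E e.1 e').2) e
      (vertLift B e b) : F) = fibreCoord F E e.1 b := by
  refine (mfderiv_vertLift b
    ((contMDiffAt_trivializationAt_snd e).mdifferentiableAt (by simp))).trans ?_
  have h3 : (fun y => (trivializationAt F E e.1 (fibreIncl F E e.1 y)).2) = fun y => y :=
    funext fun y => trivializationAt_fibreIncl e.1 y
  rw [h3, mfderiv_eq_fderiv]
  exact DFunLike.congr_fun (F := F →L[ℝ] F) fderiv_fun_id _

/-- The derivative of the fibre coordinate recovers `b` from its lift. -/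
theorem vertLift_injective (e : TotalSpace F E) : Function.Injective (vertLift B e) := by
  intro b b' h
  have h4 := mfderiv_trivializationAt_snd_vertLift (B := B) e b
  rw [h] at h4
  have h5 : fibreCoord F E e.1 b = fibreCoord F E e.1 b' :=
    h4.symm.trans (mfderiv_trivializationAt_snd_vertLift e b')
  exact fibreCoord_injective e.1 h5

/-- Translating by multiples of a section is smooth. -/
theorem contMDiff_add_smul (s : Cₛ^∞⟮𝓘(ℝ, B); F, E⟯) :
    ContMDiff ((IE B F).prod 𝓘(ℝ, ℝ)) (IE B F) ∞
      (fun q : TotalSpace F E × ℝ => (⟨q.1.1, q.1.2 + q.2 • s q.1.1⟩ : TotalSpace F E)) := by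
  intro q₀
  rw [contMDiffAt_totalSpace]
  have hfst : ContMDiffAt ((IE B F).prod 𝓘(ℝ, ℝ)) 𝓘(ℝ, B) ∞
      (fun q : TotalSpace F E × ℝ => q.1.1) q₀ :=
    (contMDiff_proj E).contMDiffAt.comp q₀ contMDiffAt_fst
  refine ⟨hfst, ?_⟩
  have h1 : ContMDiffAt ((IE B F).prod 𝓘(ℝ, ℝ)) 𝓘(ℝ, F) ∞
      (fun q : TotalSpace F E × ℝ => (trivializationAt F E q₀.1.1 q.1).2) q₀ :=
    (contMDiffAt_totalSpace.1 (contMDiffAt_fst (I := IE B F) (J := 𝓘(ℝ, ℝ)) (p := q₀))).2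
  have h2 : ContMDiffAt ((IE B F).prod 𝓘(ℝ, ℝ)) 𝓘(ℝ, F) ∞
      (fun q : TotalSpace F E × ℝ => (trivializationAt F E q₀.1.1 ⟨q.1.1, s q.1.1⟩).2) q₀ :=
    ContMDiffAt.comp (g := fun x => (trivializationAt F E q₀.1.1 ⟨x, s x⟩).2) q₀
      ((contMDiffAt_section _).1 (s.contMDiff q₀.1.1)) hfst
  refine (h1.add (contMDiffAt_snd.smul h2)).congr_of_eventuallyEq ?_
  filter_upwards [hfst.continuousAt ((trivializationAt F E q₀.1.1).open_baseSet.mem_nhds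
    (FiberBundle.mem_baseSet_trivializationAt' q₀.1.1))] with q hq
  change q.1.1 ∈ (trivializationAt F E q₀.1.1).baseSet at hq
  simp only [Pi.add_apply, Pi.smul_apply']
  rw [trivializationAt_snd (e := q.1) _ hq,
    trivializationAt_snd (e := ⟨q.1.1, q.1.2 + q.2 • s q.1.1⟩) _ hq,
    trivializationAt_snd (e := ⟨q.1.1, s q.1.1⟩) _ hq, map_add, map_smul]

/-- The vertical derivative of a smooth function along a section is smooth. -/
theorem contMDiff_dirDeriv_vertLift {f : TotalSpace F E → ℝ}
    (hf : ContMDiff (IE B F) 𝓘(ℝ, ℝ) ∞ f) (s : Cₛ^∞⟮𝓘(ℝ, B); F, E⟯) :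
    ContMDiff (IE B F) 𝓘(ℝ, ℝ) ∞ (fun e => dirDeriv (IE B F) (vertLift B e (s e.1)) f) := by
  intro e₀
  -- The vertical derivative is the `t`-derivative of `g` at `0`, and derivatives depend smoothly on
  -- parameters.
  let g : TotalSpace F E → ℝ → ℝ := fun e t => f ⟨e.1, e.2 + t • s e.1⟩
  have h1 := ContMDiffAt.mfderiv (n := ∞) (m := ∞) (I := 𝓘(ℝ, ℝ)) (I' := 𝓘(ℝ, ℝ)) (J := IE B F)
    (x₀ := e₀) g (fun _ => 0)
    ((hf.comp (contMDiff_add_smul s)) _) contMDiffAt_const (by simp)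
  have h2 := h1.clm_apply (contMDiffAt_const (c := (1 : ℝ)))
  refine h2.congr_of_eventuallyEq (Eventually.of_forall fun e => ?_)
  simp only [inTangentCoordinates_model_space, mfderiv_eq_fderiv]
  rw [dirDeriv_vertLift _ (hf.mdifferentiableAt (by simp))]
  have h3 : g e = fun t => f (fibreIncl F E e.1 (fibreCoord F E e.1 e.2 + t • fibreCoord F E e.1 (s e.1))) := by
    funext t
    rw [← map_smul, ← map_add, fibreIncl_fibreCoord]
  have h4 : DifferentiableAt ℝ (fun y => f (fibreIncl F E e.1 y)) (fibreCoord F E e.1 e.2) :=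
    ((hf.comp (contMDiff_fibreIncl e.1)).contDiff.differentiable (by simp)).differentiableAt
  have h5 : HasDerivAt (fun t : ℝ => fibreCoord F E e.1 e.2 + t • fibreCoord F E e.1 (s e.1))
      (fibreCoord F E e.1 (s e.1)) 0 := by
    simpa using ((hasDerivAt_id (0 : ℝ)).smul_const (fibreCoord F E e.1 (s e.1))).const_add
      (fibreCoord F E e.1 e.2)
  have h6 := HasFDerivAt.comp_hasDerivAt_of_eq (0 : ℝ) h4.hasFDerivAt h5 (by simp)
  rw [h3]
  exact (h6.deriv).symm

end Vertical

/-! ### The Cartan 2-section in a local frame. -/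

section CartanForm
variable {B F Q : Type*} [NormedAddCommGroup B] [NormedSpace ℝ B]
  [NormedAddCommGroup F] [NormedSpace ℝ F]
  [TopologicalSpace Q] [ChartedSpace B Q] [IsManifold 𝓘(ℝ, B) ∞ Q]
  {E : Q → Type*} [∀ x, AddCommGroup (E x)] [∀ x, Module ℝ (E x)] [∀ x, TopologicalSpace (E x)]
  [TopologicalSpace (TotalSpace F E)] [FiberBundle F E] [VectorBundle ℝ F E]
  [ContMDiffVectorBundle ∞ F E 𝓘(ℝ, B)]

theorem exists_section_eq [FiniteDimensional ℝ B] [FiniteDimensional ℝ F] [T2Space Q] {x : Q}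
    (b : E x) : ∃ s : Cₛ^∞⟮𝓘(ℝ, B); F, E⟯, s x = b := by
  obtain ⟨fr⟩ := exists_localFrame (B := B) (F := F) (E := E) x
  refine ⟨∑ a, fr.coord a x b • fr.sec a, ?_⟩
  refine Eq.trans ?_ (fr.sum_coord x fr.mem_dom b)
  have h : ∀ t : Finset (Fin fr.rank), (∑ a ∈ t, fr.coord a x b • fr.sec a) x =
      ∑ a ∈ t, fr.coord a x b • fr.sec a x := by
    classical
    intro t
    induction t using Finset.induction_on with
    | empty => rfl
    | insert a t ha ih =>
      rw [Finset.sum_insert ha, Finset.sum_insert ha, ← ih]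
      rfl
  exact h _

/-- A vector field on the total space of `E` which lifts the anchor of a section. -/
theorem exists_lift_anchorField (A : LieAlgebroid B F E) (s : Cₛ^∞⟮𝓘(ℝ, B); F, E⟯)
    (e : TotalSpace F E) (v : TangentSpace (IE B F) e)
    (hv : mfderiv (IE B F) 𝓘(ℝ, B) TotalSpace.proj e v = A.anchor e.1 (s e.1)) :
    ∃ (O : Set (TotalSpace F E)) (U : ∀ q : TotalSpace F E, TangentSpace (IE B F) q),
      IsOpen O ∧ e ∈ O ∧ ContMDiffOn (IE B F) (IE B F).tangent ∞
        (fun q => (⟨q, U q⟩ : TangentBundle (IE B F) (TotalSpace F E))) O ∧ U e = v ∧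
      ∀ q ∈ O, mfderiv (IE B F) 𝓘(ℝ, B) TotalSpace.proj q (U q) = A.anchor q.1 (s q.1) := by
  let T := trivializationAt F E e.1
  have : IsManifold 𝓘(ℝ, B) 1 Q := IsManifold.of_le (n := ∞) (by simp)
  have hT : ContMDiffOn (IE B F) (IE B F) ∞ T T.source := T.contMDiffOn
  have hTs : ContMDiffOn (IE B F) (IE B F) ∞ T.toOpenPartialHomeomorph.symm T.target :=
    T.contMDiffOn_symm
  have heT : e ∈ T.source := FiberBundle.mem_trivializationAt_proj_source
  have hTd : ∀ q ∈ T.source, MDifferentiableAt (IE B F) (IE B F) T q := fun q hq =>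
    (hT.contMDiffAt (T.open_source.mem_nhds hq)).mdifferentiableAt (by simp)
  have hTsd : ∀ q ∈ T.source, MDifferentiableAt (IE B F) (IE B F)
      T.toOpenPartialHomeomorph.symm (T q) := fun q hq =>
    (hTs.contMDiffAt (T.open_target.mem_nhds (T.map_source hq))).mdifferentiableAt (by simp)
  let c : F := (mfderiv (IE B F) (IE B F) T e v : B × F).2
  -- In the trivialization, the lift has the anchor as base component and a constant fibre
  -- component, adjusted to give `v` at `e`.
  let w : ∀ q : TotalSpace F E, B × F := fun q => (A.anchor q.1 (s q.1), c)
  let U : ∀ q : TotalSpace F E, TangentSpace (IE B F) q := fun q =>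
    (mfderiv (IE B F) (IE B F) T.toOpenPartialHomeomorph.symm (T q) : B × F →L[ℝ] B × F) (w q)
  refine ⟨T.source, U, T.open_source, heT, ?_, ?_, ?_⟩
  · have h1 : ContMDiffOn (IE B F) (𝓘(ℝ, B).tangent.prod 𝓘(ℝ, F).tangent) ∞
        (fun q : TotalSpace F E => ((⟨q.1, A.anchor q.1 (s q.1)⟩, ⟨(T q).2, c⟩) :
          TangentBundle 𝓘(ℝ, B) Q × TangentBundle 𝓘(ℝ, F) F)) T.source := by
      refine ((A.contMDiff_anchorField s).comp (contMDiff_proj E)).contMDiffOn.prodMk ?_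
      have h2 : ContMDiff 𝓘(ℝ, F) 𝓘(ℝ, F).tangent ∞
          (fun y : F => (⟨y, c⟩ : TangentBundle 𝓘(ℝ, F) F)) :=
        contMDiff_vectorSpace_iff_contDiff.2 contDiff_const
      exact h2.comp_contMDiffOn (contMDiff_snd.comp_contMDiffOn hT)
    have h2 := (contMDiff_equivTangentBundleProd_symm (I := 𝓘(ℝ, B)) (I' := 𝓘(ℝ, F)) (M := Q)
      (M' := F) (n := ∞)).comp_contMDiffOn h1
    have h3 := hTs.contMDiffOn_tangentMapWithin (m := ∞) (by simp) T.open_target.uniqueMDiffOn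
    have h4 := h3.comp h2 (fun q hq => by
      change (q.1, (T q).2) ∈ T.target
      rw [← T.coe_fst hq]
      exact T.map_source hq)
    refine h4.congr fun q hq => ?_
    have h5 : T q = (q.1, (T q).2) := by
      rw [← T.coe_fst hq]
    have h6 : ∀ y : Q × F, T q = y → y ∈ T.target → (⟨q, U q⟩ : TangentBundle (IE B F) (TotalSpace F E)) =
      ⟨T.toOpenPartialHomeomorph.symm y, (mfderivWithin (IE B F) (IE B F)
        T.toOpenPartialHomeomorph.symm T.target y : B × F →L[ℝ] B × F) (w q)⟩ := by
      rintro y rfl hy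
      rw [mfderivWithin_of_isOpen T.open_target hy]
      have h7 : q = T.toOpenPartialHomeomorph.symm (T q) :=
        (T.toOpenPartialHomeomorph.left_inv hq).symm
      exact TotalSpace.ext h7 HEq.rfl
    refine h6 (q.1, (T q).2) h5 ?_
    rw [← h5]
    exact T.map_source hq
  · have h1 := mfderiv_comp e (hTsd e heT) (hTd e heT)
    have h2 : T.toOpenPartialHomeomorph.symm ∘ T =ᶠ[𝓝 e] id := by
      filter_upwards [T.open_source.mem_nhds heT] with q hq using
        T.toOpenPartialHomeomorph.left_inv hq
    have h3 := h2.mfderiv_eq (I := IE B F) (I' := IE B F)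
    have h4 : w e = (mfderiv (IE B F) (IE B F) T e v : B × F) := by
      refine Prod.ext ?_ rfl
      have h5 := mfderiv_comp e (I'' := 𝓘(ℝ, B)) (g := Prod.fst) (mdifferentiableAt_fst) (hTd e heT)
      have h6 : Prod.fst ∘ T =ᶠ[𝓝 e] TotalSpace.proj := by
        filter_upwards [T.open_source.mem_nhds heT] with q hq using T.coe_fst hq
      have h7 := h6.mfderiv_eq (I := IE B F) (I' := 𝓘(ℝ, B))
      rw [mfderiv_fst] at h5
      refine hv.symm.trans ?_
      exact (DFunLike.congr_fun (F := B × F →L[ℝ] B) (h7.symm.trans h5) v)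
    change (mfderiv (IE B F) (IE B F) T.toOpenPartialHomeomorph.symm (T e) : B × F →L[ℝ] B × F) (w e) = v
    rw [h4]
    refine (DFunLike.congr_fun (F := B × F →L[ℝ] B × F) (h1.symm.trans h3) v).trans ?_
    exact DFunLike.congr_fun (F := B × F →L[ℝ] B × F) mfderiv_id v
  · intro q hq
    have h1 := mfderiv_comp (T q) (I'' := 𝓘(ℝ, B)) (g := TotalSpace.proj)
      ((contMDiff_proj E (n := ∞)).mdifferentiableAt (by simp)) (hTsd q hq)
    have h2 : TotalSpace.proj ∘ T.toOpenPartialHomeomorph.symm =ᶠ[𝓝 (T q)] Prod.fst := by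
      filter_upwards [T.open_target.mem_nhds (T.map_source hq)] with y hy using
        T.proj_symm_apply hy
    have h3 := h2.mfderiv_eq (I := (IE B F)) (I' := 𝓘(ℝ, B))
    rw [mfderiv_fst] at h3
    have h4 := DFunLike.congr_fun (F := B × F →L[ℝ] B) (h1.symm.trans h3) (w q)
    refine Eq.trans ?_ h4
    have h6 : ∀ q' : TotalSpace F E, q = q' → (mfderiv (IE B F) 𝓘(ℝ, B) TotalSpace.proj q : B × F →L[ℝ] B)
      = mfderiv (IE B F) 𝓘(ℝ, B) TotalSpace.proj q' := by
      rintro _ rfl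
      rfl
    exact DFunLike.congr_fun (h6 (T.toOpenPartialHomeomorph.symm (T q))
      (T.toOpenPartialHomeomorph.left_inv hq).symm) (U q)

/-- Every element of `𝒯^E E` extends to a section, so the choice operator in `differential` has
something to choose from. -/
theorem exists_isSection [FiniteDimensional ℝ B] [FiniteDimensional ℝ F] [T2Space Q]
    (A : LieAlgebroid B F E) {e : TotalSpace F E} {z : E e.1 × TangentSpace (IE B F) e}
    (hz : z ∈ prolongation (IE B F) A TotalSpace.proj e) :
    ∃ Z : ∀ q : TotalSpace F E, E q.1 × TangentSpace (IE B F) q,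
      IsSection (IE B F) A TotalSpace.proj Z ∧ Z e = z := by
  have : T2Space (TotalSpace F E) := t2Space_totalSpace E
  obtain ⟨s, hs⟩ := exists_section_eq (B := B) (F := F) z.1
  have hz' : A.anchor e.1 z.1 = mfderiv (IE B F) 𝓘(ℝ, B) TotalSpace.proj e z.2 := hz
  obtain ⟨O, U, hO, heO, hU, hUe, hUp⟩ := exists_lift_anchorField A s e z.2 (by rw [hs, hz'])
  obtain ⟨χ, hχ, hsup, h1⟩ := exists_bump (J := IE B F) (hO.mem_nhds heO)
  have hχO : ∀ q, q ∉ O → χ q = 0 := fun q hq =>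
    image_eq_zero_of_notMem_tsupport fun h => hq (hsup h)
  refine ⟨fun q => (χ q • s q.1, χ q • U q), ⟨fun q => ?_, ?_, ?_⟩, ?_⟩
  · change A.anchor q.1 (χ q • s q.1) = mfderiv (IE B F) 𝓘(ℝ, B) TotalSpace.proj q (χ q • U q)
    by_cases hq : q ∈ O
    · rw [map_smul, map_smul, hUp q hq]
    · rw [hχO q hq, zero_smul, zero_smul, map_zero, map_zero]
  · have h2 : ContMDiff (IE B F) ((IE B F).prod 𝓘(ℝ, ℝ)) ∞
        (fun q : TotalSpace F E => ((zeroSection F E q.1, χ q) : TotalSpace F E × ℝ)) :=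
      ((contMDiff_zeroSection ℝ E).comp (contMDiff_proj E)).prodMk hχ
    refine ((contMDiff_add_smul s).comp h2).contMDiffOn.congr fun q _ => ?_
    simp [zeroSection]
  · rw [contMDiffOn_univ]
    intro q
    by_cases hq : q ∈ O
    · exact hχ.contMDiffAt.smul_section (hU.contMDiffAt (hO.mem_nhds hq))
    · refine ((contMDiff_zeroSection ℝ (TangentSpace (IE B F) : TotalSpace F E → Type _))
        q).congr_of_eventuallyEq ?_
      have h3 : q ∉ tsupport χ := fun h => hq (hsup h)
      filter_upwards [(isClosed_tsupport χ).isOpen_compl.mem_nhds h3] with q' hq'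
      simp [image_eq_zero_of_notMem_tsupport hq', zeroSection]
  · have h2 : χ e = 1 := h1.self_of_nhds
    simp only [h2, one_smul, hs, hUe]

/-- The momentum of a section, as a function on `E`. -/
def momentum (L : TotalSpace F E → ℝ) (s : Cₛ^∞⟮𝓘(ℝ, B); F, E⟯) (e : TotalSpace F E) : ℝ :=
  dirDeriv (IE B F) (vertLift B e (s e.1)) L

theorem contMDiff_momentum {L : TotalSpace F E → ℝ} (hL : ContMDiff (IE B F) 𝓘(ℝ, ℝ) ∞ L)
    (s : Cₛ^∞⟮𝓘(ℝ, B); F, E⟯) : ContMDiff (IE B F) 𝓘(ℝ, ℝ) ∞ (momentum L s) :=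
  contMDiff_dirDeriv_vertLift hL s

/-- The Cartan 2-section in a frame. -/
theorem cartanTwo_eq [FiniteDimensional ℝ B] [FiniteDimensional ℝ F] [T2Space Q]
    (A : LieAlgebroid B F E) {L : TotalSpace F E → ℝ} (hL : ContMDiff (IE B F) 𝓘(ℝ, ℝ) ∞ L)
    {x₀ : Q} (fr : LocalFrame B F E x₀) {e : TotalSpace F E} (he : e.1 ∈ fr.dom)
    {z₁ z₂ : E e.1 × TangentSpace (IE B F) e}
    (hz₁ : z₁ ∈ prolongation (IE B F) A TotalSpace.proj e)
    (hz₂ : z₂ ∈ prolongation (IE B F) A TotalSpace.proj e) :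
    cartanTwo A L e z₁ z₂ =
      ∑ a, fr.coord a e.1 z₁.1 * dirDeriv (IE B F) z₂.2 (momentum L (fr.sec a))
      - ∑ a, fr.coord a e.1 z₂.1 * dirDeriv (IE B F) z₁.2 (momentum L (fr.sec a))
      + ∑ a, ∑ b, fr.coord a e.1 z₁.1 * fr.coord b e.1 z₂.1 *
        momentum L (A.bracket (fr.sec a) (fr.sec b)) e := by
  have : T2Space (TotalSpace F E) := t2Space_totalSpace E
  have hθ : ∀ q : TotalSpace F E, q.1 ∈ fr.dom → ∀ z : E q.1 × TangentSpace (IE B F) q,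
      cartanOne B L q z = ∑ a, fr.coord a q.1 z.1 * momentum L (fr.sec a) q := by
    intro q hq z
    change dirDeriv (IE B F) (vertLift B q z.1) L = _
    conv_lhs => rw [← fr.sum_coord _ hq z.1]
    simp only [map_sum, map_smul, dirDeriv_vec_sum, dirDeriv_vec_smul, momentum]
  have hdom : ∀ᶠ q : TotalSpace F E in 𝓝 e, q.1 ∈ fr.dom :=
    (FiberBundle.continuous_proj F E).continuousAt.eventually (fr.isOpen_dom.mem_nhds he)
  have hm : ∀ a, MDifferentiableAt (IE B F) 𝓘(ℝ, ℝ) (momentum L (fr.sec a)) e := fun a =>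
    (contMDiff_momentum hL _).mdifferentiableAt (by simp)
  have hd : ∀ (u : TangentSpace (IE B F) e) (Z : ∀ q : TotalSpace F E, E q.1 × TangentSpace (IE B F) q)
      (_ : IsSection (IE B F) A TotalSpace.proj Z),
      dirDeriv (IE B F) u (fun q => cartanOne B L q (Z q)) =
      ∑ a, dirDeriv (IE B F) u (fun q => fr.coord a q.1 (Z q).1) * momentum L (fr.sec a) e +
      ∑ a, fr.coord a e.1 (Z e).1 * dirDeriv (IE B F) u (momentum L (fr.sec a)) := by
    intro u Z hZ
    have h1 : (fun q => cartanOne B L q (Z q)) =ᶠ[𝓝 e]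
        fun q => ∑ a, fr.coord a q.1 (Z q).1 * momentum L (fr.sec a) q := by
      filter_upwards [hdom] with q hq using hθ q hq _
    have h2 : ∀ a, MDifferentiableAt (IE B F) 𝓘(ℝ, ℝ) (fun q => fr.coord a q.1 (Z q).1) e :=
      fun a => (fr.smoothFunAt_coord he isOpen_univ (mem_univ _) hZ.2.1 a).mdifferentiableAt
    rw [dirDeriv_congr u h1, dirDeriv_sum Finset.univ u
      (f := fun a q => fr.coord a q.1 (Z q).1 * momentum L (fr.sec a) q)
      fun a _ => (h2 a).mul (hm a), ← Finset.sum_add_distrib]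
    exact Finset.sum_congr rfl fun a _ => dirDeriv_mul u (h2 a) (hm a)
  obtain ⟨Z₁, hZ₁, hZe₁⟩ := exists_isSection A hz₁
  obtain ⟨Z₂, hZ₂, hZe₂⟩ := exists_isSection A hz₂
  rw [cartanTwo, differential]
  -- From here on `Z₁` and `Z₂` are the extensions hidden behind the choice operator; the previous
  -- pair only shows that some exist. The final formula involves only their values at `e`.
  obtain ⟨Z₁, Z₂, hZ₁, hZ₂, rfl, rfl, hc⟩ := Classical.epsilon_spec
    (p := fun c : ℝ => ∃ Z₁ Z₂ : ∀ q : TotalSpace F E, E q.1 × TangentSpace (IE B F) q,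
    IsSection (IE B F) A TotalSpace.proj Z₁ ∧ IsSection (IE B F) A TotalSpace.proj Z₂ ∧
    Z₁ e = z₁ ∧ Z₂ e = z₂ ∧
    c = dirDeriv (IE B F) z₁.2 (fun q => cartanOne B L q (Z₂ q))
      - dirDeriv (IE B F) z₂.2 (fun q => cartanOne B L q (Z₁ q))
      - cartanOne B L e (prolongationBracket (IE B F) A TotalSpace.proj Z₁ Z₂ e))
    ⟨_, Z₁, Z₂, hZ₁, hZ₂, hZe₁, hZe₂, rfl⟩
  have hbr : cartanOne B L e (prolongationBracket (IE B F) A TotalSpace.proj Z₁ Z₂ e) =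
      ∑ a, ∑ b, (fr.coord a e.1 (Z₁ e).1 * fr.coord b e.1 (Z₂ e).1) *
        momentum L (A.bracket (fr.sec a) (fr.sec b)) e +
      ∑ b, dirDeriv (IE B F) (Z₁ e).2 (fun q => fr.coord b q.1 (Z₂ q).1) *
        momentum L (fr.sec b) e -
      ∑ a, dirDeriv (IE B F) (Z₂ e).2 (fun q => fr.coord a q.1 (Z₁ q).1) *
        momentum L (fr.sec a) e := by
    change dirDeriv (IE B F) (vertLift B e
      (prolongationBracket (IE B F) A TotalSpace.proj Z₁ Z₂ e).1) L = _
    rw [fr.prolongationBracket_fst A he (contMDiff_proj E) hZ₁ hZ₂, LocalFrame.bracketFst]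
    simp only [map_sum, map_smul, map_add, map_sub, dirDeriv_vec_sum, dirDeriv_vec_smul,
      dirDeriv_vec_add, dirDeriv_vec_sub, momentum]
  refine (congrArg Neg.neg hc).trans ?_
  -- The derivatives of the coordinates of `Z₁` and `Z₂` cancel against those in the bracket.
  rw [hd _ Z₂ hZ₂, hd _ Z₁ hZ₁, hbr]
  ring

end CartanForm

/-! ### The Legendre transformation and the fibrewise Hessian of `L`. -/

section Legendre
variable {B F Q : Type*} [NormedAddCommGroup B] [NormedSpace ℝ B]
  [NormedAddCommGroup F] [NormedSpace ℝ F]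
  [TopologicalSpace Q] [ChartedSpace B Q] [IsManifold 𝓘(ℝ, B) ∞ Q]
  {E : Q → Type*} [∀ x, AddCommGroup (E x)] [∀ x, Module ℝ (E x)] [∀ x, TopologicalSpace (E x)]
  [TopologicalSpace (TotalSpace F E)] [FiberBundle F E] [VectorBundle ℝ F E]
  [ContMDiffVectorBundle ∞ F E 𝓘(ℝ, B)]

theorem inCoordinates_dual_apply {x₀ x : Q} (hx : x ∈ (trivializationAt F E x₀).baseSet)
    (φ : Dual E x) (c : F) :
    ContinuousLinearMap.inCoordinates F E ℝ (Bundle.Trivial Q ℝ) x₀ x x₀ x φ c =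
      φ ((trivializationAt F E x₀).symm x c) := by
  rw [ContinuousLinearMap.inCoordinates_eq hx (mem_univ _)]
  simp

theorem fibreCoord_dual_apply (x : Q) (φ : Dual E x) (c : F) :
    fibreCoord (F →L[ℝ] ℝ) (Dual E) x φ c = φ (fibreIncl F E x c).2 := by
  have hx : x ∈ (trivializationAt F E x).baseSet := FiberBundle.mem_baseSet_trivializationAt' x
  have h : fibreCoord (F →L[ℝ] ℝ) (Dual E) x φ =
      ContinuousLinearMap.inCoordinates F E ℝ (Bundle.Trivial Q ℝ) x x x x φ := by
    have h1 := trivializationAt_snd (F := F →L[ℝ] ℝ) (E := Dual E) x (e := ⟨x, φ⟩)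
      (FiberBundle.mem_baseSet_trivializationAt' x)
    rw [hom_trivializationAt_apply] at h1
    exact h1.symm
  rw [h, inCoordinates_dual_apply hx]
  congr 1
  exact (Trivialization.symmL_apply _ hx c).symm

variable {L : TotalSpace F E → ℝ}

theorem leg_apply_section (s : Cₛ^∞⟮𝓘(ℝ, B); F, E⟯) (e : TotalSpace F E) :
    (leg B L e).2 (s e.1) = momentum L s e := rfl

theorem momentum_congr (s : Cₛ^∞⟮𝓘(ℝ, B); F, E⟯) {e e' : TotalSpace F E}
    (h : leg B L e = leg B L e') : momentum L s e = momentum L s e' := by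
  rw [← leg_apply_section, ← leg_apply_section]
  exact congrArg (fun m : TotalSpace (F →L[ℝ] ℝ) (Dual E) => m.2 (s m.1)) h

section
variable [FiniteDimensional ℝ B] [FiniteDimensional ℝ F] [T2Space Q]

/-- In the dual frame the coefficients of `leg` are the momenta of the frame sections, which are
smooth. -/
theorem contMDiff_leg (hL : ContMDiff (IE B F) 𝓘(ℝ, ℝ) ∞ L) :
    ContMDiff (IE B F) (IEd B F) ∞ (leg B L) := by
  intro e₀
  rw [contMDiffAt_hom_bundle]
  refine ⟨(contMDiff_proj E).contMDiffAt, ?_⟩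
  obtain ⟨fr, b, hb⟩ := exists_localFrame_trivializationAt (B := B) (F := F) (E := E) e₀.1
  have h1 : ContMDiff (IE B F) 𝓘(ℝ, F →L[ℝ] ℝ) ∞
      (fun e => ∑ a, momentum L (fr.sec a) e • LinearMap.toContinuousLinearMap (b.coord a)) := by
    refine contMDiff_finsetSum fun a _ => ?_
    exact (contMDiff_momentum hL (fr.sec a)).smul contMDiff_const
  refine h1.contMDiffAt.congr_of_eventuallyEq ?_
  filter_upwards [(FiberBundle.continuous_proj F E).continuousAt.eventually
    (fr.isOpen_dom.mem_nhds fr.mem_dom)] with e he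
  refine ContinuousLinearMap.coe_injective (b.ext fun a => ?_)
  refine (inCoordinates_dual_apply (hb _ he).1 _ _).trans ?_
  change (leg B L e).2 ((trivializationAt F E e₀.1).symm e.1 (b a)) = _
  rw [← (hb _ he).2 a, leg_apply_section]
  simp [Finsupp.single_apply]

theorem contMDiff_energy (hL : ContMDiff (IE B F) 𝓘(ℝ, ℝ) ∞ L) :
    ContMDiff (IE B F) 𝓘(ℝ, ℝ) ∞ (energy B L) := by
  intro e₀
  obtain ⟨fr⟩ := exists_localFrame (B := B) (F := F) (E := E) e₀.1
  have hO : IsOpen (TotalSpace.proj ⁻¹' fr.dom : Set (TotalSpace F E)) :=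
    fr.isOpen_dom.preimage (FiberBundle.continuous_proj F E)
  have h1 : ContMDiffOn (IE B F) 𝓘(ℝ, ℝ) ∞
      (fun e => ∑ a, fr.coord a e.1 e.2 * momentum L (fr.sec a) e - L e)
      (TotalSpace.proj ⁻¹' fr.dom) := by
    refine ContMDiffOn.sub (contMDiffOn_finsetSum fun a _ => ?_) hL.contMDiffOn
    exact (fr.contMDiffOn_coord a).mul (contMDiff_momentum hL (fr.sec a)).contMDiffOn
  refine (h1.contMDiffAt (hO.mem_nhds fr.mem_dom)).congr_of_eventuallyEq ?_
  filter_upwards [hO.mem_nhds fr.mem_dom] with e he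
  change dirDeriv (IE B F) (vertLift B e e.2) L - L e = _
  conv_lhs => rw [← fr.sum_coord e.1 he e.2]
  simp only [map_sum, map_smul, dirDeriv_vec_sum, dirDeriv_vec_smul, momentum]

end

theorem contDiff_comp_fibreIncl (hL : ContMDiff (IE B F) 𝓘(ℝ, ℝ) ∞ L) (x : Q) :
    ContDiff ℝ ∞ fun y => L (fibreIncl F E x y) :=
  (hL.comp (contMDiff_fibreIncl x)).contDiff

theorem leg_fibreIncl_apply (hL : ContMDiff (IE B F) 𝓘(ℝ, ℝ) ∞ L) (x : Q) (y : F) (b : E x) :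
    (leg B L (fibreIncl F E x y)).2 b =
      fderiv ℝ (fun y => L (fibreIncl F E x y)) y (fibreCoord F E x b) := by
  refine (dirDeriv_vertLift (e := fibreIncl F E x y) b (hL.mdifferentiableAt (by simp))).trans ?_
  exact congrArg (fun y' => fderiv ℝ (fun y => L (fibreIncl F E x y)) y' (fibreCoord F E x b))
    (fibreCoord_fibreIncl x y)

/-- On a fibre, `leg` is the ordinary derivative of `L`, so its vertical derivative is the Hessian.
-/
theorem leg_fibreIncl (hL : ContMDiff (IE B F) 𝓘(ℝ, ℝ) ∞ L) (x : Q) (y : F) :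
    leg B L (fibreIncl F E x y) = fibreIncl (F →L[ℝ] ℝ) (Dual E) x
      (fderiv ℝ (fun y => L (fibreIncl F E x y)) y) := by
  have h := fibreIncl_fibreCoord (F := F →L[ℝ] ℝ) (E := Dual E) (x := x)
    (leg B L (fibreIncl F E x y)).2
  refine h.symm.trans (congrArg _ ?_)
  ext c
  refine (fibreCoord_dual_apply x _ c).trans ((leg_fibreIncl_apply hL x y _).trans ?_)
  rw [fibreCoord_fibreIncl]

theorem dirDeriv_vertLift_momentum [FiniteDimensional ℝ B] [FiniteDimensional ℝ F] [T2Space Q]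
    (hL : ContMDiff (IE B F) 𝓘(ℝ, ℝ) ∞ L) (s : Cₛ^∞⟮𝓘(ℝ, B); F, E⟯)
    (e : TotalSpace F E) (c : E e.1) :
    dirDeriv (IE B F) (vertLift B e c) (momentum L s) =
      fderiv ℝ (fderiv ℝ fun y => L (fibreIncl F E e.1 y)) (fibreCoord F E e.1 e.2)
        (fibreCoord F E e.1 c) (fibreCoord F E e.1 (s e.1)) := by
  rw [dirDeriv_vertLift _ ((contMDiff_momentum hL s).mdifferentiableAt (by simp))]
  have h : (fun y => momentum L s (fibreIncl F E e.1 y)) = fun y =>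
      fderiv ℝ (fun y => L (fibreIncl F E e.1 y)) y (fibreCoord F E e.1 (s e.1)) :=
    funext fun y => leg_fibreIncl_apply hL e.1 y _
  have hd : DifferentiableAt ℝ (fderiv ℝ fun y => L (fibreIncl F E e.1 y))
      (fibreCoord F E e.1 e.2) :=
    ((contDiff_comp_fibreIncl hL e.1).fderiv_right (m := ∞) (by simp)).differentiable
      (by simp) |>.differentiableAt
  rw [h, fderiv_clm_apply hd (differentiableAt_const _)]
  simp

/-- On a fibre the energy is `DL(y) y - L(y)`; the first-order terms of its derivative cancel and
leave the Hessian paired with the Euler vector. -/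
theorem dirDeriv_vertLift_energy [FiniteDimensional ℝ B] [FiniteDimensional ℝ F] [T2Space Q]
    (hL : ContMDiff (IE B F) 𝓘(ℝ, ℝ) ∞ L) (e : TotalSpace F E) (c : E e.1) :
    dirDeriv (IE B F) (vertLift B e c) (energy B L) =
      fderiv ℝ (fderiv ℝ fun y => L (fibreIncl F E e.1 y)) (fibreCoord F E e.1 e.2)
        (fibreCoord F E e.1 c) (fibreCoord F E e.1 e.2) := by
  rw [dirDeriv_vertLift _ ((contMDiff_energy hL).mdifferentiableAt (by simp))]
  have h : (fun y => energy B L (fibreIncl F E e.1 y)) = fun y =>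
      fderiv ℝ (fun y => L (fibreIncl F E e.1 y)) y y - L (fibreIncl F E e.1 y) := by
    funext y
    have h1 := leg_fibreIncl_apply hL e.1 y (fibreIncl F E e.1 y).2
    rw [fibreCoord_fibreIncl] at h1
    rw [← h1]
    rfl
  have hd : DifferentiableAt ℝ (fderiv ℝ fun y => L (fibreIncl F E e.1 y))
      (fibreCoord F E e.1 e.2) :=
    ((contDiff_comp_fibreIncl hL e.1).fderiv_right (m := ∞) (by simp)).differentiable
      (by simp) |>.differentiableAt
  have hd' : DifferentiableAt ℝ (fun y => L (fibreIncl F E e.1 y)) (fibreCoord F E e.1 e.2) :=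
    (contDiff_comp_fibreIncl hL e.1).differentiable (by simp) |>.differentiableAt
  rw [h, fderiv_fun_sub (hd.clm_apply differentiableAt_fun_id) hd',
    fderiv_clm_apply hd differentiableAt_fun_id]
  simp

theorem mfderiv_leg_vertLift_eq_zero [FiniteDimensional ℝ B] [FiniteDimensional ℝ F] [T2Space Q]
    (hL : ContMDiff (IE B F) 𝓘(ℝ, ℝ) ∞ L) (e : TotalSpace F E) (c : E e.1)
    (h : fderiv ℝ (fderiv ℝ fun y => L (fibreIncl F E e.1 y)) (fibreCoord F E e.1 e.2)
        (fibreCoord F E e.1 c) = 0) :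
    mfderiv (IE B F) (IEd B F) (leg B L) e (vertLift B e c) = 0 := by
  refine (mfderiv_vertLift c ((contMDiff_leg hL).mdifferentiableAt (by simp))).trans ?_
  have hd : DifferentiableAt ℝ (fderiv ℝ fun y => L (fibreIncl F E e.1 y))
      (fibreCoord F E e.1 e.2) :=
    ((contDiff_comp_fibreIncl hL e.1).fderiv_right (m := ∞) (by simp)).differentiable
      (by simp) |>.differentiableAt
  have h1 : (fun y => leg B L (fibreIncl F E e.1 y)) = fun y =>
      fibreIncl (F →L[ℝ] ℝ) (Dual E) e.1 (fderiv ℝ (fun y => L (fibreIncl F E e.1 y)) y) :=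
    funext fun y => leg_fibreIncl hL e.1 y
  have h2 := mfderiv_comp (I := 𝓘(ℝ, F)) (I' := 𝓘(ℝ, F →L[ℝ] ℝ)) (I'' := IEd B F)
    (fibreCoord F E e.1 e.2)
    ((contMDiff_fibreIncl (F := F →L[ℝ] ℝ) (E := Dual E) (B := B) e.1).mdifferentiableAt (by simp))
    hd.mdifferentiableAt
  rw [h1]
  refine (DFunLike.congr_fun (F := F →L[ℝ] B × (F →L[ℝ] ℝ)) h2 _).trans ?_
  rw [mfderiv_eq_fderiv]
  refine (congrArg _ h).trans ?_
  exact map_zero (mfderiv 𝓘(ℝ, F →L[ℝ] ℝ) (IEd B F) (fibreIncl (F →L[ℝ] ℝ) (Dual E) e.1)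
    (fderiv ℝ (fun y => L (fibreIncl F E e.1 y)) (fibreCoord F E e.1 e.2)))

end Legendre

/-! ### Fibres of the Legendre transformation: descent, saturation, the nearest-point argument. -/

section LegendreFibres
variable {B F Q : Type*} [NormedAddCommGroup B] [NormedSpace ℝ B]
  [NormedAddCommGroup F] [NormedSpace ℝ F]
  [TopologicalSpace Q] [ChartedSpace B Q] [IsManifold 𝓘(ℝ, B) ∞ Q]
  {E : Q → Type*} [∀ x, AddCommGroup (E x)] [∀ x, Module ℝ (E x)] [∀ x, TopologicalSpace (E x)]
  [TopologicalSpace (TotalSpace F E)] [FiberBundle F E] [VectorBundle ℝ F E]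
  [ContMDiffVectorBundle ∞ F E 𝓘(ℝ, B)]

/-- Transports derivatives between base points that are only provably equal, by viewing tangent
vectors in the model space. -/
theorem mfderiv_eq_of_eq {V H N : Type*} [NormedAddCommGroup V] [NormedSpace ℝ V]
    [TopologicalSpace H] [TopologicalSpace N] [ChartedSpace H N] {J : ModelWithCorners ℝ V H}
    {V' H' N' : Type*} [NormedAddCommGroup V'] [NormedSpace ℝ V'] [TopologicalSpace H']
    [TopologicalSpace N'] [ChartedSpace H' N'] {J' : ModelWithCorners ℝ V' H'} (f : N → N')
    {p q : N} (h : p = q) {v w : V} (hvw : v = w) :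
    ((mfderiv J J' f p : V →L[ℝ] V') v : V') = (mfderiv J J' f q : V →L[ℝ] V') w := by
  subst h hvw
  rfl

variable [FiniteDimensional ℝ B] [FiniteDimensional ℝ F] [T2Space Q] {L : TotalSpace F E → ℝ}
  (hL : ContMDiff (IE B F) 𝓘(ℝ, ℝ) ∞ L) (hreg : IsAlmostRegular B L)
include hL

theorem mdifferentiableAt_leg (e : TotalSpace F E) :
    MDifferentiableAt (IE B F) (IEd B F) (leg B L) e :=
  (contMDiff_leg hL).mdifferentiableAt (by simp)

/-- Because `leg` covers the identity of `Q`, membership in a prolongation can be tested after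
applying `𝒯leg`. -/
theorem mfderiv_proj_leg (e : TotalSpace F E) (v : TangentSpace (IE B F) e) :
    mfderiv (IEd B F) 𝓘(ℝ, B) (TotalSpace.proj : TotalSpace (F →L[ℝ] ℝ) (Dual E) → Q) (leg B L e)
      (mfderiv (IE B F) (IEd B F) (leg B L) e v) =
    mfderiv (IE B F) 𝓘(ℝ, B) TotalSpace.proj e v := by
  have h := mfderiv_comp e (g := (TotalSpace.proj : TotalSpace (F →L[ℝ] ℝ) (Dual E) → Q))
    (I'' := 𝓘(ℝ, B)) ((contMDiff_proj (Dual E) (n := ∞)).mdifferentiableAt (by simp))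
    (mdifferentiableAt_leg hL e)
  exact (DFunLike.congr_fun (F := B × F →L[ℝ] B) h v).symm

theorem prolongedLeg_mem (A : LieAlgebroid B F E) {e : TotalSpace F E}
    {z : E e.1 × TangentSpace (IE B F) e} :
    prolongedLeg B L e z ∈ prolongation (IEd B F) A TotalSpace.proj (leg B L e) ↔
      z ∈ prolongation (IE B F) A TotalSpace.proj e := by
  change A.anchor e.1 z.1 = _ ↔ A.anchor e.1 z.1 = _
  rw [← mfderiv_proj_leg hL e z.2]
  rfl

theorem mem_prolongation_iff_of_leg_eq (A : LieAlgebroid B F E) {x : Q} {a a' : E x}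
    (h : leg B L ⟨x, a⟩ = leg B L ⟨x, a'⟩) {v : TangentSpace (IE B F) (⟨x, a⟩ : TotalSpace F E)}
    {v' : TangentSpace (IE B F) (⟨x, a'⟩ : TotalSpace F E)}
    (hv : (mfderiv (IE B F) (IEd B F) (leg B L) ⟨x, a⟩ v : B × (F →L[ℝ] ℝ)) =
      mfderiv (IE B F) (IEd B F) (leg B L) ⟨x, a'⟩ v') (b : E x) :
    ((b, v) : E x × TangentSpace (IE B F) (⟨x, a⟩ : TotalSpace F E)) ∈
      prolongation (IE B F) A TotalSpace.proj ⟨x, a⟩ ↔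
    ((b, v') : E x × TangentSpace (IE B F) (⟨x, a'⟩ : TotalSpace F E)) ∈
      prolongation (IE B F) A TotalSpace.proj ⟨x, a'⟩ := by
  change A.anchor x b = _ ↔ A.anchor x b = _
  have h1 : (mfderiv (IE B F) 𝓘(ℝ, B) TotalSpace.proj ⟨x, a⟩ v : B) =
      mfderiv (IE B F) 𝓘(ℝ, B) TotalSpace.proj ⟨x, a'⟩ v' :=
    (mfderiv_proj_leg hL ⟨x, a⟩ v).symm.trans
      ((mfderiv_eq_of_eq (V := B × (F →L[ℝ] ℝ)) (V' := B) _ h hv).trans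
      (mfderiv_proj_leg hL ⟨x, a'⟩ v'))
  exact ⟨fun h2 => h2.trans h1, fun h2 => h2.trans h1.symm⟩

include hreg

theorem exists_leg_section (e : TotalSpace F E) :
    ∃ (O : Set (TotalSpace (F →L[ℝ] ℝ) (Dual E)))
      (σ : TotalSpace (F →L[ℝ] ℝ) (Dual E) → TotalSpace F E),
      IsOpen O ∧ leg B L e ∈ O ∧ ContMDiffOn (IEd B F) (IE B F) ∞ σ O ∧ σ (leg B L e) = e ∧
      ∀ q, leg B L q ∈ O → leg B L (σ (leg B L q)) = leg B L q := by
  obtain ⟨O, σ, hO, he, hσ, hσe, h⟩ := exists_local_section (contMDiff_leg hL) hreg.submanifold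
    (fun q => mem_range_self q) (hreg.submersion e)
  exact ⟨O, σ, hO, he, hσ, hσe, fun q hq => h _ (mem_range_self q) hq⟩

/-- The derivative of a function which is constant on the fibres of the Legendre transformation
factors through the derivative of the Legendre transformation. -/
theorem dirDeriv_eq_of_leg {g : TotalSpace F E → ℝ} (hg : ContMDiff (IE B F) 𝓘(ℝ, ℝ) ∞ g)
    (hgc : ∀ q q', leg B L q = leg B L q' → g q = g q') {e e' : TotalSpace F E}
    (h : leg B L e = leg B L e') {v : TangentSpace (IE B F) e} {v' : TangentSpace (IE B F) e'}
    (hv : (mfderiv (IE B F) (IEd B F) (leg B L) e v : B × (F →L[ℝ] ℝ)) =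
      mfderiv (IE B F) (IEd B F) (leg B L) e' v') :
    dirDeriv (IE B F) v g = dirDeriv (IE B F) v' g := by
  obtain ⟨O, σ, hO, he, hσ, hσe, hs⟩ := exists_leg_section hL hreg e
  have key : ∀ (q : TotalSpace F E) (w : TangentSpace (IE B F) q), leg B L q = leg B L e →
      dirDeriv (IE B F) w g = (mfderiv (IEd B F) 𝓘(ℝ, ℝ) (fun m => g (σ m)) (leg B L q) :
        B × (F →L[ℝ] ℝ) →L[ℝ] ℝ) (mfderiv (IE B F) (IEd B F) (leg B L) q w) := by
    intro q w hq
    have hqO : leg B L q ∈ O := hq ▸ he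
    -- A function constant on the fibres factors locally as `(g ∘ σ) ∘ leg`, with one and the same
    -- `σ` at all points of the fibre.
    have h1 : g =ᶠ[𝓝 q] fun q => g (σ (leg B L q)) := by
      filter_upwards [(contMDiff_leg hL).continuous.continuousAt.eventually (hO.mem_nhds hqO)]
        with q' hq' using hgc _ _ (hs q' hq').symm
    rw [dirDeriv_congr w h1]
    exact (dirDeriv_mfderiv w (mdifferentiableAt_leg hL q)
      (((hg.comp_contMDiffOn hσ).contMDiffAt (hO.mem_nhds hqO)).mdifferentiableAt (by simp))).symm
  rw [key e v rfl, key e' v' h.symm]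
  exact mfderiv_eq_of_eq _ h hv

-- A fibre of `leg` lies in a single fibre of `E`, so its tangent vectors are vertical. Momenta are
-- constant on it, which puts these vectors in the kernel of the Hessian.
omit hreg in
theorem exists_vertLift_of_mem_tangentTo {e : TotalSpace F E} {v : TangentSpace (IE B F) e}
    (hv : v ∈ tangentTo (IE B F) (leg B L ⁻¹' {leg B L e}) e) :
    ∃ c, v = vertLift B e c ∧ fderiv ℝ (fderiv ℝ fun y => L (fibreIncl F E e.1 y))
      (fibreCoord F E e.1 e.2) (fibreCoord F E e.1 c) = 0 := by
  have h0 : ∃ c, v = vertLift B e c := by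
    obtain ⟨γ, h0, hγ, hS, rfl⟩ := hv
    let y : ℝ → F := fun t => (trivializationAt F E e.1 (γ t)).2
    have hy : ContMDiffAt 𝓘(ℝ, ℝ) 𝓘(ℝ, F) ∞ y 0 :=
      ContMDiffAt.comp_of_eq (g := fun q => (trivializationAt F E e.1 q).2)
        (contMDiffAt_trivializationAt_snd e) hγ h0
    have hγy : γ =ᶠ[𝓝 0] fun t => fibreIncl F E e.1 (y t) := by
      filter_upwards [hS] with t ht
      have h1 : leg B L (γ t) = leg B L e := ht
      have h2 : (γ t).1 = e.1 :=
        congrArg (fun m : TotalSpace (F →L[ℝ] ℝ) (Dual E) => m.1) h1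
      exact (fibreIncl_trivializationAt h2).symm
    have h3 := hγy.mfderiv_eq (I := 𝓘(ℝ, ℝ)) (I' := IE B F)
    have h4 := mfderiv_comp (0 : ℝ) ((contMDiff_fibreIncl (B := B) (F := F) (E := E)
      e.1).mdifferentiableAt (by simp)) (hy.mdifferentiableAt (by simp))
    have hy0 : y 0 = fibreCoord F E e.1 e.2 := by
      change (trivializationAt F E e.1 (γ 0)).2 = _
      rw [h0, trivializationAt_snd _ (FiberBundle.mem_baseSet_trivializationAt' e.1)]
      rfl
    let c := (fibreIncl F E e.1 (mfderiv 𝓘(ℝ, ℝ) 𝓘(ℝ, F) y 0 (1 : ℝ) : F)).2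
    refine ⟨c, ?_⟩
    have hc : fibreCoord F E e.1 c = (mfderiv 𝓘(ℝ, ℝ) 𝓘(ℝ, F) y 0 (1 : ℝ) : F) :=
      fibreCoord_fibreIncl _ _
    refine (DFunLike.congr_fun (F := ℝ →L[ℝ] B × F) (h3.trans h4) (1 : ℝ)).trans ?_
    exact mfderiv_eq_of_eq (V := F) (V' := B × F) _ hy0 hc.symm
  obtain ⟨c, rfl⟩ := h0
  refine ⟨c, rfl, ContinuousLinearMap.ext fun w => ?_⟩
  obtain ⟨s, hs⟩ := exists_section_eq (B := B) (F := F) (fibreIncl F E e.1 w).2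
  have h1 := dirDeriv_vertLift_momentum hL s e c
  have h2 : fibreCoord F E e.1 (s e.1) = w := by
    rw [show s e.1 = (fibreIncl F E e.1 w).2 from hs]
    exact fibreCoord_fibreIncl _ _
  rw [h2] at h1
  rw [← h1, dirDeriv_congr_of_mem_tangentTo hv (h := fun _ => momentum L s e)
    ((contMDiff_momentum hL s).mdifferentiableAt (by simp)) mdifferentiableAt_const]
  · rw [dirDeriv_const]
    rfl
  · filter_upwards [self_mem_nhdsWithin] with q hq using momentum_congr s hq

/-- The energy is constant on the fibres of the Legendre transformation. -/
theorem energy_congr {e e' : TotalSpace F E} (h : leg B L e = leg B L e') :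
    energy B L e = energy B L e' := by
  have hfib := isEmbeddedSubmanifold_fibre (contMDiff_leg hL) hreg.submanifold
    (fun q => mem_range_self q) hreg.submersion (leg B L e)
  refine eqOn_of_dirDeriv_eq_zero hfib
    (hreg.connected _ (mem_range_self e)).isPreconnected (contMDiff_energy hL) ?_ rfl h.symm
  intro q hq v hv
  rw [← show leg B L q = leg B L e from hq] at hv
  obtain ⟨c, rfl, hc⟩ := exists_vertLift_of_mem_tangentTo hL hv
  rw [dirDeriv_vertLift_energy hL, hc]
  rfl

/-- The presymplectic equation depends only on the images under the prolonged Legendre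
transformation. -/
theorem cartanTwo_eq_of_leg (A : LieAlgebroid B F E) {x : Q} {a a' : E x}
    (h : leg B L ⟨x, a⟩ = leg B L ⟨x, a'⟩) {b₁ b₂ : E x}
    {v₁ v₂ : TangentSpace (IE B F) (⟨x, a⟩ : TotalSpace F E)}
    {v₁' v₂' : TangentSpace (IE B F) (⟨x, a'⟩ : TotalSpace F E)}
    (h₁ : (mfderiv (IE B F) (IEd B F) (leg B L) ⟨x, a⟩ v₁ : B × (F →L[ℝ] ℝ)) =
      mfderiv (IE B F) (IEd B F) (leg B L) ⟨x, a'⟩ v₁')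
    (h₂ : (mfderiv (IE B F) (IEd B F) (leg B L) ⟨x, a⟩ v₂ : B × (F →L[ℝ] ℝ)) =
      mfderiv (IE B F) (IEd B F) (leg B L) ⟨x, a'⟩ v₂')
    (hz₁ : ((b₁, v₁) : E x × TangentSpace (IE B F) (⟨x, a⟩ : TotalSpace F E)) ∈
      prolongation (IE B F) A TotalSpace.proj ⟨x, a⟩)
    (hz₂ : ((b₂, v₂) : E x × TangentSpace (IE B F) (⟨x, a⟩ : TotalSpace F E)) ∈
      prolongation (IE B F) A TotalSpace.proj ⟨x, a⟩) :
    cartanTwo A L ⟨x, a⟩ (b₁, v₁) (b₂, v₂) = cartanTwo A L ⟨x, a'⟩ (b₁, v₁') (b₂, v₂') := by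
  obtain ⟨fr⟩ := exists_localFrame (B := B) (F := F) (E := E) x
  rw [cartanTwo_eq A hL fr (e := ⟨x, a⟩) fr.mem_dom hz₁ hz₂,
    cartanTwo_eq A hL fr (e := ⟨x, a'⟩) fr.mem_dom
      ((mem_prolongation_iff_of_leg_eq hL A h h₁ b₁).1 hz₁)
      ((mem_prolongation_iff_of_leg_eq hL A h h₂ b₂).1 hz₂)]
  have e1 : ∀ c, dirDeriv (IE B F) v₁ (momentum L (fr.sec c)) =
      dirDeriv (IE B F) v₁' (momentum L (fr.sec c)) := fun c =>
    dirDeriv_eq_of_leg hL hreg (contMDiff_momentum hL _) (fun _ _ => momentum_congr _) h h₁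
  have e2 : ∀ c, dirDeriv (IE B F) v₂ (momentum L (fr.sec c)) =
      dirDeriv (IE B F) v₂' (momentum L (fr.sec c)) := fun c =>
    dirDeriv_eq_of_leg hL hreg (contMDiff_momentum hL _) (fun _ _ => momentum_congr _) h h₂
  simp only [e1, e2, fun s => momentum_congr s h]

omit hreg in
theorem mfderiv_leg_mem {S : Set (TotalSpace F E)} {e : TotalSpace F E}
    {v : TangentSpace (IE B F) e} (hv : v ∈ tangentTo (IE B F) S e) :
    mfderiv (IE B F) (IEd B F) (leg B L) e v ∈ tangentTo (IEd B F) (leg B L '' S) (leg B L e) :=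
  mfderiv_mem_tangentTo (contMDiff_leg hL).contMDiffAt
    (eventually_mem_nhdsWithin.mono fun _ => mem_image_of_mem _) hv

/-- Tangent vectors of the image of a saturated set lift. -/
theorem exists_lift_tangentTo {S : Set (TotalSpace F E)}
    (hS : ∀ q q', leg B L q = leg B L q' → q ∈ S → q' ∈ S) {e : TotalSpace F E}
    {m : TotalSpace (F →L[ℝ] ℝ) (Dual E)} (hm : leg B L e = m) {w : TangentSpace (IEd B F) m}
    (hw : w ∈ tangentTo (IEd B F) (leg B L '' S) m) :
    ∃ v ∈ tangentTo (IE B F) S e,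
      (mfderiv (IE B F) (IEd B F) (leg B L) e v : B × (F →L[ℝ] ℝ)) = w := by
  subst hm
  obtain ⟨O, σ, hO, he, hσ, hσe, hs⟩ := exists_leg_section hL hreg e
  obtain ⟨γ, h0, hγ, hγS, rfl⟩ := hw
  have hσγ : ContMDiffAt 𝓘(ℝ, ℝ) (IE B F) ∞ (fun t => σ (γ t)) 0 :=
    ContMDiffAt.comp_of_eq (hσ.contMDiffAt (hO.mem_nhds he)) hγ h0
  have hγO : ∀ᶠ t in 𝓝 (0 : ℝ), γ t ∈ O :=
    hγ.continuousAt.eventually (h0.symm ▸ hO.mem_nhds he)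
  have hσ0 : σ (γ 0) = e := by rw [h0, hσe]
  -- The lift of `w` is the velocity of `σ ∘ γ`; as this curve covers `γ` and `S` is saturated, it
  -- stays in `S`.
  have hleg : (fun t => leg B L (σ (γ t))) =ᶠ[𝓝 0] γ := by
    filter_upwards [hγS, hγO] with t ⟨q, _, hqt⟩ htO
    simp only [← hqt]
    exact hs q (hqt ▸ htO)
  refine ⟨(mfderiv 𝓘(ℝ, ℝ) (IE B F) (fun t => σ (γ t)) 0 (1 : ℝ) : B × F),
    ⟨_, hσ0, hσγ, ?_, rfl⟩, ?_⟩
  · filter_upwards [hγS, hleg] with t ⟨q, hq, hqt⟩ ht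
    exact hS q _ (hqt.trans ht.symm) hq
  · have h1 := hleg.mfderiv_eq (I := 𝓘(ℝ, ℝ)) (I' := IEd B F)
    have h2 := mfderiv_comp (0 : ℝ) (mdifferentiableAt_leg hL (σ (γ 0)))
      (hσγ.mdifferentiableAt (by simp))
    refine Eq.trans ?_ (DFunLike.congr_fun (F := ℝ →L[ℝ] B × (F →L[ℝ] ℝ)) (h2.symm.trans h1) (1 : ℝ))
    exact mfderiv_eq_of_eq _ hσ0.symm rfl

/-- The constraint sets are saturated for the Legendre transformation. -/
theorem constraintSet_saturated (A : LieAlgebroid B F E) (j : ℕ) :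
    ∀ q q', leg B L q = leg B L q' → q ∈ constraintSet A L j → q' ∈ constraintSet A L j := by
  induction j with
  | zero => exact fun _ _ _ _ => mem_univ _
  | succ j ih =>
    rintro ⟨x, a⟩ ⟨x', a'⟩ h ⟨hq, ⟨b, v⟩, ⟨hz, hv⟩, hsol⟩
    obtain rfl : x = x' := congrArg TotalSpace.proj h
    refine ⟨ih _ _ h hq, ?_⟩
    -- The solution is pushed down by `T leg` and lifted at the other point, tangent to `E_j` by the
    -- induction hypothesis. Test vectors make the opposite journey, with no tangency condition.
    obtain ⟨v', hv', hvv'⟩ := exists_lift_tangentTo hL hreg ih h.symm (mfderiv_leg_mem hL hv)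
    refine ⟨(b, v'), ⟨(mem_prolongation_iff_of_leg_eq hL A h hvv'.symm b).1 hz, hv'⟩, ?_⟩
    rintro ⟨c, w'⟩ hw'
    obtain ⟨w, -, hww'⟩ := exists_lift_tangentTo hL hreg (S := univ) (fun _ _ _ _ => mem_univ _) h
      (mfderiv_leg_mem hL (mem_tangentTo_univ w'))
    have hw := (mem_prolongation_iff_of_leg_eq hL A h hww' c).2 hw'
    rw [← cartanTwo_eq_of_leg hL hreg A h hvv'.symm hww' hz hw, hsol _ hw]
    exact dirDeriv_eq_of_leg hL hreg (contMDiff_energy hL) (fun _ _ => energy_congr hL hreg) h hww'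

omit hreg in
/-- The vertical part of the presymplectic equation. -/
theorem mfderiv_leg_vertLift_of_solution (A : LieAlgebroid B F E) {e : TotalSpace F E}
    {z : E e.1 × TangentSpace (IE B F) e}
    (hz : z ∈ prolongation (IE B F) A TotalSpace.proj e)
    (hsol : ∀ z' ∈ prolongation (IE B F) A TotalSpace.proj e,
      cartanTwo A L e z z' = dFun B (energy B L) e z') :
    mfderiv (IE B F) (IEd B F) (leg B L) e (vertLift B e (z.1 - e.2)) = 0 := by
  refine mfderiv_leg_vertLift_eq_zero hL e _ (ContinuousLinearMap.ext fun w => ?_)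
  obtain ⟨fr⟩ := exists_localFrame (B := B) (F := F) (E := E) e.1
  set c : E e.1 := (fibreIncl F E e.1 w).2 with hc
  have hcw : fibreCoord F E e.1 c = w := fibreCoord_fibreIncl _ _
  -- On the vertical test element `(0, c^V)` the equation reads `D²L(c, z.1) = D²L(c, e)`; symmetry
  -- of the Hessian then gives `D²L(z.1 - e, ·) = 0`.
  have hz' : ((0, vertLift B e c) : E e.1 × TangentSpace (IE B F) e) ∈
      prolongation (IE B F) A TotalSpace.proj e := by
    change A.anchor e.1 0 = mfderiv (IE B F) 𝓘(ℝ, B) TotalSpace.proj e (vertLift B e c)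
    rw [mfderiv_proj_vertLift, map_zero]
  have h1 := hsol _ hz'
  rw [cartanTwo_eq A hL fr fr.mem_dom hz hz'] at h1
  change _ = dirDeriv (IE B F) (vertLift B e c) (energy B L) at h1
  simp only [map_zero, zero_mul, mul_zero, Finset.sum_const_zero, sub_zero, add_zero,
    dirDeriv_vertLift_momentum hL, dirDeriv_vertLift_energy hL, hcw] at h1
  set D := fderiv ℝ (fderiv ℝ fun y => L (fibreIncl F E e.1 y)) (fibreCoord F E e.1 e.2) with hD
  have h2 : D w (fibreCoord F E e.1 z.1) = D w (fibreCoord F E e.1 e.2) := by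
    rw [← h1]
    conv_lhs => rw [← fr.sum_coord e.1 fr.mem_dom z.1]
    simp
  have hsymm : IsSymmSndFDerivAt ℝ (fun y => L (fibreIncl F E e.1 y))
      (fibreCoord F E e.1 e.2) :=
    (contDiff_comp_fibreIncl hL e.1).contDiffAt.isSymmSndFDerivAt (by
      simpa using ENat.LEInfty.out)
  have h3 := hsymm.eq (fibreCoord F E e.1 (z.1 - e.2)) w
  rw [← hD] at h3
  rw [h3, map_sub, map_sub, h2, sub_self]
  rfl

/-- If the vertical vectors pointing from the points of a fibre of the Legendre transformation to
`b` are tangent to that fibre, then `b` lies on it. -/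
theorem leg_eq_of_forall_vertLift {x : Q} {a₀ b : E x}
    (h : ∀ a : E x, leg B L ⟨x, a⟩ = leg B L ⟨x, a₀⟩ →
      mfderiv (IE B F) (IEd B F) (leg B L) ⟨x, a⟩ (vertLift B ⟨x, a⟩ (b - a)) = 0) :
    leg B L ⟨x, b⟩ = leg B L ⟨x, a₀⟩ := by
  have : T2Space (TotalSpace (F →L[ℝ] ℝ) (Dual E)) := t2Space_totalSpace _
  have : ProperSpace F := FiniteDimensional.proper ℝ F
  set K : Set F := {y | leg B L (fibreIncl F E x y) = leg B L ⟨x, a₀⟩} with hK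
  have hKc : IsClosed K := isClosed_eq
    ((contMDiff_leg hL).continuous.comp (contMDiff_fibreIncl (B := B) x).continuous)
    continuous_const
  have hKn : K.Nonempty := ⟨fibreCoord F E x a₀, by
    rw [hK, mem_ofPred_eq, fibreIncl_fibreCoord]⟩
  -- A nearest point exists because `K` is closed in a finite-dimensional space. Any norm will do,
  -- since only the triangle inequality is used below.
  obtain ⟨y, hyK, hy⟩ := hKc.exists_infDist_eq_dist hKn (fibreCoord F E x b)
  set a : E x := (fibreIncl F E x y).2 with ha
  have hay : fibreCoord F E x a = y := fibreCoord_fibreIncl x y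
  have hla : leg B L ⟨x, a⟩ = leg B L ⟨x, a₀⟩ := hyK
  suffices hb : b = a by rw [hb, hla]
  by_contra hne
  set d := fibreCoord F E x b - y with hd
  have hd0 : 0 < ‖d‖ := norm_pos_iff.2 fun h0 => hne (fibreCoord_injective (F := F) x
    (by rw [hay]; exact sub_eq_zero.1 h0))
  obtain ⟨γ, h0, hγ, hγS, hγv⟩ := mem_tangentTo_fibre (contMDiff_leg hL) hreg.submanifold
    (fun q => mem_range_self q) (hreg.submersion _) (h a hla)
  let u : ℝ → F := fun t => (trivializationAt F E x (γ t)).2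
  have hu : ContMDiffAt 𝓘(ℝ, ℝ) 𝓘(ℝ, F) ∞ u 0 :=
    ContMDiffAt.comp_of_eq (g := fun q => (trivializationAt F E x q).2)
      (contMDiffAt_trivializationAt_snd (⟨x, a⟩ : TotalSpace F E)) hγ h0
  have hu0 : u 0 = y := by
    change (trivializationAt F E x (γ 0)).2 = y
    rw [h0, trivializationAt_snd _ (FiberBundle.mem_baseSet_trivializationAt' x)]
    exact hay
  have hud : HasDerivAt u d 0 := by
    have h1 := (hu.mdifferentiableAt (by simp)).differentiableAt.hasDerivAt
    have h2 := mfderiv_comp_of_eq (I := 𝓘(ℝ, ℝ)) (I' := IE B F) (I'' := 𝓘(ℝ, F)) (x := (0 : ℝ))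
      (g := fun q : TotalSpace F E => (trivializationAt F E x q).2) (f := γ) (y := ⟨x, a⟩)
      ((contMDiffAt_trivializationAt_snd (⟨x, a⟩ : TotalSpace F E)).mdifferentiableAt (by simp))
      (hγ.mdifferentiableAt (by simp)) h0
    have h3 : deriv u 0 = d := by
      have h4 : (mfderiv 𝓘(ℝ, ℝ) 𝓘(ℝ, F) u 0 (1 : ℝ) : F) = d := by
        refine (DFunLike.congr_fun (F := ℝ →L[ℝ] F) h2 (1 : ℝ)).trans ?_
        refine (mfderiv_eq_of_eq (V := B × F) (V' := F) _ h0 hγv).trans ?_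
        refine (mfderiv_trivializationAt_snd_vertLift (⟨x, a⟩ : TotalSpace F E) (b - a)).trans ?_
        rw [map_sub]
        exact congrArg (fun w => fibreCoord F E x b - w) hay
      rw [mfderiv_eq_fderiv] at h4
      exact h4
    rwa [h3] at h1
  -- The curve `u` stays in `K` and has velocity `d = b - y`. With error constant `‖d‖ / 2`, small
  -- `t > 0` gives `‖b - u t‖ ≤ (1 - t)‖d‖ + t‖d‖ / 2 < ‖d‖`, against the choice of `y`.
  have h5 := (hasDerivAt_iff_isLittleO.1 hud).def (half_pos hd0)
  have h6 : ∀ᶠ t in 𝓝 (0 : ℝ), u t ∈ K := by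
    filter_upwards [hγS] with t ht
    have h7 : leg B L (γ t) = leg B L ⟨x, a⟩ := ht
    have h8 : (γ t).1 = x := congrArg TotalSpace.proj h7
    change leg B L (fibreIncl F E x (u t)) = _
    rw [fibreIncl_trivializationAt h8, h7, hla]
  obtain ⟨t, ⟨h7, h8, h9⟩, h10⟩ := (((h5.and (h6.and (eventually_lt_nhds one_pos))).filter_mono
    nhdsWithin_le_nhds).and (self_mem_nhdsWithin (s := Ioi (0 : ℝ)))).exists
  have h10 : 0 < t := h10
  have h11 : ‖d‖ ≤ ‖fibreCoord F E x b - u t‖ := by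
    rw [hd, ← dist_eq_norm, ← hy, ← dist_eq_norm]
    exact Metric.infDist_le_dist_of_mem h8
  have h12 : fibreCoord F E x b - u t = (1 - t) • d - (u t - u 0 - (t - 0) • d) := by
    rw [hu0, hd]
    module
  have h13 : ‖(1 - t) • d‖ = (1 - t) * ‖d‖ := by
    rw [norm_smul, Real.norm_of_nonneg (by linarith)]
  have h14 := norm_sub_le ((1 - t) • d) (u t - u 0 - (t - 0) • d)
  rw [← h12, h13] at h14
  have h15 : ‖t - 0‖ = t := by rw [sub_zero, Real.norm_of_nonneg h10.le]
  rw [h15] at h7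
  nlinarith [mul_pos h10 hd0]

end LegendreFibres

/-! ### Dimension counts and frames. -/

section LinearAlgebra

theorem finrank_map_add_finrank_inf_ker {M M' : Type*} [AddCommGroup M] [Module ℝ M]
    [AddCommGroup M'] [Module ℝ M'] (f : M →ₗ[ℝ] M') (W : Submodule ℝ M) [FiniteDimensional ℝ W] :
    Module.finrank ℝ (W.map f) + Module.finrank ℝ (W ⊓ LinearMap.ker f : Submodule ℝ M) =
      Module.finrank ℝ W := by
  rw [← LinearMap.finrank_range_add_finrank_ker (f.domRestrict W), LinearMap.range_domRestrict]
  congr 1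
  rw [LinearMap.ker_domRestrict]
  rw [← Submodule.map_comap_subtype]
  exact (Submodule.equivMapOfInjective _ W.injective_subtype _).finrank_eq.symm

theorem finrank_comap_of_injective {M : Type*} [AddCommGroup M] [Module ℝ M]
    [FiniteDimensional ℝ M] (f : M →ₗ[ℝ] M) (hf : Function.Injective f) (W : Submodule ℝ M) :
    Module.finrank ℝ (W.comap f) = Module.finrank ℝ W := by
  have h : (W.comap f).map f = W :=
    Submodule.map_comap_eq_of_surjective (LinearMap.injective_iff_surjective.1 hf) W
  conv_rhs => rw [← h]
  exact ((Submodule.equivMapOfInjective f hf (W.comap f)).finrank_eq)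

end LinearAlgebra

section Frames
variable {B F Q : Type*} [NormedAddCommGroup B] [NormedSpace ℝ B]
  [NormedAddCommGroup F] [NormedSpace ℝ F]
  [TopologicalSpace Q] [ChartedSpace B Q] [IsManifold 𝓘(ℝ, B) ∞ Q]
  {E : Q → Type*} [∀ x, AddCommGroup (E x)] [∀ x, Module ℝ (E x)] [∀ x, TopologicalSpace (E x)]
  [TopologicalSpace (TotalSpace F E)] [FiberBundle F E] [VectorBundle ℝ F E]
  [ContMDiffVectorBundle ∞ F E 𝓘(ℝ, B)]
  {V H N : Type*} [NormedAddCommGroup V] [NormedSpace ℝ V] [TopologicalSpace H]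
  [TopologicalSpace N] [ChartedSpace H N] {J : ModelWithCorners ℝ V H} [IsManifold J ∞ N]
  {pr : N → Q}

theorem SmoothAlong.mono {S S' : Set N} {Z : ∀ p : N, E (pr p) × TangentSpace J p}
    (h : SmoothAlong B F J pr S Z) (hS : S' ⊆ S) : SmoothAlong B F J pr S' Z :=
  ⟨h.1.mono hS, h.2.mono hS⟩

/-- Linear independence of sections is an open condition. -/
theorem SmoothAlong.eventually_linearIndependent [FiniteDimensional ℝ F] [FiniteDimensional ℝ V]
    {ι : Type*} [Finite ι]
    {S : Set N} {p : N} (hp : p ∈ S) {s : ι → ∀ q : N, E (pr q) × TangentSpace J q}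
    (hs : ∀ i, SmoothAlong B F J pr S (s i)) (hli : LinearIndependent ℝ fun i => s i p) :
    ∀ᶠ q in 𝓝[S] p, LinearIndependent ℝ fun i => s i q := by
  by_cases hι : Nonempty ι
  swap
  · have : IsEmpty ι := not_nonempty_iff.1 hι
    exact Eventually.of_forall fun q => linearIndependent_empty_type
  have : IsManifold J 1 N := IsManifold.of_le (n := ∞) (by simp)
  let T := trivializationAt F E (pr p)
  let T' := trivializationAt V (TangentSpace J : N → Type _) p
  have hpT : pr p ∈ T.baseSet := FiberBundle.mem_baseSet_trivializationAt' _
  have hpT' : p ∈ T'.baseSet := FiberBundle.mem_baseSet_trivializationAt' p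
  -- Trivializations bring all the fibres into one vector space, where linear independence is an
  -- open condition.
  let Θ : ∀ q : N, E (pr q) × TangentSpace J q →ₗ[ℝ] F × V := fun q =>
    LinearMap.prodMap (T.linearMapAt ℝ (pr q)) (T'.linearMapAt ℝ q)
  have h1 : ∀ i, ContMDiffWithinAt J (𝓘(ℝ, B).prod 𝓘(ℝ, F)) ∞
    (fun q => (⟨pr q, (s i q).1⟩ : TotalSpace F E)) S p := fun i => (hs i).1 p hp
  have h2 : ∀ i, ContMDiffWithinAt J J.tangent ∞
    (fun q => (⟨q, (s i q).2⟩ : TangentBundle J N)) S p := fun i => (hs i).2 p hp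
  have hprc : ContinuousWithinAt pr S p :=
    (contMDiffWithinAt_totalSpace.1 (h1 hι.some)).1.continuousWithinAt
  have hbase : ∀ᶠ q in 𝓝[S] p, pr q ∈ T.baseSet ∧ q ∈ T'.baseSet :=
    (hprc.eventually (T.open_baseSet.mem_nhds hpT)).and
      (mem_nhdsWithin_of_mem_nhds (T'.open_baseSet.mem_nhds hpT'))
  have hc : ContinuousWithinAt (fun q => fun i => Θ q (s i q)) S p := by
    refine continuousWithinAt_pi.2 fun i => ?_
    have h3 := (contMDiffWithinAt_totalSpace.1 (h1 i)).2.continuousWithinAt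
    have h4 := (contMDiffWithinAt_totalSpace.1 (h2 i)).2.continuousWithinAt
    refine (h3.prodMk h4).congr_of_eventuallyEq_of_mem ?_ hp
    filter_upwards [hbase] with q hq
    refine Prod.ext ?_ ?_
    · exact (congrFun (T.coe_linearMapAt_of_mem (R := ℝ) hq.1) _)
    · exact (congrFun (T'.coe_linearMapAt_of_mem (R := ℝ) hq.2) _)
  have hΘ : Function.Injective (Θ p) := by
    exact Function.Injective.prodMap
      (Function.LeftInverse.injective (T.symmₗ_linearMapAt (R := ℝ) hpT))
      (Function.LeftInverse.injective (T'.symmₗ_linearMapAt (R := ℝ) hpT'))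
  have hli' : LinearIndependent ℝ fun i => Θ p (s i p) :=
    hli.map' (Θ p) (LinearMap.ker_eq_bot.2 hΘ)
  filter_upwards [hc.eventually (isOpen_setOfPred_linearIndependent.mem_nhds hli')] with q hq
  exact LinearIndependent.of_comp (Θ q) hq

end Frames

/-- The image of an embedded submanifold under a section of a smooth map is an embedded
submanifold. -/
theorem isEmbeddedSubmanifold_image_of_section {V H N : Type*} [NormedAddCommGroup V]
    [NormedSpace ℝ V] [TopologicalSpace H] [TopologicalSpace N] [ChartedSpace H N]
    {J : ModelWithCorners ℝ V H} {V' H' N' : Type*} [NormedAddCommGroup V'] [NormedSpace ℝ V']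
    [TopologicalSpace H'] [TopologicalSpace N'] [ChartedSpace H' N'] {J' : ModelWithCorners ℝ V' H'}
    [J.Boundaryless] [FiniteDimensional ℝ V] [IsManifold J ∞ N]
    [J'.Boundaryless] [FiniteDimensional ℝ V'] [IsManifold J' ∞ N'] {f : N → N'}
    (hf : ContMDiff J J' ∞ f) {M : Set N'} (hM : IsEmbeddedSubmanifold J' M) {W : N' → N}
    (hW : ContMDiffOn J' J ∞ W M) (hfW : ∀ m ∈ M, f (W m) = m) :
    IsEmbeddedSubmanifold J (W '' M) := by
  refine isEmbeddedSubmanifold_of_isRetraction ?_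
  rintro _ ⟨m, hm, rfl⟩
  obtain ⟨U, r, hr⟩ := hM.exists_isRetraction hm
  -- Composing with `r` allows `W`, which is smooth only along `M`, to be used on an open set.
  refine ⟨f ⁻¹' U, fun q => W (r (f q)), hr.isOpen.preimage hf.continuous, ?_, ?_, ?_, ?_⟩
  · rw [mem_preimage, hfW m hm]
    exact hr.mem
  · exact hW.comp (hr.contMDiffOn.comp hf.contMDiffOn fun q hq => hq)
      fun q hq => hr.mapsTo _ hq
  · exact fun q hq => mem_image_of_mem _ (hr.mapsTo _ hq)
  · rintro _ ⟨m', hm', rfl⟩ hq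
    rw [mem_preimage, hfW m' hm'] at hq
    simp only [hfW m' hm', hr.eq_self m' hm' hq]

/-! ### Images under `leg` of saturated submanifolds and of their bundles. -/

section LegendreImage
variable {B F Q : Type*} [NormedAddCommGroup B] [NormedSpace ℝ B]
  [NormedAddCommGroup F] [NormedSpace ℝ F]
  [TopologicalSpace Q] [ChartedSpace B Q] [IsManifold 𝓘(ℝ, B) ∞ Q]
  {E : Q → Type*} [∀ x, AddCommGroup (E x)] [∀ x, Module ℝ (E x)] [∀ x, TopologicalSpace (E x)]
  [TopologicalSpace (TotalSpace F E)] [FiberBundle F E] [VectorBundle ℝ F E]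
  [ContMDiffVectorBundle ∞ F E 𝓘(ℝ, B)]
  [FiniteDimensional ℝ B] [FiniteDimensional ℝ F] [T2Space Q] {L : TotalSpace F E → ℝ}
  (hL : ContMDiff (IE B F) 𝓘(ℝ, ℝ) ∞ L) (hreg : IsAlmostRegular B L)
  {C : Set (TotalSpace F E)} (hC : ∀ q q', leg B L q = leg B L q' → q ∈ C → q' ∈ C)
include hL hreg

theorem mem_tangentTo_range_iff {e : TotalSpace F E} {w : TangentSpace (IEd B F) (leg B L e)} :
    w ∈ tangentTo (IEd B F) (range (leg B L)) (leg B L e) ↔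
      ∃ v : TangentSpace (IE B F) e, mfderiv (IE B F) (IEd B F) (leg B L) e v = w := by
  refine ⟨hreg.submersion e w, ?_⟩
  rintro ⟨v, rfl⟩
  rw [← image_univ]
  exact mfderiv_leg_mem hL (mem_tangentTo_univ v)

/-- The Legendre transformation has locally constant rank. -/
theorem exists_eventually_finrank_ker (e₀ : TotalSpace F E) : ∃ d : ℕ, ∀ᶠ e in 𝓝 e₀,
    Module.finrank ℝ (LinearMap.ker (mfderiv (IE B F) (IEd B F) (leg B L) e).toLinearMap) = d := by
  obtain ⟨φ, hφ, hp, W, hW⟩ := hreg.submanifold _ (mem_range_self e₀)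
  -- The range of `T leg` is the tangent space of `M₁`, whose dimension is that of the slice `W`.
  -- One slice chart, recentred at `leg e`, serves all nearby points.
  refine ⟨Module.finrank ℝ (B × F) - Module.finrank ℝ W, ?_⟩
  filter_upwards [(contMDiff_leg hL).continuous.continuousAt.eventually
    (φ.open_source.mem_nhds hp)] with e he
  have h1 : ∀ q ∈ φ.source, q ∈ range (leg B L) ↔
      φ.extend (IEd B F) q - φ.extend (IEd B F) (leg B L e) ∈ W := fun q hq => by
    rw [hW q hq, ← Submodule.sub_mem_iff_left W ((hW _ he).1 (mem_range_self e))]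
    rw [sub_sub_sub_cancel_right]
  let f : B × F →ₗ[ℝ] B × (F →L[ℝ] ℝ) :=
    (mfderiv (IE B F) (IEd B F) (leg B L) e : B × F →L[ℝ] B × (F →L[ℝ] ℝ)).toLinearMap
  let g : B × (F →L[ℝ] ℝ) →ₗ[ℝ] B × (F →L[ℝ] ℝ) :=
    (mfderiv (IEd B F) 𝓘(ℝ, B × (F →L[ℝ] ℝ)) (φ.extend (IEd B F)) (leg B L e) :
      B × (F →L[ℝ] ℝ) →L[ℝ] B × (F →L[ℝ] ℝ)).toLinearMap
  have h2 : LinearMap.range f = W.comap g := by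
    ext w
    refine Iff.trans ?_ (mem_tangentTo_iff_of_slice hφ he h1 (v := w))
    exact (mem_tangentTo_range_iff hL hreg).symm
  have h3 := LinearMap.finrank_range_add_finrank_ker f
  rw [h2, finrank_comap_of_injective g (mfderiv_extend_injective hφ he)] at h3
  change Module.finrank ℝ (LinearMap.ker f) = _
  omega

include hC

/-- With `σ` a local section of `leg` and `R` a retraction onto `C`, the map `leg ∘ R ∘ σ` is a
retraction onto the image; saturation places `σ n` in `C` for every nearby `n` of the image. -/
theorem isEmbeddedSubmanifold_leg_image (hCe : IsEmbeddedSubmanifold (IE B F) C) :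
    IsEmbeddedSubmanifold (IEd B F) (leg B L '' C) := by
  refine isEmbeddedSubmanifold_of_isRetraction ?_
  rintro _ ⟨e, he, rfl⟩
  obtain ⟨O, σ, hO, heO, hσ, hσe, hs⟩ := exists_leg_section hL hreg e
  obtain ⟨U, R, hR⟩ := hCe.exists_isRetraction he
  refine ⟨O ∩ σ ⁻¹' U, fun n => leg B L (R (σ n)),
    hσ.continuousOn.isOpen_inter_preimage hO hR.isOpen, ⟨heO, ?_⟩, ?_, ?_, ?_⟩
  · rw [mem_preimage, hσe]
    exact hR.mem
  · exact (contMDiff_leg hL).comp_contMDiffOn (hR.contMDiffOn.comp (hσ.mono inter_subset_left)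
      fun n hn => hn.2)
  · exact fun n hn => mem_image_of_mem _ (hR.mapsTo _ hn.2)
  · rintro _ ⟨q, hq, rfl⟩ hn
    have h1 := hs q hn.1
    simp only [hR.eq_self _ (hC _ _ h1.symm hq) hn.2, h1]

theorem image_prolongedLeg (A : LieAlgebroid B F E) {e : TotalSpace F E} :
    prolongedLeg B L e '' prolongationTo (IE B F) A TotalSpace.proj C e =
      prolongationTo (IEd B F) A TotalSpace.proj (leg B L '' C) (leg B L e) := by
  apply Subset.antisymm
  · rintro _ ⟨z, hz, rfl⟩
    exact ⟨(prolongedLeg_mem hL A).2 hz.1, mfderiv_leg_mem hL hz.2⟩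
  · rintro ⟨b, w⟩ ⟨hz, hw⟩
    obtain ⟨v, hv, hvw⟩ := exists_lift_tangentTo hL hreg hC rfl hw
    have h1 : prolongedLeg B L e (b, v) = (b, w) := Prod.ext rfl hvw
    exact ⟨(b, v), ⟨(prolongedLeg_mem hL A).1 (h1 ▸ hz), hv⟩, h1⟩

/-- The kernel of `T leg` is tangent to the fibre, which lies in `C`. So the kernel of `𝒯leg` on
this bundle has the dimension of `ker T leg`, whatever `C` is. -/
theorem prolongationTo_inter_ker (A : LieAlgebroid B F E) {e : TotalSpace F E} (he : e ∈ C)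
    {W : Submodule ℝ (E e.1 × TangentSpace (IE B F) e)}
    (hW : prolongationTo (IE B F) A TotalSpace.proj C e = W) :
    W ⊓ LinearMap.ker (prolongedLeg B L e) =
      (LinearMap.ker (mfderiv (IE B F) (IEd B F) (leg B L) e).toLinearMap).map
        (LinearMap.inr ℝ (E e.1) (TangentSpace (IE B F) e)) := by
  ext ⟨b, v⟩
  rw [Submodule.mem_inf, ← SetLike.mem_coe (p := W), ← hW, Submodule.mem_map]
  constructor
  · rintro ⟨-, h⟩
    have h1 : (b, mfderiv (IE B F) (IEd B F) (leg B L) e v) = 0 := h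
    exact ⟨v, congrArg Prod.snd h1, Prod.ext (congrArg Prod.fst h1).symm rfl⟩
  · rintro ⟨v', hv', h⟩
    obtain ⟨rfl, rfl⟩ := Prod.ext_iff.1 h
    have hv'' : mfderiv (IE B F) (IEd B F) (leg B L) e v' = 0 := hv'
    refine ⟨⟨?_, ?_⟩, ?_⟩
    · change A.anchor e.1 0 = mfderiv (IE B F) 𝓘(ℝ, B) TotalSpace.proj e v'
      refine (map_zero (A.anchor e.1)).trans (Eq.trans ?_ (mfderiv_proj_leg hL e v'))
      rw [hv'']
      exact (ContinuousLinearMap.map_zero (mfderiv (IEd B F) 𝓘(ℝ, B) TotalSpace.proj (leg B L e) :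
        B × (F →L[ℝ] ℝ) →L[ℝ] B)).symm
    · refine tangentTo_mono ?_ e (mem_tangentTo_fibre (contMDiff_leg hL) hreg.submanifold
        (fun q => mem_range_self q) (hreg.submersion e) hv'')
      exact fun q hq => hC e q (Eq.symm hq) he
    · exact Prod.ext rfl hv''

end LegendreImage

section SpanningFamily
variable {B F Q : Type*} [NormedAddCommGroup B] [NormedSpace ℝ B]
  [NormedAddCommGroup F] [NormedSpace ℝ F]
  [TopologicalSpace Q] [ChartedSpace B Q] [IsManifold 𝓘(ℝ, B) ∞ Q]
  {E : Q → Type*} [∀ x, AddCommGroup (E x)] [∀ x, Module ℝ (E x)] [∀ x, TopologicalSpace (E x)]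
  [TopologicalSpace (TotalSpace F E)] [FiberBundle F E] [VectorBundle ℝ F E]
  [ContMDiffVectorBundle ∞ F E 𝓘(ℝ, B)]
  {V H N : Type*} [NormedAddCommGroup V] [NormedSpace ℝ V] [TopologicalSpace H]
  [TopologicalSpace N] [ChartedSpace H N] {J : ModelWithCorners ℝ V H} [IsManifold J ∞ N]
  {pr : N → Q}

/-- A family of subspaces spanned by smooth sections and of locally constant dimension is a
subbundle. -/
theorem isSubbundle_of_span [FiniteDimensional ℝ F] [FiniteDimensional ℝ V] {S : Set N}
    {D : ∀ p : N, Set (E (pr p) × TangentSpace J p)}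
    (h : ∀ p ∈ S, ∃ U : Set N, IsOpen U ∧ p ∈ U ∧
      ∃ (r c : ℕ) (s : Fin r → ∀ p : N, E (pr p) × TangentSpace J p),
        (∀ i, SmoothAlong B F J pr (S ∩ U) (s i)) ∧
        ∀ q ∈ S ∩ U, D q = Submodule.span ℝ (range fun i => s i q) ∧
          Module.finrank ℝ (Submodule.span ℝ (range fun i => s i q)) = c) :
    IsSubbundle B F J pr S D := by
  intro p hp
  obtain ⟨U, hU, hpU, r, c, s, hs, hD⟩ := h p hp
  -- A subfamily that is a basis at `p` remains independent nearby, and the constant dimension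
  -- forces it to remain spanning.
  obtain ⟨κ, a, ha, hspan, hli⟩ := exists_linearIndependent' ℝ (fun i => s i p)
  have : Finite κ := Finite.of_injective a ha
  let ε := Finite.equivFin κ
  let t : Fin (Nat.card κ) → ∀ p : N, E (pr p) × TangentSpace J p := fun j => s (a (ε.symm j))
  have htli : LinearIndependent ℝ fun j => t j p := hli.comp _ ε.symm.injective
  have htspan : Submodule.span ℝ (range fun j => t j p) = Submodule.span ℝ (range fun i => s i p) := by
    rw [← hspan]
    exact congrArg (Submodule.span ℝ) (ε.symm.surjective.range_comp ((fun i => s i p) ∘ a))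
  have hcard : Nat.card κ = c := by
    rw [← (hD p ⟨hp, hpU⟩).2, ← htspan, finrank_span_eq_card htli, Fintype.card_fin]
  have hev := SmoothAlong.eventually_linearIndependent (show p ∈ S ∩ U from ⟨hp, hpU⟩)
    (fun j => hs (a (ε.symm j))) htli
  obtain ⟨U', hU', hpU', hsub⟩ := mem_nhdsWithin.1 hev
  refine ⟨U ∩ U', hU.inter hU', ⟨hpU, hpU'⟩, Nat.card κ, t,
    fun j => (hs _).mono fun q hq => ⟨hq.1, hq.2.1⟩, fun q hq => ?_⟩
  have hq' : q ∈ S ∩ U := ⟨hq.1, hq.2.1⟩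
  have hqli : LinearIndependent ℝ fun j => t j q := hsub ⟨hq.2.2, hq'⟩
  have : FiniteDimensional ℝ (Submodule.span ℝ (range fun i => s i q)) :=
    FiniteDimensional.span_of_finite ℝ (finite_range _)
  refine ⟨hqli, ?_⟩
  rw [(hD q hq').1]
  refine congrArg _ (Eq.symm (Submodule.eq_of_le_of_finrank_eq (Submodule.span_mono ?_) ?_))
  · rintro _ ⟨j, rfl⟩
    exact ⟨a (ε.symm j), rfl⟩
  · rw [finrank_span_eq_card hqli, Fintype.card_fin, hcard, (hD q hq').2]

end SpanningFamily

section LegendreImage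
variable {B F Q : Type*} [NormedAddCommGroup B] [NormedSpace ℝ B]
  [NormedAddCommGroup F] [NormedSpace ℝ F]
  [TopologicalSpace Q] [ChartedSpace B Q] [IsManifold 𝓘(ℝ, B) ∞ Q]
  {E : Q → Type*} [∀ x, AddCommGroup (E x)] [∀ x, Module ℝ (E x)] [∀ x, TopologicalSpace (E x)]
  [TopologicalSpace (TotalSpace F E)] [FiberBundle F E] [VectorBundle ℝ F E]
  [ContMDiffVectorBundle ∞ F E 𝓘(ℝ, B)]
  {L : TotalSpace F E → ℝ}

open Classical in
variable (B L) in
/-- The image under `𝒯leg` of the value at `q` of a section `s`, as an element of the fibre over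
`n = leg q`. -/
def pushLeg (s : ∀ e : TotalSpace F E, E e.1 × TangentSpace (IE B F) e) (q : TotalSpace F E)
    (n : TotalSpace (F →L[ℝ] ℝ) (Dual E)) : E n.1 × TangentSpace (IEd B F) n :=
  if h : leg B L q = n then h ▸ prolongedLeg B L q (s q) else 0

theorem pushLeg_leg (s : ∀ e : TotalSpace F E, E e.1 × TangentSpace (IE B F) e)
    (q : TotalSpace F E) : pushLeg B L s q (leg B L q) = prolongedLeg B L q (s q) :=
  dif_pos rfl

variable [FiniteDimensional ℝ B] [FiniteDimensional ℝ F] [T2Space Q]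
  (hL : ContMDiff (IE B F) 𝓘(ℝ, ℝ) ∞ L)

-- Smoothness is checked in the total spaces, where the transport between the fibres over `leg (σ
-- n)` and `n` disappears.
include hL in
theorem smoothAlong_pushLeg {s : ∀ e : TotalSpace F E, E e.1 × TangentSpace (IE B F) e}
    {C : Set (TotalSpace F E)} (hs : SmoothAlong B F (IE B F) TotalSpace.proj C s)
    {T : Set (TotalSpace (F →L[ℝ] ℝ) (Dual E))}
    {σ : TotalSpace (F →L[ℝ] ℝ) (Dual E) → TotalSpace F E}
    (hσ : ContMDiffOn (IEd B F) (IE B F) ∞ σ T) (hσC : MapsTo σ T C)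
    (hσs : ∀ n ∈ T, leg B L (σ n) = n) :
    SmoothAlong B F (IEd B F) TotalSpace.proj T fun n => pushLeg B L s (σ n) n := by
  have h1 : ∀ (n) (q : TotalSpace F E), leg B L q = n →
      (⟨n.1, (pushLeg B L s q n).1⟩ : TotalSpace F E) = ⟨q.1, (s q).1⟩ := by
    rintro _ q rfl
    rw [pushLeg_leg]
    rfl
  have h2 : ∀ (n) (q : TotalSpace F E), leg B L q = n →
      (⟨n, (pushLeg B L s q n).2⟩ : TangentBundle (IEd B F) (TotalSpace (F →L[ℝ] ℝ) (Dual E))) =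
        tangentMap (IE B F) (IEd B F) (leg B L) ⟨q, (s q).2⟩ := by
    rintro _ q rfl
    rw [pushLeg_leg]
    rfl
  refine ⟨(hs.1.comp hσ hσC).congr fun n hn => h1 n _ (hσs n hn), ?_⟩
  have h3 := (contMDiff_leg hL).contMDiff_tangentMap (m := ∞) (by simp)
  exact (h3.comp_contMDiffOn (hs.2.comp hσ hσC)).congr fun n hn => h2 n _ (hσs n hn)

variable (hreg : IsAlmostRegular B L)
  {C : Set (TotalSpace F E)} (hC : ∀ q q', leg B L q = leg B L q' → q ∈ C → q' ∈ C)
include hL hreg hC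

/-- A frame of the bundle over `C` is evaluated along a local section of `leg` and pushed down. The
result spans but need not be independent; its rank is `r - d`, with `d` the local dimension of `ker
T leg`. -/
theorem isSubbundle_leg_image (A : LieAlgebroid B F E)
    (hb : IsSubbundle B F (IE B F) TotalSpace.proj C (prolongationTo (IE B F) A TotalSpace.proj C)) :
    IsSubbundle B F (IEd B F) TotalSpace.proj (leg B L '' C)
      (prolongationTo (IEd B F) A TotalSpace.proj (leg B L '' C)) := by
  apply isSubbundle_of_span
  rintro _ ⟨e, he, rfl⟩
  obtain ⟨U, hU, heU, r, s, hs, hD⟩ := hb e he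
  obtain ⟨d, hd⟩ := exists_eventually_finrank_ker hL hreg e
  obtain ⟨U', hU'sub, hU', heU'⟩ := mem_nhds_iff.1 hd
  obtain ⟨O, σ, hO, heO, hσ, hσe, hsec⟩ := exists_leg_section hL hreg e
  have hdom : ∀ n ∈ leg B L '' C ∩ (O ∩ σ ⁻¹' (U ∩ U')), leg B L (σ n) = n ∧ σ n ∈ C := by
    rintro _ ⟨⟨q, hq, rfl⟩, hqO, -⟩
    exact ⟨hsec q hqO, hC _ _ (hsec q hqO).symm hq⟩
  have key : ∀ (n) (q : TotalSpace F E), leg B L q = n → q ∈ C ∩ U → q ∈ U' →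
      prolongationTo (IEd B F) A TotalSpace.proj (leg B L '' C) n =
        Submodule.span ℝ (range fun i => pushLeg B L (s i) q n) ∧
      Module.finrank ℝ (Submodule.span ℝ (range fun i => pushLeg B L (s i) q n)) = r - d := by
    rintro _ q rfl hq hqU'
    have h1 : (range fun i => pushLeg B L (s i) q (leg B L q)) =
        prolongedLeg B L q '' range fun i => s i q := by
      rw [← range_comp]
      exact congrArg range (funext fun i => pushLeg_leg _ _)
    rw [h1, ← Submodule.map_span, Submodule.map_coe, ← (hD q hq).2, image_prolongedLeg hL hreg hC]
    refine ⟨rfl, ?_⟩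
    have : FiniteDimensional ℝ (Submodule.span ℝ (range fun i => s i q)) :=
      FiniteDimensional.span_of_finite ℝ (finite_range _)
    have h2 := finrank_map_add_finrank_inf_ker (prolongedLeg B L q)
      (Submodule.span ℝ (range fun i => s i q))
    rw [prolongationTo_inter_ker hL hreg hC A hq.1 (hD q hq).2, finrank_span_eq_card (hD q hq).1,
      Fintype.card_fin] at h2
    have h3 := (Submodule.equivMapOfInjective (LinearMap.inr ℝ (E q.1) (TangentSpace (IE B F) q))
      LinearMap.inr_injective
      (LinearMap.ker (mfderiv (IE B F) (IEd B F) (leg B L) q).toLinearMap)).finrank_eq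
    have h4 : Module.finrank ℝ
        (LinearMap.ker (mfderiv (IE B F) (IEd B F) (leg B L) q).toLinearMap) = d := hU'sub hqU'
    rw [← h3, h4] at h2
    omega
  refine ⟨O ∩ σ ⁻¹' (U ∩ U'), hσ.continuousOn.isOpen_inter_preimage hO (hU.inter hU'),
    ⟨heO, ?_⟩, r, r - d, fun i n => pushLeg B L (s i) (σ n) n, fun i => ?_, fun n hn => ?_⟩
  · rw [mem_preimage, hσe]
    exact ⟨heU, heU'⟩
  · exact smoothAlong_pushLeg hL (hs i) (hσ.mono fun n hn => hn.2.1)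
      (fun n hn => ⟨(hdom n hn).2, hn.2.2.1⟩) fun n hn => (hdom n hn).1
  · exact key n (σ n) (hdom n hn).1 ⟨(hdom n hn).2, hn.2.2.1⟩ hn.2.2.2

theorem isLieSubalgebroid_leg_image (A : LieAlgebroid B F E)
    (hCe : IsEmbeddedSubmanifold (IE B F) C)
    (hb : IsSubbundle B F (IE B F) TotalSpace.proj C (prolongationTo (IE B F) A TotalSpace.proj C)) :
    IsLieSubalgebroid (IEd B F) A TotalSpace.proj (leg B L '' C)
      (prolongationTo (IEd B F) A TotalSpace.proj (leg B L '' C)) := by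
  have : T2Space (TotalSpace (F →L[ℝ] ℝ) (Dual E)) := t2Space_totalSpace _
  exact isLieSubalgebroid_prolongationTo A (contMDiff_proj (Dual E))
    (isEmbeddedSubmanifold_leg_image hL hreg hC hCe) (isSubbundle_leg_image hL hreg hC A hb)

end LegendreImage

/-! ### Local inverses of `leg` on a submanifold transverse to its fibres. -/

section LegendreIso
variable {B F Q : Type*} [NormedAddCommGroup B] [NormedSpace ℝ B]
  [NormedAddCommGroup F] [NormedSpace ℝ F]
  [TopologicalSpace Q] [ChartedSpace B Q] [IsManifold 𝓘(ℝ, B) ∞ Q]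
  {E : Q → Type*} [∀ x, AddCommGroup (E x)] [∀ x, Module ℝ (E x)] [∀ x, TopologicalSpace (E x)]
  [TopologicalSpace (TotalSpace F E)] [FiberBundle F E] [VectorBundle ℝ F E]
  [ContMDiffVectorBundle ∞ F E 𝓘(ℝ, B)]
  {L : TotalSpace F E → ℝ} {S : Set (TotalSpace F E)}
  {M U : Set (TotalSpace (F →L[ℝ] ℝ) (Dual E))}
  {ψ : TotalSpace (F →L[ℝ] ℝ) (Dual E) → TotalSpace F E}

variable (B L S M U ψ) in
/-- On the open set `U`, the map `ψ` is smooth, takes its values in `S`, and is inverse to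
`leg : S → M`. -/
structure IsLegInverse : Prop where
  isOpen : IsOpen U
  contMDiffOn : ContMDiffOn (IEd B F) (IE B F) ∞ ψ U
  mapsTo : MapsTo ψ U S
  mapsTo_leg : MapsTo (leg B L) S M
  left_inv : ∀ q ∈ S, leg B L q ∈ U → ψ (leg B L q) = q
  right_inv : ∀ m ∈ M, m ∈ U → leg B L (ψ m) = m

variable (B) in
/-- The linear map `(b, w) ↦ (b, Tψ(w))` from the fibre over `leg q` to the fibre over `q`, where
`ψ (leg q) = q`. -/
def prolongedInv (L : TotalSpace F E → ℝ)
    (ψ : TotalSpace (F →L[ℝ] ℝ) (Dual E) → TotalSpace F E) (q : TotalSpace F E) :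
    (E (leg B L q).1 × TangentSpace (IEd B F) (leg B L q)) →ₗ[ℝ]
      (E q.1 × TangentSpace (IE B F) q) :=
  LinearMap.prodMap (LinearMap.id (R := ℝ) (M := E q.1))
    (mfderiv (IEd B F) (IE B F) ψ (leg B L q)).toLinearMap

namespace IsLegInverse
variable [FiniteDimensional ℝ B] [FiniteDimensional ℝ F] [T2Space Q]
  (hL : ContMDiff (IE B F) 𝓘(ℝ, ℝ) ∞ L) (h : IsLegInverse B L S M U ψ) {q : TotalSpace F E}
  (hqS : q ∈ S) (hqU : leg B L q ∈ U)
include h hqS hqU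

theorem contMDiffAt : ContMDiffAt (IEd B F) (IE B F) ∞ ψ (leg B L q) :=
  h.contMDiffOn.contMDiffAt (h.isOpen.mem_nhds hqU)

-- The relation `ψ ∘ leg = id` holds only on `S`, so it may be differentiated only in directions
-- tangent to `S`.
include hL in
theorem mfderiv_mfderiv_leg {v : TangentSpace (IE B F) q} (hv : v ∈ tangentTo (IE B F) S q) :
    (mfderiv (IEd B F) (IE B F) ψ (leg B L q) (mfderiv (IE B F) (IEd B F) (leg B L) q v) : B × F) =
      v := by
  have h1 := mfderiv_comp q ((h.contMDiffAt hqS hqU).mdifferentiableAt (by simp))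
    (mdifferentiableAt_leg hL q)
  have h2 := mfderiv_congr_of_mem_tangentTo hv
    (((h.contMDiffAt hqS hqU).comp q (contMDiff_leg hL).contMDiffAt).mdifferentiableAt (by simp))
    (mdifferentiableAt_id) (J' := IE B F) (by
      filter_upwards [self_mem_nhdsWithin, mem_nhdsWithin_of_mem_nhds
        ((h.isOpen.preimage (contMDiff_leg hL).continuous).mem_nhds hqU)] with q' hq' hqU'
      exact h.left_inv q' hq' hqU')
  rw [h1] at h2
  refine Eq.trans h2 ?_
  rw [mfderiv_id]
  rfl

theorem mfderiv_mem {w : TangentSpace (IEd B F) (leg B L q)}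
    (hw : w ∈ tangentTo (IEd B F) M (leg B L q)) :
    (mfderiv (IEd B F) (IE B F) ψ (leg B L q) w : B × F) ∈
      (tangentTo (IE B F) S q : Set (B × F)) := by
  have h1 := mfderiv_mem_tangentTo (h.contMDiffAt hqS hqU) (S' := S)
    (mem_nhdsWithin_of_mem_nhds (mem_of_superset (h.isOpen.mem_nhds hqU) h.mapsTo)) hw
  have h2 : ∀ q', q' = q → ∀ u : B × F, u ∈ (tangentTo (IE B F) S q' : Set (B × F)) →
      u ∈ (tangentTo (IE B F) S q : Set (B × F)) := by
    rintro _ rfl u hu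
    exact hu
  exact h2 _ (h.left_inv q hqS hqU) _ h1

include hL in
theorem mfderiv_leg_mfderiv {w : TangentSpace (IEd B F) (leg B L q)}
    (hw : w ∈ tangentTo (IEd B F) M (leg B L q)) :
    (mfderiv (IE B F) (IEd B F) (leg B L) q
      (mfderiv (IEd B F) (IE B F) ψ (leg B L q) w : B × F) : B × (F →L[ℝ] ℝ)) = w := by
  have h1 := mfderiv_comp (leg B L q) (mdifferentiableAt_leg hL (ψ (leg B L q)))
    ((h.contMDiffAt hqS hqU).mdifferentiableAt (by simp))
  have h2 := mfderiv_congr_of_mem_tangentTo hw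
    (((contMDiff_leg hL).contMDiffAt.comp _ (h.contMDiffAt hqS hqU)).mdifferentiableAt (by simp))
    (mdifferentiableAt_id) (J' := IEd B F) (by
      filter_upwards [self_mem_nhdsWithin, mem_nhdsWithin_of_mem_nhds
        (h.isOpen.mem_nhds hqU)] with m hm hmU
      exact h.right_inv m hm hmU)
  rw [h1] at h2
  refine (mfderiv_eq_of_eq (V := B × F) (V' := B × (F →L[ℝ] ℝ)) (leg B L)
    (h.left_inv q hqS hqU).symm rfl).trans (Eq.trans h2 ?_)
  rw [mfderiv_id]
  rfl

include hL

theorem prolongedInv_prolongedLeg (A : LieAlgebroid B F E) {z : E q.1 × TangentSpace (IE B F) q}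
    (hz : z ∈ prolongationTo (IE B F) A TotalSpace.proj S q) :
    prolongedInv B L ψ q (prolongedLeg B L q z) = z :=
  Prod.ext rfl (h.mfderiv_mfderiv_leg hL hqS hqU hz.2)

theorem prolongedLeg_prolongedInv (A : LieAlgebroid B F E)
    {z : E (leg B L q).1 × TangentSpace (IEd B F) (leg B L q)}
    (hz : z ∈ prolongationTo (IEd B F) A TotalSpace.proj M (leg B L q)) :
    prolongedLeg B L q (prolongedInv B L ψ q z) = z :=
  Prod.ext rfl (h.mfderiv_leg_mfderiv hL hqS hqU hz.2)

omit hqU in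
theorem prolongedLeg_mem_prolongationTo (A : LieAlgebroid B F E)
    {z : E q.1 × TangentSpace (IE B F) q}
    (hz : z ∈ prolongationTo (IE B F) A TotalSpace.proj S q) :
    prolongedLeg B L q z ∈ prolongationTo (IEd B F) A TotalSpace.proj M (leg B L q) :=
  ⟨(prolongedLeg_mem hL A).2 hz.1, tangentTo_mono (image_subset_iff.2 h.mapsTo_leg) _
    (mfderiv_leg_mem hL hz.2)⟩

theorem prolongedInv_mem_prolongationTo (A : LieAlgebroid B F E)
    {z : E (leg B L q).1 × TangentSpace (IEd B F) (leg B L q)}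
    (hz : z ∈ prolongationTo (IEd B F) A TotalSpace.proj M (leg B L q)) :
    prolongedInv B L ψ q z ∈ prolongationTo (IE B F) A TotalSpace.proj S q := by
  refine ⟨(prolongedLeg_mem hL A).1 ?_, h.mfderiv_mem hqS hqU hz.2⟩
  rw [h.prolongedLeg_prolongedInv hL hqS hqU A hz]
  exact hz.1

theorem bijOn_prolongedLeg (A : LieAlgebroid B F E) :
    BijOn (prolongedLeg B L q) (prolongationTo (IE B F) A TotalSpace.proj S q)
      (prolongationTo (IEd B F) A TotalSpace.proj M (leg B L q)) :=
  BijOn.mk (fun _ hz => h.prolongedLeg_mem_prolongationTo hL hqS A hz)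
    (LeftInvOn.injOn fun _ hz => h.prolongedInv_prolongedLeg hL hqS hqU A hz)
    fun z hz => ⟨prolongedInv B L ψ q z, h.prolongedInv_mem_prolongationTo hL hqS hqU A hz,
      h.prolongedLeg_prolongedInv hL hqS hqU A hz⟩

theorem image_prolongedInv (A : LieAlgebroid B F E) :
    prolongedInv B L ψ q '' prolongationTo (IEd B F) A TotalSpace.proj M (leg B L q) =
      prolongationTo (IE B F) A TotalSpace.proj S q := by
  apply Subset.antisymm
  · rintro _ ⟨z, hz, rfl⟩
    exact h.prolongedInv_mem_prolongationTo hL hqS hqU A hz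
  · exact fun z hz => ⟨_, h.prolongedLeg_mem_prolongationTo hL hqS A hz,
      h.prolongedInv_prolongedLeg hL hqS hqU A hz⟩

omit hqS hqU

theorem smoothAlong_prolongedInv
    {Z : ∀ m : TotalSpace (F →L[ℝ] ℝ) (Dual E), E m.1 × TangentSpace (IEd B F) m}
    {T : Set (TotalSpace (F →L[ℝ] ℝ) (Dual E))}
    (hZ : SmoothAlong B F (IEd B F) TotalSpace.proj T Z) {S' : Set (TotalSpace F E)}
    (hS' : ∀ q ∈ S', q ∈ S ∧ leg B L q ∈ T ∩ U) :
    SmoothAlong B F (IE B F) TotalSpace.proj S'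
      fun q => prolongedInv B L ψ q (Z (leg B L q)) := by
  refine ⟨hZ.1.comp (contMDiff_leg hL).contMDiffOn fun q hq => (hS' q hq).2.1, ?_⟩
  have h1 := h.contMDiffOn.contMDiffOn_tangentMapWithin (m := ∞) (by simp) h.isOpen.uniqueMDiffOn
  have h2 := h1.comp ((hZ.2.mono inter_subset_left).comp (contMDiff_leg hL).contMDiffOn
    fun q hq => (hS' q hq).2) fun q hq => (hS' q hq).2.2
  refine h2.congr fun q hq => ?_
  have h3 : ∀ q', q' = q → ∀ u : B × F, (⟨q, u⟩ : TangentBundle (IE B F) (TotalSpace F E)) =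
      ⟨q', u⟩ := by
    rintro _ rfl u
    rfl
  refine (h3 _ (h.left_inv q (hS' q hq).1 (hS' q hq).2.2) _).trans ?_
  simp only [Function.comp_apply, tangentMapWithin]
  rw [mfderivWithin_eq_mfderiv (h.isOpen.uniqueMDiffWithinAt (hS' q hq).2.2)
    ((h.contMDiffAt (hS' q hq).1 (hS' q hq).2.2).mdifferentiableAt (by simp))]
  rfl

/-- A frame over `M` is pulled back through `ψ`; independence persists because `𝒯leg` undoes the
pullback. -/
theorem exists_localFrame_prolongationTo (A : LieAlgebroid B F E)
    (hb : IsSubbundle B F (IEd B F) TotalSpace.proj M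
      (prolongationTo (IEd B F) A TotalSpace.proj M)) (hqS : q ∈ S) (hqU : leg B L q ∈ U) :
    ∃ U : Set (TotalSpace F E), IsOpen U ∧ q ∈ U ∧
    ∃ (r : ℕ) (s : Fin r → ∀ p : TotalSpace F E, E p.1 × TangentSpace (IE B F) p),
      (∀ i, SmoothAlong B F (IE B F) TotalSpace.proj (S ∩ U) (s i)) ∧
      ∀ q ∈ S ∩ U, LinearIndependent ℝ (fun i => s i q) ∧
        prolongationTo (IE B F) A TotalSpace.proj S q =
          Submodule.span ℝ (range fun i => s i q) := by
  obtain ⟨U', hU', hqU', r, s, hs, hD⟩ := hb _ (h.mapsTo_leg hqS)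
  refine ⟨leg B L ⁻¹' (U' ∩ U), (hU'.inter h.isOpen).preimage (contMDiff_leg hL).continuous,
    ⟨hqU', hqU⟩, r, fun i p => prolongedInv B L ψ p (s i (leg B L p)), fun i => ?_, ?_⟩
  · exact h.smoothAlong_prolongedInv hL (hs i) fun p hp =>
      ⟨hp.1, ⟨h.mapsTo_leg hp.1, hp.2.1⟩, hp.2.2⟩
  · intro p hp
    obtain ⟨hli, hspan⟩ := hD (leg B L p) ⟨h.mapsTo_leg hp.1, hp.2.1⟩
    constructor
    · refine LinearIndependent.of_comp (prolongedLeg B L p) ?_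
      convert hli using 2 with i
      refine h.prolongedLeg_prolongedInv hL hp.1 hp.2.2 A ?_
      rw [hspan]
      exact Submodule.subset_span (mem_range_self i)
    · rw [← h.image_prolongedInv hL hp.1 hp.2.2 A, hspan, ← Submodule.map_coe, Submodule.map_span,
        ← range_comp]
      rfl

end IsLegInverse
end LegendreIso

section SmoothAlong
variable {B F Q : Type*} [NormedAddCommGroup B] [NormedSpace ℝ B]
  [NormedAddCommGroup F] [NormedSpace ℝ F]
  [TopologicalSpace Q] [ChartedSpace B Q] [IsManifold 𝓘(ℝ, B) ∞ Q]
  {E : Q → Type*} [∀ x, AddCommGroup (E x)] [∀ x, Module ℝ (E x)] [∀ x, TopologicalSpace (E x)]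
  [TopologicalSpace (TotalSpace F E)] [FiberBundle F E] [VectorBundle ℝ F E]
  [ContMDiffVectorBundle ∞ F E 𝓘(ℝ, B)]
  {V H N : Type*} [NormedAddCommGroup V] [NormedSpace ℝ V] [TopologicalSpace H]
  [TopologicalSpace N] [ChartedSpace H N] {J : ModelWithCorners ℝ V H} [IsManifold J ∞ N]
  {pr : N → Q} {S : Set N} {Z Z' : ∀ p : N, E (pr p) × TangentSpace J p}

theorem SmoothAlong.congr (h : SmoothAlong B F J pr S Z) (hZ : ∀ p ∈ S, Z' p = Z p) :
    SmoothAlong B F J pr S Z' :=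
  ⟨h.1.congr fun p hp => by rw [hZ p hp], h.2.congr fun p hp => by rw [hZ p hp]⟩

theorem smoothAlong_of_locally (h : ∀ p ∈ S, ∃ U, IsOpen U ∧ p ∈ U ∧
    SmoothAlong B F J pr (S ∩ U) Z) : SmoothAlong B F J pr S Z := by
  constructor <;> refine contMDiffOn_of_locally_contMDiffOn fun p hp => ?_
  · obtain ⟨U, hU, hpU, hs⟩ := h p hp
    exact ⟨U, hU, hpU, hs.1⟩
  · obtain ⟨U, hU, hpU, hs⟩ := h p hp
    exact ⟨U, hU, hpU, hs.2⟩

end SmoothAlong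

/-! ### The isomorphism defined by `leg` on the image of a section. -/

section LegendreIso
variable {B F Q : Type*} [NormedAddCommGroup B] [NormedSpace ℝ B]
  [NormedAddCommGroup F] [NormedSpace ℝ F]
  [TopologicalSpace Q] [ChartedSpace B Q] [IsManifold 𝓘(ℝ, B) ∞ Q]
  {E : Q → Type*} [∀ x, AddCommGroup (E x)] [∀ x, Module ℝ (E x)] [∀ x, TopologicalSpace (E x)]
  [TopologicalSpace (TotalSpace F E)] [FiberBundle F E] [VectorBundle ℝ F E]
  [ContMDiffVectorBundle ∞ F E 𝓘(ℝ, B)]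
  {L : TotalSpace F E → ℝ}
  {M : Set (TotalSpace (F →L[ℝ] ℝ) (Dual E))}
  {W : TotalSpace (F →L[ℝ] ℝ) (Dual E) → TotalSpace F E}

variable [FiniteDimensional ℝ B] [FiniteDimensional ℝ F] [T2Space Q]
  (hL : ContMDiff (IE B F) 𝓘(ℝ, ℝ) ∞ L)
  (hM : IsEmbeddedSubmanifold (IEd B F) M)
  (hW : ContMDiffOn (IEd B F) (IE B F) ∞ W M) (hlW : ∀ m ∈ M, leg B L (W m) = m)

-- Take `ψ = W ∘ r` with `r` a retraction onto `M`: differentiating `W` requires an extension to an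
-- open set.
include hM hW hlW in
theorem exists_isLegInverse {q : TotalSpace F E} (hq : q ∈ W '' M) :
    ∃ U ψ, leg B L q ∈ U ∧ IsLegInverse B L (W '' M) M U ψ := by
  obtain ⟨m, hm, rfl⟩ := hq
  obtain ⟨U, r, hr⟩ := hM.exists_isRetraction hm
  refine ⟨U, fun n => W (r n), ?_, hr.isOpen,
    hW.comp hr.contMDiffOn fun n hn => hr.mapsTo n hn,
    fun n hn => mem_image_of_mem _ (hr.mapsTo n hn), ?_, ?_, ?_⟩
  · rw [hlW m hm]
    exact hr.mem
  · rintro _ ⟨n, hn, rfl⟩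
    rwa [hlW n hn]
  · rintro _ ⟨n, hn, rfl⟩ hU
    rw [hlW n hn] at hU ⊢
    simp only [hr.eq_self n hn hU]
  · intro n hn hU
    simp only [hr.eq_self n hn hU, hlW n hn]

include hL in
/-- The bracket is natural with respect to `𝒯leg`, for sections that are related along a set `S`
to which they are tangent. -/
theorem prolongedLeg_prolongationBracket (A : LieAlgebroid B F E) {S : Set (TotalSpace F E)}
    {p : TotalSpace F E} (hp : p ∈ S)
    {Z₁ Z₂ : ∀ e : TotalSpace F E, E e.1 × TangentSpace (IE B F) e}
    {Z₁' Z₂' : ∀ m : TotalSpace (F →L[ℝ] ℝ) (Dual E), E m.1 × TangentSpace (IEd B F) m}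
    (hZ₁ : IsSection (IE B F) A TotalSpace.proj Z₁) (hZ₂ : IsSection (IE B F) A TotalSpace.proj Z₂)
    (hZ₁' : IsSection (IEd B F) A TotalSpace.proj Z₁')
    (hZ₂' : IsSection (IEd B F) A TotalSpace.proj Z₂')
    (h₁ : ∀ᶠ q in 𝓝[S] p, Z₁ q ∈ prolongationTo (IE B F) A TotalSpace.proj S q ∧
      prolongedLeg B L q (Z₁ q) = Z₁' (leg B L q))
    (h₂ : ∀ᶠ q in 𝓝[S] p, Z₂ q ∈ prolongationTo (IE B F) A TotalSpace.proj S q ∧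
      prolongedLeg B L q (Z₂ q) = Z₂' (leg B L q)) :
    prolongedLeg B L p (prolongationBracket (IE B F) A TotalSpace.proj Z₁ Z₂ p) =
      prolongationBracket (IEd B F) A TotalSpace.proj Z₁' Z₂' (leg B L p) := by
  have : T2Space (TotalSpace (F →L[ℝ] ℝ) (Dual E)) := t2Space_totalSpace _
  have : T2Space (TotalSpace F E) := t2Space_totalSpace _
  refine Prod.ext ?_ ?_
  · obtain ⟨fr⟩ := exists_localFrame (B := B) (F := F) (E := E) p.1
    refine Eq.trans ?_ (fr.prolongationBracket_fst A (p := leg B L p) fr.mem_dom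
      (contMDiff_proj (Dual E)) hZ₁' hZ₂').symm
    refine (fr.prolongationBracket_fst A fr.mem_dom (contMDiff_proj E) hZ₁ hZ₂).trans ?_
    have hfst : ∀ {Z : ∀ e : TotalSpace F E, E e.1 × TangentSpace (IE B F) e}
        {Z' : ∀ m : TotalSpace (F →L[ℝ] ℝ) (Dual E), E m.1 × TangentSpace (IEd B F) m}
        {q : TotalSpace F E}, prolongedLeg B L q (Z q) = Z' (leg B L q) →
        ((Z q).1 : E q.1) = (Z' (leg B L q)).1 := fun h => congrArg Prod.fst h
    have hder : ∀ {Z₁ Z₂ : ∀ e : TotalSpace F E, E e.1 × TangentSpace (IE B F) e}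
        {Z₁' Z₂' : ∀ m : TotalSpace (F →L[ℝ] ℝ) (Dual E), E m.1 × TangentSpace (IEd B F) m}
        (_ : IsSection (IE B F) A TotalSpace.proj Z₂)
        (_ : IsSection (IEd B F) A TotalSpace.proj Z₂')
        (_ : ∀ᶠ q in 𝓝[S] p, Z₁ q ∈ prolongationTo (IE B F) A TotalSpace.proj S q ∧
          prolongedLeg B L q (Z₁ q) = Z₁' (leg B L q))
        (_ : ∀ᶠ q in 𝓝[S] p, Z₂ q ∈ prolongationTo (IE B F) A TotalSpace.proj S q ∧
          prolongedLeg B L q (Z₂ q) = Z₂' (leg B L q)) (a : Fin fr.rank),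
        dirDeriv (IE B F) (Z₁ p).2 (fun q => fr.coord a q.1 (Z₂ q).1) =
          dirDeriv (IEd B F) (Z₁' (leg B L p)).2 (fun m => fr.coord a m.1 (Z₂' m).1) := by
      intro Z₁ Z₂ Z₁' Z₂' hZ₂ hZ₂' h₁ h₂ a
      have h3 := (fr.smoothFunAt_coord (pr := TotalSpace.proj) fr.mem_dom isOpen_univ
        (mem_univ p) hZ₂.2.1 a).mdifferentiableAt
      have h4 := (fr.smoothFunAt_coord (p := leg B L p) (pr := TotalSpace.proj) fr.mem_dom
        isOpen_univ (mem_univ _) hZ₂'.2.1 a).mdifferentiableAt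
      have h5 := h₁.self_of_nhdsWithin hp
      rw [← h5.2]
      -- The coordinates of `Z₂` and of `Z₂' ∘ leg` agree along `S` only, which suffices because the
      -- anchor of `Z₁` is tangent to `S`.
      refine Eq.trans ?_ (dirDeriv_mfderiv (Z₁ p).2 (mdifferentiableAt_leg hL p) h4).symm
      refine dirDeriv_congr_of_mem_tangentTo h5.1.2 h3
        (h4.comp p (mdifferentiableAt_leg hL p)) ?_
      filter_upwards [h₂] with q hq
      exact congrArg (fr.coord a q.1) (hfst hq.2)
    have e₁ := hfst (h₁.self_of_nhdsWithin hp).2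
    have e₂ := hfst (h₂.self_of_nhdsWithin hp).2
    unfold LocalFrame.bracketFst
    have d₁ := hder hZ₂ hZ₂' h₁ h₂
    have d₂ := hder hZ₁ hZ₁' h₂ h₁
    simp only [d₁, d₂, e₁, e₂]
    rfl
  · exact mfderiv_mlieBracket_of_related hp isOpen_univ (mem_univ p)
      (contMDiff_leg hL).contMDiffOn (hZ₁.smoothFieldAt A p) (hZ₂.smoothFieldAt A p)
      (hZ₁'.smoothFieldAt A _) (hZ₂'.smoothFieldAt A _) (h₁.self_of_nhdsWithin hp).1.2
      (h₂.self_of_nhdsWithin hp).1.2 (h₁.mono fun q hq => congrArg Prod.snd hq.2)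
      (h₂.mono fun q hq => congrArg Prod.snd hq.2)

include hL hM hW hlW

theorem isLieSubalgebroid_image_of_section (A : LieAlgebroid B F E)
    (hb : IsSubbundle B F (IEd B F) TotalSpace.proj M
      (prolongationTo (IEd B F) A TotalSpace.proj M)) :
    IsLieSubalgebroid (IE B F) A TotalSpace.proj (W '' M)
      (prolongationTo (IE B F) A TotalSpace.proj (W '' M)) := by
  have : T2Space (TotalSpace F E) := t2Space_totalSpace _
  refine isLieSubalgebroid_prolongationTo A (contMDiff_proj E)
    (isEmbeddedSubmanifold_image_of_section (contMDiff_leg hL) hM hW hlW) fun q hq => ?_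
  obtain ⟨U, ψ, hqU, hψ⟩ := exists_isLegInverse hM hW hlW hq
  exact hψ.exists_localFrame_prolongationTo hL A hb hq hqU

theorem isLieAlgebroidIso_leg (A : LieAlgebroid B F E) :
    IsLieAlgebroidIso (IE B F) (IEd B F) A TotalSpace.proj TotalSpace.proj
      (W '' M) (prolongationTo (IE B F) A TotalSpace.proj (W '' M))
      M (prolongationTo (IEd B F) A TotalSpace.proj M) (leg B L) (prolongedLeg B L) where
  bijOn_base := by
    refine BijOn.mk ?_ ?_ fun m hm => ⟨W m, mem_image_of_mem _ hm, hlW m hm⟩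
    · rintro _ ⟨m, hm, rfl⟩
      rwa [hlW m hm]
    · rintro _ ⟨m, hm, rfl⟩ _ ⟨m', hm', rfl⟩ h
      rw [hlW m hm, hlW m' hm'] at h
      rw [h]
  smooth_base := (contMDiff_leg hL).contMDiffOn
  smooth_base_inv := ⟨W, hW, by
    rintro _ ⟨m, hm, rfl⟩
    rw [hlW m hm]⟩
  bijOn_fibre p hp := by
    obtain ⟨U, ψ, hqU, hψ⟩ := exists_isLegInverse hM hW hlW hp
    exact hψ.bijOn_prolongedLeg hL hp hqU A
  smooth_iff Z Z' hZ hZZ := by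
    constructor
    · intro hs
      refine (smoothAlong_pushLeg hL hs hW (fun m hm => mem_image_of_mem _ hm) hlW).congr ?_
      have h1 : ∀ m, ∀ q ∈ W '' M, leg B L q = m → Z' m = pushLeg B L Z q m := by
        rintro _ q hq rfl
        rw [pushLeg_leg, hZZ q hq]
      exact fun m hm => h1 m (W m) (mem_image_of_mem _ hm) (hlW m hm)
    · refine fun hs => smoothAlong_of_locally fun p hp => ?_
      obtain ⟨U, ψ, hqU, hψ⟩ := exists_isLegInverse hM hW hlW hp
      refine ⟨leg B L ⁻¹' U, hψ.isOpen.preimage (contMDiff_leg hL).continuous, hqU,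
        (hψ.smoothAlong_prolongedInv hL hs
          fun q hq => ⟨hq.1, hψ.mapsTo_leg hq.1, hq.2⟩).congr fun q hq => ?_⟩
      rw [← hZZ q hq.1]
      exact (hψ.prolongedInv_prolongedLeg hL hq.1 hq.2 A (hZ q hq.1)).symm
  map_anchor _ _ _ _ := rfl
  map_bracket _ hp _ _ _ _ hZ₁ hZ₂ hZ₁' hZ₂' h₁ h₂ :=
    prolongedLeg_prolongationBracket hL A hp hZ₁ hZ₂ hZ₁' hZ₂' h₁ h₂

end LegendreIso

/-! ### The second-order condition on a projectable solution. -/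

section SodeSection
variable {B F Q : Type*} [NormedAddCommGroup B] [NormedSpace ℝ B]
  [NormedAddCommGroup F] [NormedSpace ℝ F]
  [TopologicalSpace Q] [ChartedSpace B Q] [IsManifold 𝓘(ℝ, B) ∞ Q]
  {E : Q → Type*} [∀ x, AddCommGroup (E x)] [∀ x, Module ℝ (E x)] [∀ x, TopologicalSpace (E x)]
  [TopologicalSpace (TotalSpace F E)] [FiberBundle F E] [VectorBundle ℝ F E]
  [ContMDiffVectorBundle ∞ F E 𝓘(ℝ, B)]
  [FiniteDimensional ℝ B] [FiniteDimensional ℝ F] [T2Space Q]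
  {L : TotalSpace F E → ℝ}

/-- Injectivity of the vertical lift reduces the condition defining `S^X` to an equation in the
fibre of `E`. -/
theorem vertEndo_eq_euler_iff (e : TotalSpace F E) (z : E e.1 × TangentSpace (IE B F) e) :
    vertEndo B e z = euler B e ↔ z.1 = e.2 :=
  ⟨fun h => vertLift_injective e (congrArg Prod.snd h), fun h => by
    unfold vertEndo euler
    rw [h]⟩

/-- If a solution of the dynamical equation along a `leg`-saturated set projects to `Y`, then the
`E`-component of `Y m` lies on the fibre of `leg` over `m`. -/
theorem leg_fst_of_projectable (hL : ContMDiff (IE B F) 𝓘(ℝ, ℝ) ∞ L) (hreg : IsAlmostRegular B L)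
    (A : LieAlgebroid B F E) {C : Set (TotalSpace F E)}
    (hC : ∀ q q', leg B L q = leg B L q' → q ∈ C → q' ∈ C)
    {X : ∀ e : TotalSpace F E, E e.1 × TangentSpace (IE B F) e}
    (hX : ∀ e ∈ C, X e ∈ prolongation (IE B F) A TotalSpace.proj e)
    (hX_sol : ∀ e ∈ C, ∀ z ∈ prolongation (IE B F) A TotalSpace.proj e,
      cartanTwo A L e (X e) z = dFun B (energy B L) e z)
    {Y : ∀ m : TotalSpace (F →L[ℝ] ℝ) (Dual E), E m.1 × TangentSpace (IEd B F) m}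
    (hXY : ∀ e ∈ C, prolongedLeg B L e (X e) = Y (leg B L e)) {m} (hm : m ∈ leg B L '' C) :
    leg B L ⟨m.1, (Y m).1⟩ = m := by
  obtain ⟨⟨x, a₀⟩, he, rfl⟩ := hm
  refine leg_eq_of_forall_vertLift hL hreg fun a ha => ?_
  have haC : (⟨x, a⟩ : TotalSpace F E) ∈ C := hC _ _ ha.symm he
  -- The same vector `(Y m).1` is the `E`-component of `X` at every point of the fibre; this fixed
  -- target is what the nearest-point argument requires.
  have h1 : ∀ n, leg B L ⟨x, a⟩ = n → ∀ hn : n.1 = x,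
      (X ⟨x, a⟩).1 = hn ▸ (Y n).1 := by
    rintro _ rfl hn
    exact congrArg Prod.fst (hXY _ haC)
  have h2 := mfderiv_leg_vertLift_of_solution hL A (hX _ haC) (hX_sol _ haC)
  rw [h1 _ ha rfl] at h2
  exact h2

end SodeSection

end LieAlgd
end

/-! ### The theorem. -/

theorem theorem4p4
    {B F Q : Type*} [NormedAddCommGroup B] [NormedSpace ℝ B] [FiniteDimensional ℝ B]
    [NormedAddCommGroup F] [NormedSpace ℝ F] [FiniteDimensional ℝ F]
    [TopologicalSpace Q] [T2Space Q] [ChartedSpace B Q] [IsManifold 𝓘(ℝ, B) ∞ Q]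
    {E : Q → Type*} [∀ x, AddCommGroup (E x)] [∀ x, Module ℝ (E x)] [∀ x, TopologicalSpace (E x)]
    [TopologicalSpace (TotalSpace F E)] [FiberBundle F E] [VectorBundle ℝ F E]
    [ContMDiffVectorBundle ∞ F E 𝓘(ℝ, B)]
    (A : LieAlgebroid B F E)
    (L : TotalSpace F E → ℝ) (hL : ContMDiff (IE B F) 𝓘(ℝ, ℝ) ∞ L)
    (hreg : IsAlmostRegular B L)
    (k : ℕ)
    (halg : ∀ j ≤ k, IsEmbeddedSubmanifold (IE B F) (constraintSet A L j) ∧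
      IsSubbundle B F (IE B F) TotalSpace.proj (constraintSet A L j)
        (constraintBundle A L j))
    (hfinal : constraintSet A L (k + 1) = constraintSet A L k)
    (X : ∀ e : TotalSpace F E, E e.1 × TangentSpace (IE B F) e)
    (hX_smooth : SmoothAlong B F (IE B F) TotalSpace.proj (constraintSet A L k) X)
    (hX_mem : ∀ e ∈ constraintSet A L k, X e ∈ constraintBundle A L k e)
    (hX_sol : ∀ e ∈ constraintSet A L k, ∀ z ∈ prolongation (IE B F) A TotalSpace.proj e,
      cartanTwo A L e (X e) z = dFun B (energy B L) e z)
    (Y : ∀ m : TotalSpace (F →L[ℝ] ℝ) (Dual E), E m.1 × TangentSpace (IEd B F) m)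
    (hY_smooth : SmoothAlong B F (IEd B F) TotalSpace.proj (legConstraintSet A L k) Y)
    (hY_mem : ∀ m ∈ legConstraintSet A L k, Y m ∈ legConstraintBundle A L k m)
    (hXY : ∀ e ∈ constraintSet A L k, prolongedLeg B L e (X e) = Y (leg B L e)) :
    IsEmbeddedSubmanifold (IE B F) (sodeSet A L k X) ∧
    (∃ W : TotalSpace (F →L[ℝ] ℝ) (Dual E) → TotalSpace F E,
      ContMDiffOn (IEd B F) (IE B F) ∞ W (legConstraintSet A L k) ∧
      (∀ m ∈ legConstraintSet A L k, W m ∈ constraintSet A L k ∧ leg B L (W m) = m) ∧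
      W '' legConstraintSet A L k = sodeSet A L k X) ∧
    IsLieSubalgebroid (IEd B F) A TotalSpace.proj (legConstraintSet A L k)
      (legConstraintBundle A L k) ∧
    ∃ AX : ∀ e : TotalSpace F E, Set (E e.1 × TangentSpace (IE B F) e),
      IsLieSubalgebroid (IE B F) A TotalSpace.proj (sodeSet A L k X) AX ∧
      (∀ e ∈ sodeSet A L k X, AX e ⊆ constraintBundle A L k e) ∧
      IsLieAlgebroidIso (IE B F) (IEd B F) A TotalSpace.proj TotalSpace.proj
        (sodeSet A L k X) AX (legConstraintSet A L k) (legConstraintBundle A L k)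
        (leg B L) (prolongedLeg B L) :=  by
  have hC := constraintSet_saturated hL hreg A k
  obtain ⟨hCe, hCb⟩ := halg k le_rfl
  have hM : IsEmbeddedSubmanifold (IEd B F) (legConstraintSet A L k) :=
    isEmbeddedSubmanifold_leg_image hL hreg hC hCe
  have hMb := isSubbundle_leg_image hL hreg hC A hCb
  -- The only possible section: a point `e` of `S^X` equals `(X e).1 = (Y (leg e)).1`.
  let W : TotalSpace (F →L[ℝ] ℝ) (Dual E) → TotalSpace F E := fun m => ⟨m.1, (Y m).1⟩
  have hW : ContMDiffOn (IEd B F) (IE B F) ∞ W (legConstraintSet A L k) := hY_smooth.1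
  have hlW : ∀ m ∈ legConstraintSet A L k, leg B L (W m) = m := fun m hm =>
    leg_fst_of_projectable hL hreg A hC (fun e he => (hX_mem e he).1) hX_sol hXY hm
  have hWC : ∀ m ∈ legConstraintSet A L k, W m ∈ constraintSet A L k := by
    rintro _ ⟨e, he, rfl⟩
    exact hC e _ (hlW _ (mem_image_of_mem _ he)).symm he
  have hS : W '' legConstraintSet A L k = sodeSet A L k X := by
    have h1 : ∀ e ∈ constraintSet A L k, (X e).1 = (W (leg B L e)).2 := fun e he =>
      congrArg Prod.fst (hXY e he)
    apply Subset.antisymm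
    · rintro _ ⟨m, hm, rfl⟩
      refine ⟨hWC m hm, (vertEndo_eq_euler_iff _ _).2 ((h1 _ (hWC m hm)).trans ?_)⟩
      have h2 : ∀ n, n = m → ∀ hn : n.1 = m.1, hn ▸ (Y n).1 = (Y m).1 := by
        rintro _ rfl _
        rfl
      exact h2 _ (hlW m hm) rfl
    · rintro e ⟨he, heX⟩
      refine ⟨leg B L e, mem_image_of_mem _ he, ?_⟩
      have h2 := (h1 e he).symm.trans ((vertEndo_eq_euler_iff e _).1 heX)
      exact TotalSpace.ext rfl (heq_of_eq h2)
  -- `A^X` is taken to be all of `(ρ^τ)⁻¹(T S^X)`, which corresponds under `leg` to `(ρ^{τ^*})⁻¹(T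
  -- M_{k+1})`.
  refine ⟨?_, ⟨W, hW, fun m hm => ⟨hWC m hm, hlW m hm⟩, hS⟩,
    isLieSubalgebroid_leg_image hL hreg hC A hCe hCb,
    prolongationTo (IE B F) A TotalSpace.proj (sodeSet A L k X), ?_, ?_, ?_⟩
  · rw [← hS]
    exact isEmbeddedSubmanifold_image_of_section (contMDiff_leg hL) hM hW hlW
  · rw [← hS]
    exact isLieSubalgebroid_image_of_section hL hM hW hlW A hMb
  · exact fun e _ z hz => ⟨hz.1, tangentTo_mono (fun e' he' => he'.1) e hz.2⟩
  · rw [← hS]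
    exact isLieAlgebroidIso_leg hL hM hW hlW A
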